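/- **Definitions.** A directed $s$-$t$ graph is a finite directed graph without parallel edges with two designated vertices $s$ and $t$ ($s=t$ is allowed); DAG means directed acyclic graph. Paths are simple, and are directed in a directed graph; $V(P)$ is the vertex set of the path $P$. A *tracking set* of a DAG $G$ with designated $s,t$ is a set $T\subseteq V(G)$ with $T\cap V(P_1)\ne T\cap V(P_2)$ for all distinct $s$-$t$ paths $P_1,P_2$. An instance $(G,k)$, $k\in\mathbb N=\{0,1,\dots\}$, of Tracking Paths in DAGs is a YES instance if $G$ has a tracking set of size at most $k$. An instance $(G,k)$ of Tracking Shortest Paths consists of a finite simple undirected graph $G$ with designated $s,t$ and of $k\in\mathbb N$; it is a YES instance if there is a set of at most $k$ vertices that meets the vertex sets of any two distinct shortest $s$-$t$ paths in different sets. The *reduction rules* for a DAG $G$ are the following. 1. Delete a vertex other than $s,t$, or an edge, that lies on no $s$-$t$ path. 2. If $s\neq t$ and $\deg(s)=1$ and $(s,u)\in E(G)$, delete $s$ and set $s:=u$; if $s\ne t$ and $\deg(t)=1$ and $(v,t)\in E(G)$, delete $t$ and set $t:=v$. 3. If $(x,y),(y,z)\in E(G)$, $\deg(x)=\deg(y)=2$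 and $x,y\notin\{s,t\}$, delete $y$ and insert the edge $(x,z)$. Here $\deg$ is in-degree plus out-degree. A DAG is *reduced* if no rule applies to it. A set $T\subseteq V(G)$ satisfies the *tracking set condition* if for all $u,v\in T\cup\{s,t\}$ there is at most one path from $u$ to $v$ in the subgraph of $G$ induced on $V(G)\setminus(T\setminus\{u,v\})$. The machine is a word RAM: a program works on finitely many integer variables and arrays, and assignments, additions, truncated subtractions, comparisons, array reads and array writes take one step each. A graph with $n$ vertices and $m$ edges is given by arbitrary adjacency lists (out-neighbours in the directed case), stored in one array with an array of offsets. All values and array indices used are at most a fixed power of $n+m+k+2$, that is, words have $O(\log(n+m+k+2))$ bits. **Theorem.** (a) There is a word RAM program that, given a DAG $G$ with $n$ vertices, $m$ edges and designated $s,t$, and given $k\in\mathbb N$, decides whether $(G,k)$ is a YES instance of Tracking Paths in DAGs in time $O\big(2^{k^2+3k}\,\max(k,1)^2\,(m+n)\big)$. (b) There is a word RAM program that decides Tracking Shortest Paths, for undirected graphs with $n$ vertices and $m$ edges, in time $O\big(2^{k^2+3k}\,\max(k,1)^2\,(m+n)\big)$. (c) If a DAG has $p$ $s$-$t$ paths,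 then each of its tracking sets has at least $\lg p$ elements (for $p\ge1$), where $\lg$ is the logarithm to base $2$. (d) From every DAG $G$ one arrives at a reduced graph by applying reduction rules finitely many times. For each reduced graph $G'$ obtained in this way, $G'$ is a DAG; for every $k$, $(G,k)$ is a YES instance if and only if $(G',k)$ is; if $G'$ has an $s$-$t$ path at all, it has at least $|V(G')|/5$ of them; if $(G,k)$ is a YES instance, then $|V(G')|\le 5\cdot 2^k$; and a set $T\subseteq V(G')$ is a tracking set of $G'$ if and only if it satisfies the tracking set condition. -/

import Mathlib

/-! ## Directed graphs with a source and a destination -/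

/-- A finite directed graph (no parallel edges) with two designated vertices: the source `s`
and the destination `t`. -/
structure STDigraph (α : Type*) where
  verts : Finset α
  edges : Finset (α × α)
  s : α
  t : α

namespace STDigraph

variable {α : Type*}

/-- `G` is a directed acyclic `s`-`t` graph: `s` and `t` are vertices, edges join vertices, and
there is no directed cycle. -/
structure IsDAG (G : STDigraph α) : Prop where
  s_mem : G.s ∈ G.verts
  t_mem : G.t ∈ G.verts
  edges_mem : ∀ e ∈ G.edges, e.1 ∈ G.verts ∧ e.2 ∈ G.verts
  acyclic : ∀ v, ¬ Relation.TransGen (fun a b => (a, b) ∈ G.edges) v v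

/-- `l` is the vertex sequence of a (simple, directed) path from `u` to `v`. -/
structure IsPath (G : STDigraph α) (u v : α) (l : List α) : Prop where
  head_eq : l.head? = some u
  last_eq : l.getLast? = some v
  mem_verts : ∀ x ∈ l, x ∈ G.verts
  nodup : l.Nodup
  chain : l.IsChain (fun a b => (a, b) ∈ G.edges)

/-- The set of all `s`-`t` paths. -/
def paths (G : STDigraph α) : Set (List α) := {l | G.IsPath G.s G.t l}

variable [DecidableEq α]

/-- `T` is a tracking set for the `s`-`t` paths of `G`. -/
def IsTrackingSet (G : STDigraph α) (T : Finset α) : Prop :=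
  T ⊆ G.verts ∧ ∀ P₁ ∈ G.paths, ∀ P₂ ∈ G.paths, P₁ ≠ P₂ → T ∩ P₁.toFinset ≠ T ∩ P₂.toFinset

/-- `(G, k)` is a YES instance: there is a tracking set of size at most `k`. -/
def IsYes (G : STDigraph α) (k : ℕ) : Prop :=
  ∃ T : Finset α, G.IsTrackingSet T ∧ T.card ≤ k

/-- In-degree plus out-degree. -/
def deg (G : STDigraph α) (v : α) : ℕ :=
  (G.edges.filter (fun e => e.1 = v)).card + (G.edges.filter (fun e => e.2 = v)).card

/-- The subgraph induced on the vertices in `W`. -/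
def induce (G : STDigraph α) (W : Finset α) : STDigraph α where
  verts := G.verts ∩ W
  edges := G.edges.filter (fun e => e.1 ∈ W ∧ e.2 ∈ W)
  s := G.s
  t := G.t

/-- Delete the vertex `v` with its incident edges. -/
def deleteVert (G : STDigraph α) (v : α) : STDigraph α := G.induce (G.verts.erase v)

/-- One application of a reduction rule:
* delete a vertex or an edge that lies on no `s`-`t` path;
* if the source (destination) has degree one, delete it and let its neighbour take its role;
* if `x → y → z` where `x` and `y`, both different from `s` and `t`, have degree two, delete `y`
  and insert the edge `(x, z)`. -/
inductive Step : STDigraph α → STDigraph α → Prop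
  | vert (G : STDigraph α) (v : α) : v ∈ G.verts → v ≠ G.s → v ≠ G.t →
      (∀ P ∈ G.paths, v ∉ P) → Step G (G.deleteVert v)
  | edge (G : STDigraph α) (u v : α) : (u, v) ∈ G.edges →
      (∀ P ∈ G.paths, ¬ [u, v] <:+: P) → Step G { G with edges := G.edges.erase (u, v) }
  | source (G : STDigraph α) (u : α) : G.s ≠ G.t → G.deg G.s = 1 → (G.s, u) ∈ G.edges →
      Step G { G.deleteVert G.s with s := u }
  | dest (G : STDigraph α) (v : α) : G.s ≠ G.t → G.deg G.t = 1 → (v, G.t) ∈ G.edges →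
      Step G { G.deleteVert G.t with t := v }
  | degTwo (G : STDigraph α) (x y z : α) : (x, y) ∈ G.edges → (y, z) ∈ G.edges →
      G.deg x = 2 → G.deg y = 2 → x ≠ G.s → x ≠ G.t → y ≠ G.s → y ≠ G.t →
      Step G { G.deleteVert y with edges := insert (x, z) (G.deleteVert y).edges }

/-- No reduction rule is applicable. -/
def IsReduced (G : STDigraph α) : Prop := ∀ G', ¬ Step G G'

/-- The tracking set condition: for all `u, v ∈ T ∪ {s, t}` there is at most one path from `u` to
`v` in the subgraph induced on `V ∖ (T ∖ {u, v})`. -/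
def TrackingSetCondition (G : STDigraph α) (T : Finset α) : Prop :=
  ∀ u ∈ T ∪ {G.s, G.t}, ∀ v ∈ T ∪ {G.s, G.t}, ∀ P₁ P₂ : List α,
    (G.induce (G.verts \ (T \ {u, v}))).IsPath u v P₁ →
    (G.induce (G.verts \ (T \ {u, v}))).IsPath u v P₂ → P₁ = P₂

end STDigraph

/-! ## Shortest paths in undirected graphs -/

/-- `T` is a tracking set for the shortest `s`-`t` paths of the undirected graph `G`. -/
def IsShortestTrackingSet {V : Type*} [DecidableEq V] (G : SimpleGraph V) (s t : V)
    (T : Finset V) : Prop :=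
  ∀ P₁ P₂ : G.Walk s t, P₁.IsPath → P₁.length = G.dist s t → P₂.IsPath →
    P₂.length = G.dist s t → P₁ ≠ P₂ → T ∩ P₁.support.toFinset ≠ T ∩ P₂.support.toFinset

/-- `(G, k)` is a YES instance of the problem of tracking shortest paths. -/
def IsShortestYes {V : Type*} [DecidableEq V] (G : SimpleGraph V) (s t : V) (k : ℕ) : Prop :=
  ∃ T : Finset V, IsShortestTrackingSet G s t T ∧ T.card ≤ k

/-! ## A word RAM

Programs work on finitely many integer variables and finitely many integer arrays. An elementary
instruction is an assignment (of a constant, a variable, a sum or truncated difference of two of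
these, or an array entry), a write to an array, or a comparison; each of them takes one step. -/

namespace RAM

/-- An operand: a constant of the program, or a variable. -/
inductive Operand
  | const (c : ℕ)
  | var (x : ℕ)

/-- Right-hand sides of assignments; `read A i` is the entry `i` of the array `A`. -/
inductive Expr
  | atom (a : Operand)
  | add (a b : Operand)
  | sub (a b : Operand)
  | read (A : ℕ) (i : Operand)

/-- Comparisons. -/
inductive Test
  | lt (a b : Operand)
  | le (a b : Operand)
  | eq (a b : Operand)
  | ne (a b : Operand)

/-- Programs. -/
inductive Prog
  | skip
  | assign (x : ℕ) (e : Expr)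
  | store (A : ℕ) (i a : Operand)
  | seq (p q : Prog)
  | ite (b : Test) (p q : Prog)
  | while (b : Test) (p : Prog)

/-- The values of the variables and of the array entries. -/
structure State where
  vars : ℕ → ℕ
  arrs : ℕ → ℕ → ℕ

/-- The value of an operand. -/
def Operand.eval (σ : State) : Operand → ℕ
  | .const c => c
  | .var x => σ.vars x

/-- The value of a right-hand side. -/
def Expr.eval (σ : State) : Expr → ℕ
  | .atom a => a.eval σ
  | .add a b => a.eval σ + b.eval σ
  | .sub a b => a.eval σ - b.eval σ
  | .read A i => σ.arrs A (i.eval σ)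

/-- The outcome of a comparison. -/
def Test.Holds (σ : State) : Test → Prop
  | .lt a b => a.eval σ < b.eval σ
  | .le a b => a.eval σ ≤ b.eval σ
  | .eq a b => a.eval σ = b.eval σ
  | .ne a b => a.eval σ ≠ b.eval σ

/-- Write `v` to the variable `x`. -/
def State.setVar (σ : State) (x v : ℕ) : State :=
  { σ with vars := Function.update σ.vars x v }

/-- Write `v` to the entry `i` of the array `A`. -/
def State.setArr (σ : State) (A i v : ℕ) : State :=
  { σ with arrs := Function.update σ.arrs A (Function.update (σ.arrs A) i v) }

/-- `Exec B p σ σ' τ`: the program `p`, started in the state `σ`, halts in the state `σ'` after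
exactly `τ` steps, and during the run no value larger than `B` is written, and no array entry with
an index larger than `B` is accessed. -/
inductive Exec (B : ℕ) : Prog → State → State → ℕ → Prop
  | skip (σ : State) : Exec B .skip σ σ 1
  | assign (σ : State) (x : ℕ) (e : Expr) :
      e.eval σ ≤ B → (∀ A i, e = .read A i → i.eval σ ≤ B) →
      Exec B (.assign x e) σ (σ.setVar x (e.eval σ)) 1
  | store (σ : State) (A : ℕ) (i a : Operand) : i.eval σ ≤ B → a.eval σ ≤ B →
      Exec B (.store A i a) σ (σ.setArr A (i.eval σ) (a.eval σ)) 1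
  | seq {p q : Prog} {σ₁ σ₂ σ₃ : State} {τ₁ τ₂ : ℕ} :
      Exec B p σ₁ σ₂ τ₁ → Exec B q σ₂ σ₃ τ₂ → Exec B (.seq p q) σ₁ σ₃ (τ₁ + τ₂)
  | ite_true {b : Test} {p q : Prog} {σ σ' : State} {τ : ℕ} :
      b.Holds σ → Exec B p σ σ' τ → Exec B (.ite b p q) σ σ' (τ + 1)
  | ite_false {b : Test} {p q : Prog} {σ σ' : State} {τ : ℕ} :
      ¬ b.Holds σ → Exec B q σ σ' τ → Exec B (.ite b p q) σ σ' (τ + 1)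
  | while_true {b : Test} {p : Prog} {σ₁ σ₂ σ₃ : State} {τ₁ τ₂ : ℕ} :
      b.Holds σ₁ → Exec B p σ₁ σ₂ τ₁ → Exec B (.while b p) σ₂ σ₃ τ₂ →
      Exec B (.while b p) σ₁ σ₃ (τ₁ + τ₂ + 1)
  | while_false {b : Test} {p : Prog} {σ : State} :
      ¬ b.Holds σ → Exec B (.while b p) σ σ 1

/-- The initial state for a graph on the vertices `0, …, n - 1` given by adjacency lists `L`.
Variables `0, 1, 2, 3` hold `n, s, t, k`; array `1` holds the concatenation of the lists
`L 0, …, L (n - 1)`, and entry `v` of array `0` is the position in it at which the list of `v`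
starts (entry `n` is the total length). Everything else is zero. -/
def init {n : ℕ} (L : Fin n → List (Fin n)) (s t : Fin n) (k : ℕ) : State where
  vars := fun x =>
    if x = 0 then n else if x = 1 then s else if x = 2 then t else if x = 3 then k else 0
  arrs := fun A i =>
    if A = 0 then ((List.ofFn L).take i).flatten.length
    else if A = 1 then ((List.ofFn L).flatten.map Fin.val).getD i 0
    else 0

/-- Within `τ` steps, on values and indices at most `B`, the program halts, with variable `0`
equal to `1` if `answer` holds and to `0` otherwise. -/
def DecidesWithin (p : Prog) (B : ℕ) (σ : State) (answer : Prop) (τ : ℕ) : Prop :=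
  ∃ (σ' : State) (τ' : ℕ), Exec B p σ σ' τ' ∧ τ' ≤ τ ∧
    (answer → σ'.vars 0 = 1) ∧ (¬ answer → σ'.vars 0 = 0)

end RAM

/-! The lower bound (c) is the remark that P ↦ T ∩ V(P) maps the s-t paths injectively into the
power set of T, so p ≤ 2^|T|.

For (d), each reduction rule comes with a correspondence between the paths of the two graphs, and
trackers that would disappear are moved to a vertex with the same effect (`IsYes.transfer`).
Vertices plus edges decrease in every step, so reduction ends. The size bound rests on
`IsDAG.card_edges_add_two_le`: if all vertices lie between s and t, there are at least m - n + 2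
paths. Indeed, choose one default out-edge at each vertex other than t. Every other edge e gives a
path whose last non-default edge is e, and following defaults from s gives one more. In a reduced
graph the inner vertices of degree two are pairwise non-adjacent and the other inner vertices have
degree at least three, so counting degrees turns the inequality into n ≤ 5p.

The tracking set condition is analysed through clashes. A clash for u is a vertex b with two
distinct predecessors, both reachable from u and with edges into b, where only edges leaving u or a
vertex outside T are used. If two s-t paths have the same trace on T, compare them from their ends
backwards. They split at some b, and the last vertex of T ∪ {s} before b is the same vertex u on
both, because the graph is acyclic; this is a clash (`IsDAG.exists_clash`). A clash extends beyond b
to two u-v paths violating the condition. Two paths violating the condition extend to s-t paths with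
equal traces. Hence being a tracking set, the condition and the absence of clashes for u ∈ T ∪ {s}
are equivalent once the graph is trimmed.

The algorithm for (a) does not construct the reduced graph. It sorts the edges topologically and
discards those on no s-t path. If u → v is the only edge leaving u and the only edge entering v,
then u and v lie on the same paths, so trackers may be restricted to the heads of the chains of such
edges. By the path count there are at most 3p heads, hence at most 3·2^k in a YES instance. If there
are more, the answer is NO. Otherwise at most (3·2^k)^k ≤ 2^(k²+3k) tuples of heads are tested, each
by k + 1 searches for clashes. On a sorted edge list one search is a single linear pass, because
every edge into a vertex precedes every edge out of it.

For (b), breadth-first search from s lists the edges along which the distance from s increases,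
already in sorted order. The s-t paths along these edges are exactly the shortest s-t paths, and the
decision procedure for sorted lists applies.

The run of a program is analysed with weakest preconditions `wp` that also bound the number of steps
and the size of all values. -/

namespace STDigraph

/-! ### Chains and paths in acyclic digraphs -/

variable {α : Type*}

/-- `G.Adj a b`: there is an edge from `a` to `b`. -/
abbrev Adj (G : STDigraph α) (a b : α) : Prop := (a, b) ∈ G.edges

open Relation

theorem IsDAG.adj_irrefl {G : STDigraph α} (hG : G.IsDAG) (a : α) : ¬ G.Adj a a :=
  fun h => hG.acyclic a (.single h)

theorem IsDAG.antisymm {G : STDigraph α} (hG : G.IsDAG) {u v : α}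
    (h₁ : ReflTransGen G.Adj u v) (h₂ : ReflTransGen G.Adj v u) : u = v := by
  rcases reflTransGen_iff_eq_or_transGen.1 h₁ with h | h
  · exact h.symm
  · exact (hG.acyclic u (h.trans_left h₂)).elim

theorem IsDAG.not_reach {G : STDigraph α} (hG : G.IsDAG) {u v : α}
    (h₁ : G.Adj u v) (h₂ : ReflTransGen G.Adj v u) : False :=
  hG.acyclic u (TransGen.head' h₁ h₂)

theorem IsDAG.mem_of_reach {G : STDigraph α} (hG : G.IsDAG) {u v : α} (hu : u ∈ G.verts)
    (h : ReflTransGen G.Adj u v) : v ∈ G.verts := by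
  induction h with
  | refl => exact hu
  | tail _ h _ => exact (hG.edges_mem _ h).2

theorem nodup_of_isChain {r : α → α → Prop} (hr : ∀ v, ¬ TransGen r v v) {l : List α}
    (h : l.IsChain r) : l.Nodup := by
  have : l.Pairwise (TransGen r) :=
    List.isChain_iff_pairwise.1 (h.imp fun a b hab => TransGen.single hab)
  refine this.imp ?_
  rintro a b hab rfl
  exact hr a hab

theorem reach_of_isChain {r : α → α → Prop} {u v : α} {l : List α} (h : l.IsChain r)
    (hu : l.head? = some u) (hv : l.getLast? = some v) : ReflTransGen r u v := by
  induction l generalizing u with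
  | nil => simp at hu
  | cons a l ih =>
    obtain rfl : a = u := by simpa using hu
    cases l with
    | nil => obtain rfl : a = v := by simpa using hv
             exact .refl
    | cons b l =>
      rw [List.isChain_cons_cons] at h
      exact .head h.1 (ih h.2 rfl (by simpa using hv))

theorem exists_isChain {r : α → α → Prop} {u v : α} (h : ReflTransGen r u v) :
    ∃ l : List α, l.IsChain r ∧ l.head? = some u ∧ l.getLast? = some v := by
  induction h using ReflTransGen.head_induction_on with
  | refl => exact ⟨[v], by simp⟩
  | @head a c hac _ ih =>
    obtain ⟨l, h1, h2, h3⟩ := ih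
    refine ⟨a :: l, ?_, rfl, ?_⟩
    · exact h1.cons fun y hy => by
        rw [h2] at hy; cases hy; exact hac
    · cases l with
      | nil => simp at h2
      | cons b l => simpa using h3

namespace IsPath

variable {G : STDigraph α} {u v w z : α} {l l₁ l₂ : List α}

theorem ne_nil (h : G.IsPath u v l) : l ≠ [] := by
  rintro rfl; simpa using h.head_eq

theorem reach (h : G.IsPath u v l) : ReflTransGen G.Adj u v :=
  reach_of_isChain h.chain h.head_eq h.last_eq

theorem head_mem (h : G.IsPath u v l) : u ∈ l := List.mem_of_mem_head? h.head_eq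

theorem last_mem (h : G.IsPath u v l) : v ∈ l := List.mem_of_mem_getLast? h.last_eq

theorem left {x : α} (h : G.IsPath u v (l₁ ++ x :: l₂)) : G.IsPath u x (l₁ ++ [x]) where
  head_eq := by have := h.head_eq; cases l₁ <;> simpa using this
  last_eq := by simp
  mem_verts y hy := h.mem_verts y (by simp at hy ⊢; tauto)
  nodup := h.nodup.sublist (by simp)
  chain := h.chain.prefix ⟨l₂, by simp⟩

theorem right {x : α} (h : G.IsPath u v (l₁ ++ x :: l₂)) : G.IsPath x v (x :: l₂) where
  head_eq := rfl
  last_eq := by have := h.last_eq; simpa [List.getLast?_append] using this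
  mem_verts y hy := h.mem_verts y (by simp at hy ⊢; tauto)
  nodup := h.nodup.sublist (by simp)
  chain := h.chain.suffix ⟨l₁, by simp⟩

theorem reach_mem {x : α} (h : G.IsPath u v l) (hx : x ∈ l) :
    ReflTransGen G.Adj u x ∧ ReflTransGen G.Adj x v := by
  obtain ⟨l₁, l₂, rfl⟩ := List.append_of_mem hx
  exact ⟨h.left.reach, h.right.reach⟩

end IsPath

theorem IsDAG.isPath {G : STDigraph α} (hG : G.IsDAG) {u v : α} {l : List α} (hu : u ∈ G.verts)
    (h1 : l.head? = some u) (h2 : l.getLast? = some v) (h3 : l.IsChain G.Adj) :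
    G.IsPath u v l where
  head_eq := h1
  last_eq := h2
  mem_verts x hx := by
    obtain ⟨l₁, l₂, rfl⟩ := List.append_of_mem hx
    refine hG.mem_of_reach hu (reach_of_isChain (l := l₁ ++ [x]) (h3.prefix ⟨l₂, by simp⟩) ?_ (by simp))
    cases l₁ <;> simpa using h1
  nodup := nodup_of_isChain hG.acyclic h3
  chain := h3

theorem IsDAG.exists_isPath {G : STDigraph α} (hG : G.IsDAG) {u v : α} (hu : u ∈ G.verts)
    (h : ReflTransGen G.Adj u v) : ∃ l, G.IsPath u v l := by
  obtain ⟨l, h1, h2, h3⟩ := exists_isChain h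
  exact ⟨l, hG.isPath hu h2 h3 h1⟩

theorem IsDAG.isPath_append {G : STDigraph α} (hG : G.IsDAG) {u v w z : α} {l₁ l₂ : List α}
    (h₁ : G.IsPath u v l₁) (h : G.Adj v w) (h₂ : G.IsPath w z l₂) : G.IsPath u z (l₁ ++ l₂) := by
  refine hG.isPath (h₁.mem_verts _ h₁.head_mem) ?_ ?_ ?_
  · simp [List.head?_append, h₁.head_eq]
  · simp [List.getLast?_append, h₂.last_eq]
  · refine h₁.chain.append h₂.chain fun x hx y hy => ?_
    rw [h₁.last_eq] at hx; rw [h₂.head_eq] at hy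
    cases hx; cases hy; exact h

/-- Paths are glued at a common vertex. -/
theorem IsDAG.isPath_glue {G : STDigraph α} (hG : G.IsDAG) {u v z : α} {l₁ l₂ : List α}
    (h₁ : G.IsPath u v l₁) (h₂ : G.IsPath v z l₂) : G.IsPath u z (l₁ ++ l₂.tail) := by
  cases l₂ with
  | nil => exact (h₂.ne_nil rfl).elim
  | cons a l =>
    obtain rfl : a = v := by simpa using h₂.head_eq
    cases l with
    | nil =>
      obtain rfl : a = z := by simpa using h₂.last_eq
      simpa using h₁
    | cons b l =>
      have := h₂.chain
      rw [List.isChain_cons_cons] at this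
      exact hG.isPath_append h₁ this.1 (IsPath.right (l₁ := [a]) h₂)

theorem IsDAG.wellFounded {G : STDigraph α} (hG : G.IsDAG) : WellFounded G.Adj := by
  have hfin : (G.edges : Set (α × α)).Finite := G.edges.finite_toSet
  refine WellFounded.mono (r := TransGen G.Adj) ?_ fun a b h => .single h
  -- The ambient type may be infinite, but every vertex with a successor is the tail of one of
  -- finitely many edges, and only such vertices occur as predecessors.
  have : Finite {x // ∃ y, TransGen G.Adj x y} := by
    refine (G.edges.finite_toSet.image Prod.fst).subset ?_
    rintro x ⟨y, h⟩
    obtain ⟨z, h, -⟩ := (TransGen.head'_iff).1 h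
    exact ⟨(x, z), h, rfl⟩
  let r : {x // ∃ y, TransGen G.Adj x y} → {x // ∃ y, TransGen G.Adj x y} → Prop :=
    fun a b => TransGen G.Adj a.1 b.1
  have : IsTrans _ r := ⟨fun a b c h1 h2 => h1.trans h2⟩
  have : Std.Irrefl r := ⟨fun a h => hG.acyclic _ h⟩
  have hwf : WellFounded r := Finite.wellFounded_of_trans_of_irrefl r
  have key : ∀ a : {x // ∃ y, TransGen G.Adj x y}, Acc (TransGen G.Adj) a.1 := fun a => by
    induction a using hwf.induction with
    | _ a ih => exact ⟨_, fun b hb => ih ⟨b, _, hb⟩ hb⟩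
  exact ⟨fun a => ⟨_, fun b hb => key ⟨b, _, hb⟩⟩⟩

/-- The digraph with all edges reversed. -/
def rev (G : STDigraph α) : STDigraph α where
  verts := G.verts
  edges := G.edges.map (Equiv.prodComm α α).toEmbedding
  s := G.t
  t := G.s

theorem rev_adj {G : STDigraph α} {a b : α} : G.rev.Adj a b ↔ G.Adj b a := by
  simp [rev, Adj]

theorem IsDAG.rev {G : STDigraph α} (hG : G.IsDAG) : G.rev.IsDAG where
  s_mem := hG.t_mem
  t_mem := hG.s_mem
  edges_mem := by
    rintro ⟨a, b⟩ h
    have := hG.edges_mem _ (rev_adj.1 h)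
    exact ⟨this.2, this.1⟩
  acyclic v h := by
    exact hG.acyclic v (transGen_swap.1
      (TransGen.mono (p := Function.swap G.Adj) (fun a b hab => rev_adj.1 hab) v v h))

theorem IsPath.rev {G : STDigraph α} {u v : α} {l : List α} (h : G.IsPath u v l) :
    G.rev.IsPath v u l.reverse where
  head_eq := by simpa using h.last_eq
  last_eq := by simpa using h.head_eq
  mem_verts x hx := h.mem_verts x (by simpa using hx)
  nodup := by simpa using h.nodup
  chain := by
    rw [List.isChain_reverse]
    exact h.chain.imp fun a b hab => rev_adj.2 hab

variable [DecidableEq α]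

/-! ### Tracking sets and the number of paths -/

theorem isTrackingSet_iff {G : STDigraph α} {T : Finset α} : G.IsTrackingSet T ↔
    T ⊆ G.verts ∧ ∀ P₁ ∈ G.paths, ∀ P₂ ∈ G.paths, (∀ v ∈ T, v ∈ P₁ ↔ v ∈ P₂) → P₁ = P₂ := by
  refine and_congr_right fun _ => forall₄_congr fun P₁ _ P₂ _ => ?_
  rw [not_imp_comm, ← not_imp_comm, not_imp_not]
  refine imp_congr_left ?_
  simp only [Finset.ext_iff, Finset.mem_inter, List.mem_toFinset, and_congr_right_iff]

theorem IsTrackingSet.injOn {G : STDigraph α} {T : Finset α} (h : G.IsTrackingSet T) :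
    Set.InjOn (fun P : List α => T ∩ P.toFinset) G.paths :=
  fun P₁ h₁ P₂ h₂ e => by_contra fun hne => h.2 P₁ h₁ P₂ h₂ hne e

theorem IsTrackingSet.paths_ncard_le {G : STDigraph α} {T : Finset α} (h : G.IsTrackingSet T) :
    G.paths.ncard ≤ 2 ^ T.card := by
  rw [← Finset.card_powerset, ← Set.ncard_coe_finset]
  refine Set.ncard_le_ncard_of_injOn _ ?_ h.injOn (Finset.finite_toSet _)
  intro P _
  simp

theorem IsTrackingSet.logb_ncard_le {G : STDigraph α} {T : Finset α} (h : G.IsTrackingSet T) :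
    Real.logb 2 (G.paths.ncard : ℝ) ≤ (T.card : ℝ) := by
  rcases Nat.eq_zero_or_pos G.paths.ncard with h0 | h0
  -- The logarithm of zero is zero by convention, so the bound also holds when there is no path.
  · simp [h0]
  · rw [Real.logb_le_iff_le_rpow (by norm_num) (by exact_mod_cast h0), Real.rpow_natCast]
    exact_mod_cast h.paths_ncard_le

theorem IsTrackingSet.mono {G : STDigraph α} {T T' : Finset α} (h : G.IsTrackingSet T)
    (hT : T ⊆ T') (hT' : T' ⊆ G.verts) : G.IsTrackingSet T' := by
  rw [isTrackingSet_iff] at h ⊢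
  exact ⟨hT', fun P₁ h₁ P₂ h₂ e => h.2 P₁ h₁ P₂ h₂ fun v hv => e v (hT hv)⟩

/-- In a DAG the vertex set is a tracking set. -/
theorem IsDAG.isTrackingSet_verts {G : STDigraph α} (hG : G.IsDAG) : G.IsTrackingSet G.verts := by
  rw [isTrackingSet_iff]
  refine ⟨subset_rfl, fun P₁ h₁ P₂ h₂ e => ?_⟩
  have hmem : ∀ v, v ∈ P₁ ↔ v ∈ P₂ := fun v =>
    ⟨fun h => (e v (h₁.mem_verts v h)).1 h, fun h => (e v (h₂.mem_verts v h)).2 h⟩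
  -- A path lists its vertices in increasing order for strict reachability, which is antisymmetric.
  -- Two paths with the same vertices are therefore sorted permutations of each other, hence equal.
  have hp : P₁.Perm P₂ := (List.perm_ext_iff_of_nodup h₁.nodup h₂.nodup).2 hmem
  have hs : ∀ P ∈ G.paths, P.Pairwise (TransGen G.Adj) := fun P hP =>
    List.isChain_iff_pairwise.1 (hP.chain.imp fun a b hab => TransGen.single hab)
  exact hp.eq_of_pairwise
    (fun a b _ _ h1 h2 => (hG.acyclic a (h1.trans h2)).elim) (hs _ h₁) (hs _ h₂)

theorem IsDAG.finite_paths {G : STDigraph α} (hG : G.IsDAG) : G.paths.Finite :=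
  Set.Finite.of_finite_image (Set.Finite.subset (G.verts.powerset.finite_toSet)
    (by rintro _ ⟨P, _, rfl⟩; simp)) hG.isTrackingSet_verts.injOn

end STDigraph

/-! ### The reduction rules preserve acyclicity and YES instances -/

namespace STDigraph

open Relation

variable {α : Type*}

/-- The terminal rules only rename s or t after a deletion; paths between given ends do not notice
this. -/
theorem isPath_congr {G G' : STDigraph α} (hv : G.verts = G'.verts) (he : G.edges = G'.edges)
    {u v : α} {l : List α} : G.IsPath u v l ↔ G'.IsPath u v l := by
  constructor
  · rintro ⟨h1, h2, h3, h4, h5⟩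
    exact ⟨h1, h2, hv ▸ h3, h4, he ▸ h5⟩
  · rintro ⟨h1, h2, h3, h4, h5⟩
    exact ⟨h1, h2, hv ▸ h3, h4, he ▸ h5⟩

theorem paths_rev {G : STDigraph α} {P : List α} : P ∈ G.rev.paths ↔ P.reverse ∈ G.paths := by
  have key : ∀ (G : STDigraph α) P, P ∈ G.paths → P.reverse ∈ G.rev.paths := fun G P h => h.rev
  refine ⟨fun h => ?_, fun h => by simpa using key _ _ h⟩
  have h2 := key _ _ h
  have : G.rev.rev = G := by
    cases G
    simp only [rev, Finset.map_map]
    congr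
    convert Finset.map_refl
    ext ⟨a, b⟩ <;> rfl
  rwa [this] at h2

variable [DecidableEq α]

theorem induce_isPath {G : STDigraph α} {W : Finset α} {u v : α} {l : List α} :
    (G.induce W).IsPath u v l ↔ G.IsPath u v l ∧ ∀ x ∈ l, x ∈ W := by
  constructor
  · rintro ⟨h1, h2, h3, h4, h5⟩
    have h3' : ∀ x ∈ l, x ∈ G.verts ∧ x ∈ W := fun x hx => Finset.mem_inter.1 (h3 x hx)
    exact ⟨⟨h1, h2, fun x hx => (h3' x hx).1, h4,
      h5.imp fun a b h => (Finset.mem_filter.1 h).1⟩, fun x hx => (h3' x hx).2⟩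
  · rintro ⟨⟨h1, h2, h3, h4, h5⟩, h6⟩
    exact ⟨h1, h2, fun x hx => Finset.mem_inter.2 ⟨h3 x hx, h6 x hx⟩, h4,
      h5.imp_of_mem_imp fun a b ha hb h => Finset.mem_filter.2 ⟨h, h6 a ha, h6 b hb⟩⟩

theorem deleteVert_isPath {G : STDigraph α} {w u v : α} {l : List α} :
    (G.deleteVert w).IsPath u v l ↔ G.IsPath u v l ∧ w ∉ l := by
  rw [deleteVert, induce_isPath]
  refine and_congr_right fun h => ?_
  simp only [Finset.mem_erase]
  exact ⟨fun h1 h2 => (h1 w h2).1 rfl, fun h1 x hx => ⟨fun e => h1 (e ▸ hx), h.mem_verts x hx⟩⟩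

/-- Tracking sets are carried along an injection between path sets that respects membership. -/
theorem IsTrackingSet.transfer {G G' : STDigraph α} {T : Finset α} (hT : G.IsTrackingSet T)
    (f : α → α) (ψ : List α → List α) (hf : ∀ v ∈ G.verts, f v ∈ G'.verts)
    (hψ : ∀ P ∈ G'.paths, ψ P ∈ G.paths)
    (hinj : ∀ P₁ ∈ G'.paths, ∀ P₂ ∈ G'.paths, ψ P₁ = ψ P₂ → P₁ = P₂)
    (htr : ∀ v ∈ G.verts, ∀ P₁ ∈ G'.paths, ∀ P₂ ∈ G'.paths,
      (f v ∈ P₁ ↔ f v ∈ P₂) → (v ∈ ψ P₁ ↔ v ∈ ψ P₂)) :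
    G'.IsTrackingSet (T.image f) := by
  rw [isTrackingSet_iff] at hT ⊢
  refine ⟨?_, fun P₁ h₁ P₂ h₂ h => ?_⟩
  · intro x hx
    obtain ⟨v, hv, rfl⟩ := Finset.mem_image.1 hx
    exact hf v (hT.1 hv)
  · refine hinj P₁ h₁ P₂ h₂ (hT.2 _ (hψ _ h₁) _ (hψ _ h₂) fun v hv => ?_)
    exact htr v (hT.1 hv) P₁ h₁ P₂ h₂ (h _ (Finset.mem_image_of_mem f hv))

theorem IsYes.transfer {G G' : STDigraph α} {k : ℕ} (hk : G.IsYes k)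
    (f : α → α) (ψ : List α → List α) (hf : ∀ v ∈ G.verts, f v ∈ G'.verts)
    (hψ : ∀ P ∈ G'.paths, ψ P ∈ G.paths)
    (hinj : ∀ P₁ ∈ G'.paths, ∀ P₂ ∈ G'.paths, ψ P₁ = ψ P₂ → P₁ = P₂)
    (htr : ∀ v ∈ G.verts, ∀ P₁ ∈ G'.paths, ∀ P₂ ∈ G'.paths,
      (f v ∈ P₁ ↔ f v ∈ P₂) → (v ∈ ψ P₁ ↔ v ∈ ψ P₂)) : G'.IsYes k := by
  obtain ⟨T, hT, hTk⟩ := hk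
  exact ⟨_, hT.transfer f ψ hf hψ hinj htr, Finset.card_image_le.trans hTk⟩

theorem isYes_rev {G : STDigraph α} {k : ℕ} : G.rev.IsYes k ↔ G.IsYes k := by
  constructor
  · intro h
    exact h.transfer id List.reverse (fun v h => h) (fun P h => paths_rev.2 (by simpa using h))
      (fun _ _ _ _ h => by simpa using h) (by simp)
  · intro h
    exact h.transfer id List.reverse (fun v h => h) (fun P h => paths_rev.1 h)
      (fun _ _ _ _ h => by simpa using h) (by simp)

theorem deg_rev (G : STDigraph α) (v : α) : G.rev.deg v = G.deg v := by
  rw [deg, deg, add_comm]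
  congr 1 <;>
  · rw [rev, Finset.filter_map, Finset.card_map]
    congr

theorem exists_out_of_deg {G : STDigraph α} {x y : α} (h : G.Adj x y)
    (h1 : (G.edges.filter (fun e => e.1 = x)).card ≤ 1) {w : α} (hw : G.Adj x w) : w = y := by
  have := Finset.card_le_one.1 h1 (x, w) (by simpa using hw) (x, y) (by simpa using h)
  simpa using this

theorem exists_in_of_deg {G : STDigraph α} {x y : α} (h : G.Adj x y)
    (h1 : (G.edges.filter (fun e => e.2 = y)).card ≤ 1) {w : α} (hw : G.Adj w y) : w = x := by
  have := Finset.card_le_one.1 h1 (w, y) (by simpa using hw) (x, y) (by simpa using h)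
  simpa using this

theorem out_pos {G : STDigraph α} {x y : α} (h : G.Adj x y) :
    0 < (G.edges.filter (fun e => e.1 = x)).card :=
  Finset.card_pos.2 ⟨(x, y), by simpa using h⟩

theorem in_pos {G : STDigraph α} {x y : α} (h : G.Adj x y) :
    0 < (G.edges.filter (fun e => e.2 = y)).card :=
  Finset.card_pos.2 ⟨(x, y), by simpa using h⟩

theorem not_adj_of_in_eq_zero {G : STDigraph α} {y : α}
    (h : (G.edges.filter (fun e => e.2 = y)).card = 0) (w : α) : ¬ G.Adj w y := fun hw => by
  have := in_pos hw; omega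

theorem IsDAG.deleteVert_adj {G : STDigraph α} (hG : G.IsDAG) {w a b : α} :
    (G.deleteVert w).Adj a b ↔ G.Adj a b ∧ a ≠ w ∧ b ≠ w := by
  simp only [Adj, deleteVert, induce, Finset.mem_filter, Finset.mem_erase]
  exact ⟨fun h => ⟨h.1, h.2.1.1, h.2.2.1⟩, fun h => ⟨h.1, ⟨h.2.1, (hG.edges_mem _ h.1).1⟩,
    ⟨h.2.2, (hG.edges_mem _ h.1).2⟩⟩⟩

theorem mem_deleteVert {G : STDigraph α} {w a : α} :
    a ∈ (G.deleteVert w).verts ↔ a ∈ G.verts ∧ a ≠ w := by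
  simp [deleteVert, induce]; tauto

/-- Adjacency after the degree-two rule has replaced `x → y → z` by `x → z`. -/
theorem IsDAG.degTwo_adj {G : STDigraph α} (hG : G.IsDAG) {x y z a b : α} :
    ({ G.deleteVert y with edges := insert (x, z) (G.deleteVert y).edges } : STDigraph α).Adj a b ↔
      (a = x ∧ b = z) ∨ G.Adj a b ∧ a ≠ y ∧ b ≠ y := by
  rw [← hG.deleteVert_adj]
  simp [Adj]

theorem Step.isDAG {G G' : STDigraph α} (h : Step G G') (hG : G.IsDAG) : G'.IsDAG := by
  have hdel : ∀ w a b, (G.deleteVert w).Adj a b → G.Adj a b := fun w a b h =>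
    (hG.deleteVert_adj.1 h).1
  have hmem : ∀ w, ∀ e ∈ (G.deleteVert w).edges,
      e.1 ∈ (G.deleteVert w).verts ∧ e.2 ∈ (G.deleteVert w).verts := by
    rintro w ⟨a, b⟩ h
    have h' := hG.deleteVert_adj.1 h
    have := hG.edges_mem _ h'.1
    exact ⟨mem_deleteVert.2 ⟨this.1, h'.2.1⟩, mem_deleteVert.2 ⟨this.2, h'.2.2⟩⟩
  have hac : ∀ w v, ¬ TransGen (G.deleteVert w).Adj v v := fun w v h =>
    hG.acyclic v (TransGen.mono (hdel w) v v h)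
  cases h with
  | vert v hv h1 h2 h3 =>
    exact ⟨mem_deleteVert.2 ⟨hG.s_mem, Ne.symm h1⟩, mem_deleteVert.2 ⟨hG.t_mem, Ne.symm h2⟩,
      hmem v, hac v⟩
  | edge u v h1 h2 =>
    exact ⟨hG.s_mem, hG.t_mem, fun e he => hG.edges_mem _ (Finset.mem_of_mem_erase he), fun v h =>
      hG.acyclic v (TransGen.mono (fun a b h => Finset.mem_of_mem_erase h) v v h)⟩
  | source u h1 h2 h3 =>
    refine ⟨mem_deleteVert.2 ⟨(hG.edges_mem _ h3).2, ?_⟩, mem_deleteVert.2 ⟨hG.t_mem, Ne.symm h1⟩,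
      hmem _, hac _⟩
    rintro rfl
    exact hG.adj_irrefl _ h3
  | dest v h1 h2 h3 =>
    refine ⟨mem_deleteVert.2 ⟨hG.s_mem, h1⟩, mem_deleteVert.2 ⟨(hG.edges_mem _ h3).1, ?_⟩,
      hmem _, hac _⟩
    rintro rfl
    exact hG.adj_irrefl _ h3
  | degTwo x y z h1 h2 h3 h4 h5 h6 h7 h8 =>
    have hxy : x ≠ y := by rintro rfl; exact hG.adj_irrefl _ h1
    have hzy : z ≠ y := by rintro rfl; exact hG.adj_irrefl _ h2
    refine ⟨mem_deleteVert.2 ⟨hG.s_mem, Ne.symm h7⟩, mem_deleteVert.2 ⟨hG.t_mem, Ne.symm h8⟩,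
      fun e he => ?_, fun v h => ?_⟩
    · rcases Finset.mem_insert.1 he with rfl | he
      · exact ⟨mem_deleteVert.2 ⟨(hG.edges_mem _ h1).1, hxy⟩,
          mem_deleteVert.2 ⟨(hG.edges_mem _ h2).2, hzy⟩⟩
      · exact hmem y e he
    · refine hG.acyclic v ?_
      clear h6 h7 h8 h5
      -- The inserted edge abbreviates x → y → z, so a cycle in the new graph unfolds to a cycle in
      -- the old one.
      have : ∀ a b, ({ G.deleteVert y with
          edges := insert (x, z) (G.deleteVert y).edges } : STDigraph α).Adj a b →
          TransGen G.Adj a b := by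
        intro a b hab
        rcases hG.degTwo_adj.1 hab with ⟨rfl, rfl⟩ | hab
        · exact .tail (.single h1) h2
        · exact .single hab.1
      exact TransGen.trans_induction_on (motive := fun {a b} _ => TransGen G.Adj a b) h
        (fun h => this _ _ h) (fun _ _ h1 h2 => h1.trans h2)

theorem Step.measure_lt {G G' : STDigraph α} (h : Step G G') (hG : G.IsDAG) :
    G'.verts.card + G'.edges.card < G.verts.card + G.edges.card := by
  have hv : ∀ w ∈ G.verts, (G.deleteVert w).verts.card < G.verts.card := fun w hw =>
    Finset.card_lt_card ⟨fun a h => (mem_deleteVert.1 h).1,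
      fun h => (mem_deleteVert.1 (h hw)).2 rfl⟩
  have he : ∀ w, (G.deleteVert w).edges.card ≤ G.edges.card := fun w =>
    Finset.card_le_card (Finset.filter_subset _ _)
  cases h with
  | vert v h => exact Nat.add_lt_add_of_lt_of_le (hv v h) (he v)
  | edge u v h => exact Nat.add_lt_add_left (Finset.card_erase_lt_of_mem h) _
  | source u h1 h2 h3 => exact Nat.add_lt_add_of_lt_of_le (hv _ hG.s_mem) (he _)
  | dest u h1 h2 h3 => exact Nat.add_lt_add_of_lt_of_le (hv _ hG.t_mem) (he _)
  | degTwo x y z h1 h2 h3 h4 h5 h6 h7 h8 =>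
    refine Nat.add_lt_add_of_lt_of_le (hv _ (hG.edges_mem _ h1).2) ?_
    -- Deleting y removes at least the edge (x, y), which pays for the inserted edge.
    refine (Finset.card_insert_le _ _).trans (Finset.card_lt_card ⟨Finset.filter_subset _ _, ?_⟩)
    exact fun h => (hG.deleteVert_adj.1 (h h1)).2.2 rfl

theorem IsDAG.exists_reduced {G : STDigraph α} (hG : G.IsDAG) :
    ∃ G', ReflTransGen Step G G' ∧ G'.IsReduced := by
  induction hm : G.verts.card + G.edges.card using Nat.strong_induction_on generalizing G with
  | _ m ih =>
    by_cases hr : G.IsReduced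
    · exact ⟨G, .refl, hr⟩
    · simp only [IsReduced, not_forall, not_not] at hr
      obtain ⟨G₁, h₁⟩ := hr
      obtain ⟨G', h2, h3⟩ := ih _ (hm ▸ h₁.measure_lt hG) (h₁.isDAG hG) rfl
      exact ⟨G', .head h₁ h2, h3⟩

/-- Since s ≠ t and (s, u) is the only edge at s, every path starts with s → u. Removing the first
vertex is a bijection from the old paths to the new ones. -/
theorem IsDAG.isYes_source {G : STDigraph α} (hG : G.IsDAG) {u : α} (h1 : G.s ≠ G.t)
    (h2 : G.deg G.s = 1) (h3 : (G.s, u) ∈ G.edges) (k : ℕ) :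
    G.IsYes k ↔ ({ G.deleteVert G.s with s := u } : STDigraph α).IsYes k := by
  have hout := out_pos h3
  have hG' := (Step.source G u h1 h2 h3).isDAG hG
  unfold deg at h2
  have hs : ∀ w, G.Adj G.s w → w = u := fun w hw => exists_out_of_deg h3 (by omega) hw
  have hin : ∀ w, ¬ G.Adj w G.s := not_adj_of_in_eq_zero (by omega)
  have hus : u ≠ G.s := by rintro e; rw [e] at h3; exact hG.adj_irrefl _ h3
  have key : ∀ P ∈ G.paths, ∃ Q, Q ∈ ({ G.deleteVert G.s with s := u } : STDigraph α).paths ∧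
      P = G.s :: Q := by
    intro P hP
    obtain _ | ⟨a, Q⟩ := P
    · exact (hP.ne_nil rfl).elim
    obtain rfl : a = G.s := by simpa using hP.head_eq
    obtain _ | ⟨b, Q⟩ := Q
    · exact (h1 (by simpa using hP.last_eq)).elim
    have hc := hP.chain
    rw [List.isChain_cons_cons] at hc
    obtain rfl := hs _ hc.1
    refine ⟨_, ?_, rfl⟩
    refine (isPath_congr (G := G.deleteVert G.s)
      (G' := { G.deleteVert G.s with s := b }) rfl rfl).1 ?_
    exact deleteVert_isPath.2 ⟨IsPath.right (l₁ := [G.s]) hP, (List.nodup_cons.1 hP.nodup).1⟩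
  have key2 : ∀ Q ∈ ({ G.deleteVert G.s with s := u } : STDigraph α).paths, G.s :: Q ∈ G.paths := by
    intro Q hQ
    have hQ' : G.IsPath u G.t Q := (deleteVert_isPath.1 ((isPath_congr (G := { G.deleteVert G.s with s := u })
      (G' := G.deleteVert G.s) rfl rfl).1 hQ)).1
    exact hG.isPath_append (l₁ := [G.s])
      ⟨rfl, rfl, by simpa using hG.s_mem, by simp, by simp⟩ h3 hQ'
  constructor
  · intro h
    -- The vertex s lies on every path, so a tracker there separates nothing; it is moved to u only
    -- to stay in the graph.
    refine h.transfer (fun w => if w = G.s then u else w) (fun Q => G.s :: Q) ?_ key2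
      (fun _ _ _ _ h => by simpa using h) ?_
    · intro v hv
      by_cases e : v = G.s
      · simp only [e, if_true]; exact hG'.s_mem
      · simp only [e, if_false]; exact mem_deleteVert.2 ⟨hv, e⟩
    · intro v hv P₁ _ P₂ _ h
      by_cases e : v = G.s
      · simp [e]
      · simpa [e] using h
  · intro h
    refine h.transfer id List.tail (fun v hv => (mem_deleteVert.1 hv).1) ?_ ?_ ?_
    · intro P hP
      obtain ⟨Q, hQ, rfl⟩ := key P hP
      exact hQ
    · intro P₁ hP₁ P₂ hP₂ h
      obtain ⟨Q, hQ, rfl⟩ := key _ hP₁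
      obtain ⟨Q', hQ', rfl⟩ := key _ hP₂
      simpa using h
    · intro v hv P₁ hP₁ P₂ hP₂ h
      have := (mem_deleteVert.1 hv).2
      obtain ⟨Q, hQ, rfl⟩ := key _ hP₁
      obtain ⟨Q', hQ', rfl⟩ := key _ hP₂
      simpa [this] using h

/-- Reversing all edges exchanges the two terminals and preserves tracking sets, so this is the
source rule for the reversed graph. -/
theorem IsDAG.isYes_dest {G : STDigraph α} (hG : G.IsDAG) {v : α} (h1 : G.s ≠ G.t)
    (h2 : G.deg G.t = 1) (h3 : (v, G.t) ∈ G.edges) (k : ℕ) :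
    G.IsYes k ↔ ({ G.deleteVert G.t with t := v } : STDigraph α).IsYes k := by
  rw [← isYes_rev, hG.rev.isYes_source (u := v) h1.symm ((deg_rev _ _).trans h2) (rev_adj.2 h3),
    ← isYes_rev (G := ({ G.deleteVert G.t with t := v } : STDigraph α))]
  have : ({ G.rev.deleteVert G.rev.s with s := v } : STDigraph α) =
      ({ G.deleteVert G.t with t := v } : STDigraph α).rev := by
    simp only [deleteVert, induce]
    rw [STDigraph.rev]
    congr 1
    ext ⟨a, b⟩
    simp
    tauto
  rw [this]

/-- The edges (x, y) and (y, z) exhaust the degree of y, so a path through y contains x → y → z.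
Conversely a path through x must continue to y. Thus x and y lie on the same paths, rerouting x → y
→ z along x → z matches the paths of both graphs, and a tracker at y can be moved to x. -/
theorem IsDAG.isYes_degTwo {G : STDigraph α} (hG : G.IsDAG) {x y z : α} (h1 : (x, y) ∈ G.edges)
    (h2 : (y, z) ∈ G.edges) (hx : G.deg x = 2) (hy : G.deg y = 2) (hxs : x ≠ G.s) (hxt : x ≠ G.t)
    (hys : y ≠ G.s) (hyt : y ≠ G.t) (k : ℕ) :
    G.IsYes k ↔ ({ G.deleteVert y with
      edges := insert (x, z) (G.deleteVert y).edges } : STDigraph α).IsYes k := by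
  have hG' := (Step.degTwo G x y z h1 h2 hx hy hxs hxt hys hyt).isDAG hG
  set G' : STDigraph α := { G.deleteVert y with edges := insert (x, z) (G.deleteVert y).edges }
    with hdef
  have hadj : ∀ {a b}, G'.Adj a b ↔ (a = x ∧ b = z) ∨ G.Adj a b ∧ a ≠ y ∧ b ≠ y :=
    hG.degTwo_adj
  have hxy : x ≠ y := by rintro rfl; exact hG.adj_irrefl _ h1
  have hzy : z ≠ y := by rintro rfl; exact hG.adj_irrefl _ h2
  have hyo : ∀ w, G.Adj y w → w = z := fun w hw => exists_out_of_deg h2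
    (by have := in_pos h1; unfold deg at hy; omega) hw
  have hyi : ∀ w, G.Adj w y → w = x := fun w hw => exists_in_of_deg h1
    (by have := out_pos h2; unfold deg at hy; omega) hw
  -- If x has a second out-edge, its degree is used up and nothing enters x; as x ≠ s, no path then
  -- visits x. In particular it does no harm if the edge (x, z) was already present.
  have hxc : (∀ w, ¬ G.Adj w x) ∨ ∀ w, G.Adj x w → w = y := by
    unfold deg at hx
    by_cases h0 : (G.edges.filter (fun e => e.2 = x)).card = 0
    · exact .inl (not_adj_of_in_eq_zero h0)
    · exact .inr fun w hw => exists_out_of_deg h1 (by omega) hw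
  have hpaths : ∀ {P}, P ∈ G'.paths → y ∉ P := fun hP hy' =>
    (mem_deleteVert.1 (hP.mem_verts y hy')).2 rfl
  -- a vertex without in-neighbours lies on a path only as its first vertex
  have hno : ∀ (H : STDigraph α) (P : List α), P ∈ H.paths → x ≠ H.s → (∀ w, ¬ H.Adj w x) →
      x ∉ P := by
    intro H P hP hxs hno hxP
    rcases reflTransGen_iff_eq_or_transGen.1 (hP.reach_mem hxP).1 with h | h
    · exact hxs h
    · obtain ⟨w, -, hw⟩ := TransGen.tail'_iff.1 h
      exact hno w hw
  -- successors on a path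
  have hsucc : ∀ (H : STDigraph α) (P : List α) (w : α), P ∈ H.paths → w ∈ P → w ≠ H.t →
      ∃ A b B, P = A ++ w :: b :: B ∧ H.Adj w b := by
    intro H P w hP hw hwt
    obtain ⟨A, B, rfl⟩ := List.append_of_mem hw
    obtain _ | ⟨b, B⟩ := B
    · exact (hwt (by simpa using hP.last_eq)).elim
    · refine ⟨A, b, B, rfl, ?_⟩
      have := (hP.right).chain
      rw [List.isChain_cons_cons] at this
      exact this.1
  have hpred : ∀ P ∈ G.paths, y ∈ P → x ∈ P := by
    intro P hP hyP
    obtain ⟨A, B, rfl⟩ := List.append_of_mem hyP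
    rcases List.eq_nil_or_concat A with rfl | ⟨A, a, rfl⟩
    · exact (hys (by simpa using hP.head_eq)).elim
    · have hc : ([a, y]).IsChain G.Adj := hP.chain.infix ⟨A, B, by simp⟩
      simp only [List.isChain_pair] at hc
      obtain rfl := hyi a hc
      simp
  -- edges of a path that avoids `x` and `y`
  have hφ : ∀ P, ∃ Q, P ∈ G.paths → Q ∈ G'.paths ∧ (∀ v ≠ y, v ∈ Q ↔ v ∈ P) ∧ (y ∈ P ↔ x ∈ P) := by
    intro P
    by_cases hP : P ∈ G.paths
    swap
    · exact ⟨[], fun h => (hP h).elim⟩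
    by_cases hxP : x ∈ P
    · have hxo : ∀ w, G.Adj x w → w = y := by
        rcases hxc with h | h
        · exact (hno G P hP hxs h hxP).elim
        · exact h
      obtain ⟨A, b, B, rfl, hb⟩ := hsucc G P x hP hxP hxt
      obtain rfl := hxo b hb
      obtain _ | ⟨c, B⟩ := B
      · exact (hyt (by simpa using hP.last_eq)).elim
      have hc := (hP.right).chain
      simp only [List.isChain_cons_cons] at hc
      obtain rfl := hyo c hc.2.1
      have hnd := hP.nodup
      simp only [List.nodup_append, List.nodup_cons, List.mem_cons] at hnd
      have hA : G'.IsPath G.s x (A ++ [x]) := by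
        refine hG'.isPath hG'.s_mem hP.left.head_eq hP.left.last_eq ?_
        refine hP.left.chain.imp_of_mem_imp fun a b' ha hb' hab => hadj.2 (.inr ⟨hab, ?_, ?_⟩) <;>
        · rintro rfl
          simp only [List.mem_append, List.mem_singleton] at ha hb'
          grind
      have hB : G'.IsPath c G.t (c :: B) := by
        have hr : G.IsPath c G.t (c :: B) := (IsPath.right (l₁ := A ++ [x, b]) (by simpa [paths] using hP))
        refine hG'.isPath (mem_deleteVert.2 ⟨hr.mem_verts _ (by simp), hzy⟩) hr.head_eq hr.last_eq ?_
        refine hr.chain.imp_of_mem_imp fun a b' ha hb' hab => hadj.2 (.inr ⟨hab, ?_, ?_⟩) <;>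
        · rintro rfl
          simp only [List.mem_cons] at ha hb'
          grind
      refine ⟨_, fun _ => ⟨hG'.isPath_append hA (hadj.2 (.inl ⟨rfl, rfl⟩)) hB, ?_, ?_⟩⟩
      · intro v hv
        simp [hv]
      · simp
    · have hyP : y ∉ P := fun h => hxP (hpred P hP h)
      refine ⟨P, fun _ => ⟨hG'.isPath hG'.s_mem hP.head_eq hP.last_eq ?_, fun _ _ => Iff.rfl,
        iff_of_false hyP hxP⟩⟩
      exact hP.chain.imp_of_mem_imp fun a b ha hb hab =>
        hadj.2 (.inr ⟨hab, by rintro rfl; exact hyP ha, by rintro rfl; exact hyP hb⟩)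
  -- In the other direction, a path of the new graph through x must leave it along the inserted edge
  -- and is rerouted through y; a path avoiding x does not use the inserted edge.
  have hψ : ∀ P, ∃ Q, P ∈ G'.paths → Q ∈ G.paths ∧ (∀ v ≠ y, v ∈ Q ↔ v ∈ P) ∧ (y ∈ Q ↔ x ∈ Q) := by
    intro P
    by_cases hP : P ∈ G'.paths
    swap
    · exact ⟨[], fun h => (hP h).elim⟩
    have hyP := hpaths hP
    by_cases hxP : x ∈ P
    · have hxo : ∀ w, G.Adj x w → w = y := by
        rcases hxc with h | h
        · refine (hno G' P hP hxs (fun w hw => ?_) hxP).elim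
          rcases hadj.1 hw with ⟨-, e⟩ | hw
          · rw [← e] at h2
            exact hG.not_reach h1 (.single h2)
          · exact h w hw.1
        · exact h
      obtain ⟨A, b, B, rfl, hb⟩ := hsucc G' P x hP hxP hxt
      obtain rfl : b = z := by
        rcases hadj.1 hb with h | h
        · exact h.2
        · exact (h.2.2 (hxo _ h.1)).elim
      have hnd := hP.nodup
      simp only [List.nodup_append, List.nodup_cons, List.mem_cons] at hnd
      have hA : G.IsPath G.s x (A ++ [x]) := by
        refine hG.isPath hG.s_mem hP.left.head_eq hP.left.last_eq ?_
        refine List.IsChain.imp_of_mem_tail_imp (fun a b' ha hb' hab => ?_) hP.left.chain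
        rcases hadj.1 hab with ⟨-, rfl⟩ | h
        · have := List.mem_of_mem_tail hb'
          simp only [List.mem_append, List.mem_singleton] at this
          grind
        · exact h.1
      have hB : G.IsPath b G.t (b :: B) := by
        have hr : G'.IsPath b G.t (b :: B) := (IsPath.right (u := G'.s) (l₁ := A ++ [x])
          (by rw [List.append_assoc]; exact hP))
        refine hG.isPath (hG.edges_mem _ h2).2 hr.head_eq hr.last_eq ?_
        refine hr.chain.imp_of_mem_imp fun a b' ha hb' hab => ?_
        rcases hadj.1 hab with ⟨rfl, -⟩ | h
        · simp only [List.mem_cons] at ha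
          grind
        · exact h.1
      have hyB : G.IsPath y G.t (y :: b :: B) := hG.isPath_append (l₁ := [y])
        ⟨rfl, rfl, by simpa using (hG.edges_mem _ h1).2, by simp, by simp⟩ h2 hB
      refine ⟨_, fun _ => ⟨hG.isPath_append hA h1 hyB, ?_, ?_⟩⟩
      · intro v hv
        simp [hv]
      · simp
    · refine ⟨P, fun _ => ⟨hG.isPath hG.s_mem hP.head_eq hP.last_eq ?_, fun _ _ => Iff.rfl,
        iff_of_false hyP hxP⟩⟩
      refine hP.chain.imp_of_mem_imp fun a b ha hb hab => ?_
      rcases hadj.1 hab with ⟨rfl, -⟩ | h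
      · exact (hxP ha).elim
      · exact h.1
  -- Paths of a DAG are determined by their vertex sets, so the membership statements in `hφ` and
  -- `hψ` already give injectivity.
  have hinj : ∀ (H : STDigraph α), H.IsDAG → ∀ P₁ ∈ H.paths, ∀ P₂ ∈ H.paths,
      (∀ v, v ∈ P₁ ↔ v ∈ P₂) → P₁ = P₂ := fun H hH P₁ h₁ P₂ h₂ h =>
    (isTrackingSet_iff.1 hH.isTrackingSet_verts).2 P₁ h₁ P₂ h₂ fun v _ => h v
  choose φ hφ using hφ
  choose ψ hψ using hψ
  constructor
  · intro h
    refine h.transfer (fun w => if w = y then x else w) ψ ?_ (fun P hP => (hψ P hP).1) ?_ ?_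
    · intro v hv
      by_cases e : v = y
      · simp only [e, if_true]; exact mem_deleteVert.2 ⟨(hG.edges_mem _ h1).1, hxy⟩
      · simp only [e, if_false]; exact mem_deleteVert.2 ⟨hv, e⟩
    · intro P₁ hP₁ P₂ hP₂ h
      refine hinj G' hG' P₁ hP₁ P₂ hP₂ fun v => ?_
      by_cases e : v = y
      · subst e
        exact iff_of_false (hpaths hP₁) (hpaths hP₂)
      · rw [← (hψ P₁ hP₁).2.1 v e, ← (hψ P₂ hP₂).2.1 v e, h]
    · intro v hv P₁ hP₁ P₂ hP₂ h
      by_cases e : v = y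
      · subst e
        simp only [if_true] at h
        rw [(hψ P₁ hP₁).2.2, (hψ P₂ hP₂).2.2, (hψ P₁ hP₁).2.1 _ hxy, (hψ P₂ hP₂).2.1 _ hxy, h]
      · simp only [e, if_false] at h
        rw [(hψ P₁ hP₁).2.1 _ e, (hψ P₂ hP₂).2.1 _ e, h]
  · intro h
    refine h.transfer id φ (fun v hv => (mem_deleteVert.1 hv).1) (fun P hP => (hφ P hP).1) ?_ ?_
    · intro P₁ hP₁ P₂ hP₂ h
      refine hinj G hG P₁ hP₁ P₂ hP₂ fun v => ?_
      have : ∀ v ≠ y, v ∈ P₁ ↔ v ∈ P₂ := fun v e => by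
        rw [← (hφ P₁ hP₁).2.1 v e, ← (hφ P₂ hP₂).2.1 v e, h]
      by_cases e : v = y
      · subst e
        rw [(hφ P₁ hP₁).2.2, (hφ P₂ hP₂).2.2, this x hxy]
      · exact this v e
    · intro v hv P₁ hP₁ P₂ hP₂ h
      have e : v ≠ y := (mem_deleteVert.1 hv).2
      rw [(hφ P₁ hP₁).2.1 _ e, (hφ P₂ hP₂).2.1 _ e]
      exact h

theorem Step.isYes_iff {G G' : STDigraph α} (h : Step G G') (hG : G.IsDAG) (k : ℕ) :
    G.IsYes k ↔ G'.IsYes k := by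
  have hG' := h.isDAG hG
  cases h with
  | vert v hv h1 h2 h3 =>
    have key : ∀ P, P ∈ (G.deleteVert v).paths ↔ P ∈ G.paths := fun P =>
      deleteVert_isPath.trans ⟨fun h => h.1, fun h => ⟨h, h3 P h⟩⟩
    constructor
    · intro h
      -- The deleted vertex lies on no path, so it tracks nothing and may be replaced by any
      -- remaining vertex, here s.
      refine h.transfer (fun w => if w = v then G.s else w) id ?_ (fun P hP => (key P).1 hP)
        (fun _ _ _ _ h => h) ?_
      · intro w hw
        by_cases e : w = v
        · simp only [e, if_true]; exact hG'.s_mem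
        · simp only [e, if_false]; exact mem_deleteVert.2 ⟨hw, e⟩
      · intro w hw P₁ hP₁ P₂ hP₂ h
        by_cases e : w = v
        · subst e
          exact iff_of_false (h3 _ ((key _).1 hP₁)) (h3 _ ((key _).1 hP₂))
        · simpa [e] using h
    · intro h
      exact h.transfer id id (fun w hw => (mem_deleteVert.1 hw).1) (fun P hP => (key P).2 hP)
        (fun _ _ _ _ h => h) (fun _ _ _ _ _ _ h => h)
  | edge u v h1 h2 =>
    have key : ∀ P, P ∈ ({ G with edges := G.edges.erase (u, v) } : STDigraph α).paths ↔
        P ∈ G.paths := by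
      intro P
      refine ⟨fun h => ⟨h.1, h.2, h.3, h.4, h.5.imp fun a b h => Finset.mem_of_mem_erase h⟩,
        fun h => ⟨h.1, h.2, h.3, h.4, ?_⟩⟩
      refine List.isChain_iff_forall_rel_of_append_cons_cons.2 ?_
      rintro a b l₁ l₂ rfl
      refine Finset.mem_erase.2 ⟨?_, List.isChain_iff_forall_rel_of_append_cons_cons.1 h.5 rfl⟩
      rintro e
      cases e
      exact h2 _ h ⟨l₁, l₂, by simp⟩
    exact ⟨fun h => h.transfer id id (fun w hw => hw) (fun P hP => (key P).1 hP)
        (fun _ _ _ _ h => h) (fun _ _ _ _ _ _ h => h),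
      fun h => h.transfer id id (fun w hw => hw) (fun P hP => (key P).2 hP)
        (fun _ _ _ _ h => h) (fun _ _ _ _ _ _ h => h)⟩
  | source u h1 h2 h3 => exact hG.isYes_source h1 h2 h3 k
  | dest u h1 h2 h3 => exact hG.isYes_dest h1 h2 h3 k
  | degTwo x y z h1 h2 h3 h4 h5 h6 h7 h8 => exact hG.isYes_degTwo h1 h2 h3 h4 h5 h6 h7 h8 k

theorem IsDAG.of_steps {G G' : STDigraph α} (hG : G.IsDAG) (h : ReflTransGen Step G G') :
    G'.IsDAG ∧ ∀ k, G.IsYes k ↔ G'.IsYes k := by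
  induction h with
  | refl => exact ⟨hG, fun _ => Iff.rfl⟩
  | tail _ h ih => exact ⟨h.isDAG ih.1, fun k => (ih.2 k).trans (h.isYes_iff ih.1 k)⟩

end STDigraph

/-! ### Clashes, the tracking set condition, and a lower bound on the number of paths -/

namespace STDigraph

open Relation

variable {α : Type*}

/-- Every vertex is reachable from the source, and the destination is reachable from it. -/
def Trim (G : STDigraph α) : Prop :=
  ∀ v ∈ G.verts, ReflTransGen G.Adj G.s v ∧ ReflTransGen G.Adj v G.t

/-- Some vertex is entered by two edges of `r` whose tails are both reachable from `u`. -/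
def Clash (r : α → α → Prop) (u : α) : Prop :=
  ∃ a₁ a₂ b, a₁ ≠ a₂ ∧ ReflTransGen r u a₁ ∧ ReflTransGen r u a₂ ∧ r a₁ b ∧ r a₂ b

/-- The edges that leave `u` or a vertex outside of `T`. -/
def Avoid (G : STDigraph α) (T : Finset α) (u a b : α) : Prop := G.Adj a b ∧ (a = u ∨ a ∉ T)

theorem exists_first {p : α → Prop} {l : List α} (h : ∃ x ∈ l, p x) :
    ∃ C v D, l = C ++ v :: D ∧ p v ∧ ∀ x ∈ C, ¬ p x := by
  induction l with
  | nil => simp at h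
  | cons a l ih =>
    by_cases ha : p a
    · exact ⟨[], a, l, rfl, ha, by simp⟩
    · obtain ⟨C, v, D, rfl, hv, hC⟩ := ih (by simpa [ha] using h)
      exact ⟨a :: C, v, D, rfl, hv, by simpa [ha] using hC⟩

theorem exists_last {p : α → Prop} {l : List α} (h : ∃ x ∈ l, p x) :
    ∃ C v D, l = C ++ v :: D ∧ p v ∧ ∀ x ∈ D, ¬ p x := by
  obtain ⟨C, v, D, e, hv, hC⟩ := exists_first (l := l.reverse) (p := p) (by simpa using h)
  refine ⟨D.reverse, v, C.reverse, ?_, hv, by simpa using hC⟩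
  rw [← l.reverse_reverse, e]
  simp

theorem exists_first_diff {x y : List α} (h : x ≠ y) :
    (∃ C a b D E, x = C ++ a :: D ∧ y = C ++ b :: E ∧ a ≠ b) ∨ (∃ D, D ≠ [] ∧ y = x ++ D) ∨
      ∃ D, D ≠ [] ∧ x = y ++ D := by
  induction x generalizing y with
  | nil => exact .inr (.inl ⟨y, h.symm, rfl⟩)
  | cons a x ih =>
    cases y with
    | nil => exact .inr (.inr ⟨_, h, rfl⟩)
    | cons b y =>
      by_cases e : a = b
      · subst e
        rcases ih (y := y) (by simpa using h) with ⟨C, a', b, D, E, rfl, rfl, h'⟩ | ⟨D, hD, rfl⟩ |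
          ⟨D, hD, rfl⟩
        · exact .inl ⟨a :: C, a', b, D, E, rfl, rfl, h'⟩
        · exact .inr (.inl ⟨D, hD, rfl⟩)
        · exact .inr (.inr ⟨D, hD, rfl⟩)
      · exact .inl ⟨[], a, b, x, y, rfl, rfl, e⟩

theorem rel_of_mem_isChain {r : α → α → Prop} {l : List α} {a : α} (h : l.IsChain r)
    (ha : l.getLast? = some a) {x : α} (hx : x ∈ l) : x = a ∨ ∃ y, r x y := by
  obtain ⟨A, B, rfl⟩ := List.append_of_mem hx
  obtain _ | ⟨b, B⟩ := B
  · left; simpa using ha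
  · right
    exact ⟨b, List.isChain_iff_forall_rel_of_append_cons_cons.1 h rfl⟩

theorem Trim.exists_pred {G : STDigraph α} (hT : G.Trim) {v : α}
    (hv : v ∈ G.verts) (hs : v ≠ G.s) : ∃ w, G.Adj w v := by
  rcases reflTransGen_iff_eq_or_transGen.1 (hT v hv).1 with h | h
  · exact (hs h).elim
  · obtain ⟨w, -, hw⟩ := TransGen.tail'_iff.1 h
    exact ⟨w, hw⟩

theorem Trim.exists_succ {G : STDigraph α} (hT : G.Trim) {v : α}
    (hv : v ∈ G.verts) (ht : v ≠ G.t) : ∃ w, G.Adj v w := by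
  rcases reflTransGen_iff_eq_or_transGen.1 (hT v hv).2 with h | h
  · exact (ht h.symm).elim
  · obtain ⟨w, hw, -⟩ := TransGen.head'_iff.1 h
    exact ⟨w, hw⟩

variable [DecidableEq α]

/-- Two distinct paths with equal traces on T are compared from t backwards. Let b be the first
vertex of their maximal common end, entered from a₁ ≠ a₂. On each path take the last vertex of T ∪
{s} before b. Both paths meet T ∪ {s} before b in the same vertices, so each of these two last
vertices reaches the other, and acyclicity makes them equal. -/
theorem IsDAG.exists_clash {G : STDigraph α} (hG : G.IsDAG) {T : Finset α} (hTv : T ⊆ G.verts)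
    (h : ¬ G.IsTrackingSet T) : ∃ u ∈ insert G.s T, Clash (G.Avoid T u) u := by
  simp only [isTrackingSet_iff, hTv, true_and, not_forall] at h
  obtain ⟨P₁, h₁, P₂, h₂, htr, hne⟩ := h
  -- Neither path is a proper final segment of the other: the longer one would visit s twice.
  have hsuf : ∀ P₁ P₂, P₁ ∈ G.paths → P₂ ∈ G.paths →
      ¬ ∃ D, D ≠ [] ∧ P₂.reverse = P₁.reverse ++ D := by
    rintro P₁ P₂ h₁ h₂ ⟨D, hD, e⟩
    have e' : P₂ = D.reverse ++ P₁ := by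
      rw [← P₂.reverse_reverse, e]; simp
    obtain ⟨a, D', hD'⟩ := List.exists_cons_of_ne_nil (l := D.reverse) (by simpa using hD)
    rw [hD'] at e'
    have ha : a = G.s := by simpa [e'] using h₂.head_eq
    have hnd := h₂.nodup
    rw [e', List.nodup_append] at hnd
    exact hnd.2.2 a (by simp) G.s h₁.head_mem ha
  rcases exists_first_diff (x := P₁.reverse) (y := P₂.reverse) (by simpa using hne) with
    ⟨C, a₁, a₂, D₁, D₂, e₁, e₂, ha⟩ | h | h
  rotate_left
  · exact (hsuf P₁ P₂ h₁ h₂ h).elim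
  · exact (hsuf P₂ P₁ h₂ h₁ h).elim
  obtain ⟨S, rfl⟩ : ∃ S, C = S.reverse := ⟨C.reverse, by simp⟩
  obtain ⟨A₁, rfl⟩ : ∃ S, D₁ = S.reverse := ⟨D₁.reverse, by simp⟩
  obtain ⟨A₂, rfl⟩ : ∃ S, D₂ = S.reverse := ⟨D₂.reverse, by simp⟩
  obtain rfl : P₁ = A₁ ++ a₁ :: S := by rw [← P₁.reverse_reverse, e₁]; simp
  obtain rfl : P₂ = A₂ ++ a₂ :: S := by rw [← P₂.reverse_reverse, e₂]; simp
  -- The common end is not empty, because both paths end in t.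
  obtain _ | ⟨b, S⟩ := S
  · have e1 := h₁.last_eq
    have e2 := h₂.last_eq
    simp only [List.getLast?_append, List.getLast?_singleton, Option.some_or, Option.some.injEq] at e1 e2
    exact (ha (e1.trans e2.symm)).elim
  -- in each path, the last vertex of `T ∪ {s}` before the common end
  have key : ∀ A a, A ++ a :: b :: S ∈ G.paths → ∃ X u Y, A ++ [a] = X ++ u :: Y ∧
      (u ∈ T ∨ u = G.s) ∧ (∀ y ∈ Y, ¬ (y ∈ T ∨ y = G.s)) ∧ ReflTransGen (G.Avoid T u) u a ∧
      G.Avoid T u a b := by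
    intro A a hP
    obtain ⟨X, u, Y, e, hu, hY⟩ := exists_last (l := A ++ [a]) (p := fun x => x ∈ T ∨ x = G.s)
      ⟨G.s, hP.left.head_mem, .inr rfl⟩
    have hu' : G.IsPath u a (u :: Y) := IsPath.right (l₁ := X) (e ▸ hP.left)
    have hav : ∀ x ∈ u :: Y, x = u ∨ x ∉ T := fun x hx => by
      rcases List.mem_cons.1 hx with h | h
      · exact .inl h
      · exact .inr fun h' => hY x h (.inl h')
    refine ⟨X, u, Y, e, hu, hY, ?_, ?_, hav a hu'.last_mem⟩
    · exact reach_of_isChain (hu'.chain.imp_of_mem_imp fun x y hx hy hxy => ⟨hxy, hav x hx⟩)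
        hu'.head_eq hu'.last_eq
    · have := hP.right.chain
      rw [List.isChain_cons_cons] at this
      exact this.1
  obtain ⟨X₁, u₁, Y₁, e₁, hu₁, hY₁, hr₁, hb₁⟩ := key _ _ h₁
  obtain ⟨X₂, u₂, Y₂, e₂, hu₂, hY₂, hr₂, hb₂⟩ := key _ _ h₂
  -- The traces agree on the whole paths; paths are simple, so a vertex before b does not recur in
  -- the common end and the traces before b agree as well.
  have hmem : ∀ x, x ∈ T ∨ x = G.s → (x ∈ A₁ ++ [a₁] ↔ x ∈ A₂ ++ [a₂]) := by
    rintro x (hx | rfl)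
    · have hx' := htr x hx
      have n1 := h₁.nodup
      have n2 := h₂.nodup
      rw [show A₁ ++ a₁ :: b :: S = (A₁ ++ [a₁]) ++ (b :: S) by simp] at n1 hx'
      rw [show A₂ ++ a₂ :: b :: S = (A₂ ++ [a₂]) ++ (b :: S) by simp] at n2 hx'
      have d1 := (List.nodup_append.1 n1).2.2
      have d2 := (List.nodup_append.1 n2).2.2
      rw [List.mem_append, List.mem_append (s := A₂ ++ [a₂])] at hx'
      constructor
      · intro h
        rcases hx'.1 (.inl h) with h' | h'
        · exact h'
        · exact (d1 x h x h' rfl).elim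
      · intro h
        rcases hx'.2 (.inl h) with h' | h'
        · exact h'
        · exact (d2 x h x h' rfl).elim
    · exact iff_of_true h₁.left.head_mem h₂.left.head_mem
  have hle : ∀ {A a X u Y v}, A ++ a :: b :: S ∈ G.paths → A ++ [a] = X ++ u :: Y →
      (∀ y ∈ Y, ¬ (y ∈ T ∨ y = G.s)) → (v ∈ T ∨ v = G.s) → v ∈ A ++ [a] →
      ReflTransGen G.Adj v u := by
    intro A a X u Y v hP e hY hv hvm
    have hP' : G.IsPath G.s u (X ++ [u]) := IsPath.left (l₂ := Y) (e ▸ hP.left)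
    refine (hP'.reach_mem ?_).2
    rw [e] at hvm
    simp only [List.mem_append, List.mem_cons] at hvm ⊢
    rcases hvm with h | h | h
    · exact .inl h
    · exact .inr (.inl h)
    · exact (hY v h hv).elim
  -- Each of the two lies on the other path before b, hence reaches the last vertex of T ∪ {s}
  -- there.
  obtain rfl : u₁ = u₂ := by
    refine hG.antisymm (hle h₂ e₂ hY₂ hu₁ ((hmem _ hu₁).1 ?_)) (hle h₁ e₁ hY₁ hu₂ ((hmem _ hu₂).2 ?_))
    · rw [e₁]; simp
    · rw [e₂]; simp
  refine ⟨u₁, ?_, a₁, a₂, b, ha, hr₁, hr₂, hb₁, hb₂⟩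
  rw [Finset.mem_insert]
  tauto

/-- From b, follow a path towards t until it first meets a vertex v of T ∪ {t}. Both ways from u to
b, continued along this piece, avoid T except at u and v, and they differ in the predecessor of b.
-/
theorem IsDAG.not_condition_of_clash {G : STDigraph α} (hG : G.IsDAG) (hT : G.Trim)
    {T : Finset α} (hTv : T ⊆ G.verts) {u : α} (hu : u ∈ insert G.s T)
    (h : Clash (G.Avoid T u) u) : ¬ G.TrackingSetCondition T := by
  obtain ⟨a₁, a₂, b, hne, hr₁, hr₂, hb₁, hb₂⟩ := h
  have huv : u ∈ G.verts := by
    rcases Finset.mem_insert.1 hu with rfl | h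
    · exact hG.s_mem
    · exact hTv h
  have hbv : b ∈ G.verts := (hG.edges_mem _ hb₁.1).2
  obtain ⟨l, hl⟩ := hG.exists_isPath hbv (hT b hbv).2
  obtain ⟨C, v, D, rfl, hv, hC⟩ := exists_first (l := l) (p := fun x => x ∈ T ∨ x = G.t)
    ⟨G.t, hl.last_mem, .inr rfl⟩
  have key : ∀ a, ReflTransGen (G.Avoid T u) u a → G.Avoid T u a b → ∃ l, l.getLast? = some a ∧
      (G.induce (G.verts \ (T \ {u, v}))).IsPath u v (l ++ (C ++ [v])) := by
    intro a hr hb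
    obtain ⟨l, h1, h2, h3⟩ := exists_isChain hr
    have hp : G.IsPath u a l := hG.isPath huv h2 h3 (h1.imp fun x y h => h.1)
    refine ⟨l, h3, induce_isPath.2 ⟨hG.isPath_append hp hb.1 hl.left, fun x hx => ?_⟩⟩
    rw [Finset.mem_sdiff]
    refine ⟨(hG.isPath_append hp hb.1 hl.left).mem_verts x hx, fun hxT => ?_⟩
    simp only [Finset.mem_sdiff, Finset.mem_insert, Finset.mem_singleton, not_or] at hxT
    simp only [List.mem_append, List.mem_singleton] at hx
    rcases hx with hx | hx | hx
    -- Each vertex before b is the tail of an admissible edge, either of the walk or of the final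
    -- edge into b, so it equals u or lies outside T.
    · rcases rel_of_mem_isChain h1 h3 hx with rfl | ⟨y, hy⟩
      · exact hb.2.elim hxT.2.1 fun h => h hxT.1
      · exact hy.2.elim hxT.2.1 fun h => h hxT.1
    · exact hC x hx (.inl hxT.1)
    · exact hxT.2.2 hx
  obtain ⟨l₁, g₁, p₁⟩ := key a₁ hr₁ hb₁
  obtain ⟨l₂, g₂, p₂⟩ := key a₂ hr₂ hb₂
  intro hc
  have := hc u (by simp at hu ⊢; tauto) v (by simp; tauto) _ _ p₁ p₂
  rw [List.append_cancel_right this, g₂] at g₁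
  cases g₁
  exact hne rfl

/-- Extend two u-v paths with no inner vertices in T by the same path A from s to u and the same
path B from v to t. The resulting s-t paths have the same trace on T, so they coincide, and A and B
can be cancelled. Trimness supplies A and B. -/
theorem IsDAG.condition_of_isTrackingSet {G : STDigraph α} (hG : G.IsDAG) (hT : G.Trim)
    {T : Finset α} (h : G.IsTrackingSet T) : G.TrackingSetCondition T := by
  rw [isTrackingSet_iff] at h
  have hmem : ∀ u ∈ T ∪ {G.s, G.t}, u ∈ G.verts := by
    intro u hu
    simp only [Finset.mem_union, Finset.mem_insert, Finset.mem_singleton] at hu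
    rcases hu with hu | rfl | rfl
    · exact h.1 hu
    · exact hG.s_mem
    · exact hG.t_mem
  intro u hu v hv P₁ P₂ h₁ h₂
  rw [induce_isPath] at h₁ h₂
  obtain ⟨A, hA⟩ := hG.exists_isPath hG.s_mem (hT u (hmem u hu)).1
  obtain ⟨B, hB⟩ := hG.exists_isPath (hmem v hv) (hT v (hmem v hv)).2
  have g := fun P (hP : G.IsPath u v P) => hG.isPath_glue (hG.isPath_glue hA hP) hB
  -- The only vertices of T on the middle piece are u, the end of A, and v, the start of B, so the
  -- trace is independent of that piece.
  have key : ∀ P, (G.IsPath u v P ∧ ∀ x ∈ P, x ∈ G.verts \ (T \ {u, v})) → ∀ x ∈ T,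
      (x ∈ A ++ P.tail ++ B.tail ↔ x ∈ A ∨ x ∈ B) := by
    rintro P ⟨hP, hP'⟩ x hx
    obtain ⟨P', rfl⟩ : ∃ P', P = u :: P' := by
      obtain _ | ⟨a, P'⟩ := P
      · exact (hP.ne_nil rfl).elim
      · exact ⟨P', by simpa using hP.head_eq⟩
    obtain ⟨B', rfl⟩ : ∃ B', B = v :: B' := by
      obtain _ | ⟨a, B'⟩ := B
      · exact (hB.ne_nil rfl).elim
      · exact ⟨B', by simpa using hB.head_eq⟩
    have h1 := hA.last_mem
    have h2 := hP.last_mem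
    have h3 : x ∈ u :: P' → x = u ∨ x = v := fun h => by
      have := hP' x h
      simp only [Finset.mem_sdiff, Finset.mem_insert, Finset.mem_singleton] at this
      tauto
    simp only [List.tail_cons, List.mem_append, List.mem_cons] at h2 h3 ⊢
    grind
  have := h.2 _ (g P₁ h₁.1) _ (g P₂ h₂.1) fun x hx => (key P₁ h₁ x hx).trans (key P₂ h₂ x hx).symm
  have := List.append_cancel_left (List.append_cancel_right this)
  obtain _ | ⟨a, P₁⟩ := P₁
  · exact (h₁.1.ne_nil rfl).elim
  obtain _ | ⟨a', P₂⟩ := P₂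
  · exact (h₂.1.ne_nil rfl).elim
  have e1 := h₁.1.head_eq
  have e2 := h₂.1.head_eq
  simp_all

theorem IsDAG.isTrackingSet_iff_condition {G : STDigraph α} (hG : G.IsDAG) (hT : G.Trim)
    {T : Finset α} (hTv : T ⊆ G.verts) : G.IsTrackingSet T ↔ G.TrackingSetCondition T := by
  refine ⟨hG.condition_of_isTrackingSet hT, fun h => by_contra fun hn => ?_⟩
  obtain ⟨u, hu, hc⟩ := hG.exists_clash hTv hn
  exact hG.not_condition_of_clash hT hTv hu hc h

/-- This is the form that is tested algorithmically: one search for each starting vertex u, instead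
of a count of paths for each pair u, v. -/
theorem IsDAG.isTrackingSet_iff_not_clash {G : STDigraph α} (hG : G.IsDAG) (hT : G.Trim)
    {T : Finset α} (hTv : T ⊆ G.verts) :
    G.IsTrackingSet T ↔ ∀ u ∈ insert G.s T, ¬ Clash (G.Avoid T u) u := by
  constructor
  · intro h u hu hc
    exact hG.not_condition_of_clash hT hTv hu hc (hG.condition_of_isTrackingSet hT h)
  · intro h
    by_contra hn
    obtain ⟨u, hu, hc⟩ := hG.exists_clash hTv hn
    exact h u hu hc

/-- A DAG all of whose vertices lie on `s`-`t` paths has at least `m - n + 2` such paths. -/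
theorem IsDAG.card_edges_add_two_le {G : STDigraph α} (hG : G.IsDAG) (hT : G.Trim) :
    G.edges.card + 2 ≤ G.verts.card + G.paths.ncard := by
  -- Fix a default successor `d v` of every vertex other than t, and let `D v` follow the defaults
  -- from v to t. An edge e that is not a default yields the path `A e.1 ++ D e.2`, in which e is
  -- the last non-default edge; so distinct edges give distinct paths, none of them the pure default
  -- path from s.
  have hd : ∀ v, ∃ w, v ∈ G.verts → v ≠ G.t → G.Adj v w := fun v => by
    by_cases h : v ∈ G.verts ∧ v ≠ G.t
    · obtain ⟨w, hw⟩ := hT.exists_succ h.1 h.2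
      exact ⟨w, fun _ _ => hw⟩
    · exact ⟨v, fun h1 h2 => (h ⟨h1, h2⟩).elim⟩
  choose d hd using hd
  have hD : ∀ v, ∃ l, v ∈ G.verts → G.IsPath v G.t l ∧ l.IsChain (fun a b => b = d a) := by
    intro v
    -- Well-foundedness of the reversed graph allows recursion along successors.
    induction v using hG.rev.wellFounded.induction with
    | _ v ih =>
      by_cases hv : v ∈ G.verts
      swap
      · exact ⟨[], fun h => (hv h).elim⟩
      by_cases ht : v = G.t
      · exact ⟨[v], fun _ => ⟨⟨rfl, by simp [ht], by simpa using hv, by simp, by simp⟩, by simp⟩⟩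
      · have ha := hd v hv ht
        obtain ⟨l, hl⟩ := ih (d v) (rev_adj.2 ha)
        have hl := hl (hG.edges_mem _ ha).2
        refine ⟨[v] ++ l, fun _ => ⟨hG.isPath_append (v := v)
          ⟨rfl, rfl, by simpa using hv, by simp, by simp⟩ ha hl.1, ?_⟩⟩
        refine List.IsChain.append (by simp) hl.2 fun x hx y hy => ?_
        rw [hl.1.head_eq] at hy
        simp at hx hy
        rw [← hy, ← hx]
  choose D hD using hD
  have hA : ∀ v, ∃ l, v ∈ G.verts → G.IsPath G.s v l := fun v => by
    by_cases hv : v ∈ G.verts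
    · obtain ⟨l, hl⟩ := hG.exists_isPath hG.s_mem (hT v hv).1
      exact ⟨l, fun _ => hl⟩
    · exact ⟨[], fun h => (hv h).elim⟩
  choose A hA using hA
  let N := G.edges.filter fun e => e.2 ≠ d e.1
  let f : α × α → List α := fun e => A e.1 ++ D e.2
  have hN : ∀ e ∈ N, G.Adj e.1 e.2 ∧ e.1 ∈ G.verts ∧ e.2 ∈ G.verts ∧ e.2 ≠ d e.1 := by
    intro e he
    obtain ⟨h1, h2⟩ := Finset.mem_filter.1 he
    exact ⟨h1, (hG.edges_mem _ h1).1, (hG.edges_mem _ h1).2, h2⟩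
  -- default paths do not contain the other edges
  have hdef : ∀ v ∈ G.verts, ∀ e ∈ N, ∀ X, D v = X ++ D e.2 → X.getLast? = some e.1 → False := by
    intro v hv e he X hX hl
    have hc := (hD v hv).2
    rw [hX, List.isChain_append] at hc
    exact (hN e he).2.2.2 (hc.2.2 _ hl _ (hD _ (hN e he).2.2.1).1.head_eq)
  -- If two decompositions of one path split at different places, the edge of the later split lies
  -- inside the default part of the earlier one, contradicting `hdef`. If they split at the same
  -- place, the edges agree.
  have haux : ∀ e ∈ N, ∀ e' ∈ N, ∀ X, A e'.1 = A e.1 ++ X → D e.2 = X ++ D e'.2 → e = e' := by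
    intro e he e' he' X h1 h2
    have l1 := (hA _ (hN e he).2.1).last_eq
    have l2 := (hA _ (hN e' he').2.1).last_eq
    rcases List.eq_nil_or_concat X with rfl | ⟨X', a, rfl⟩
    · have k1 := (hD _ (hN e he).2.2.1).1.head_eq
      have k2 := (hD _ (hN e' he').2.2.1).1.head_eq
      simp only [List.append_nil, List.nil_append] at h1 h2
      rw [h1, l1] at l2
      rw [h2, k2] at k1
      exact Prod.ext (by simpa using l2) (by simpa using k1.symm)
    · refine (hdef _ (hN e he).2.2.1 e' he' _ h2 ?_).elim
      rw [h1] at l2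
      simpa [List.getLast?_append] using l2
  have hinj : Set.InjOn f N := by
    intro e he e' he' h
    rcases List.append_eq_append_iff.1 h with ⟨X, h1, h2⟩ | ⟨X, h1, h2⟩
    · exact haux e he e' he' X h1 h2
    · exact (haux e' he' e he X h1 h2).symm
  have hf : ∀ e ∈ N, f e ∈ G.paths := fun e he =>
    hG.isPath_append (hA _ (hN e he).2.1) (hN e he).1 (hD _ (hN e he).2.2.1).1
  have hs : D G.s ∉ N.image f := by
    intro h
    obtain ⟨e, he, h⟩ := Finset.mem_image.1 h
    exact hdef _ hG.s_mem e he _ h.symm (hA _ (hN e he).2.1).last_eq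
  have h1 : N.card + 1 ≤ G.paths.ncard := by
    rw [← Finset.card_image_of_injOn hinj, ← Finset.card_insert_of_notMem hs,
      Set.ncard_eq_toFinset_card _ hG.finite_paths]
    refine Finset.card_le_card fun P hP => ?_
    rw [Set.Finite.mem_toFinset]
    rcases Finset.mem_insert.1 hP with rfl | hP
    · exact (hD _ hG.s_mem).1
    · obtain ⟨e, he, rfl⟩ := Finset.mem_image.1 hP
      exact hf e he
  have h2 : G.edges.card ≤ N.card + (G.verts.erase G.t).card := by
    rw [← Finset.card_filter_add_card_filter_not (s := G.edges) (fun e => e.2 ≠ d e.1)]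
    refine Nat.add_le_add_left (Finset.card_le_card_of_injOn Prod.fst ?_ ?_) _
    · intro e he
      have he' : e ∈ G.edges := (Finset.mem_filter.1 he).1
      refine Finset.mem_coe.2 (Finset.mem_erase.2 ⟨?_, (hG.edges_mem _ he').1⟩)
      -- No edge leaves t, since its head would reach t again. Hence there are at most n - 1 default
      -- edges.
      intro h
      exact hG.not_reach (u := e.1) (v := e.2) he' (h ▸ (hT _ (hG.edges_mem _ he').2).2)
    · intro e he e' he' h
      have k1 := (Finset.mem_filter.1 he).2
      have k2 := (Finset.mem_filter.1 he').2
      simp only [ne_eq, not_not] at k1 k2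
      exact Prod.ext h (by rw [k1, k2, h])
  rw [Finset.card_erase_of_mem hG.t_mem] at h2
  have := Finset.card_pos.2 ⟨_, hG.t_mem⟩
  omega

/-! ### Degree counting and the size of reduced graphs -/

theorem sum_out {G : STDigraph α} (S : Finset α) :
    ∑ v ∈ S, (G.edges.filter (fun e => e.1 = v)).card = (G.edges.filter (fun e => e.1 ∈ S)).card := by
  rw [Finset.card_eq_sum_card_fiberwise (s := G.edges.filter (fun e => e.1 ∈ S)) (f := Prod.fst)
    (t := S) (fun e he => (Finset.mem_filter.1 he).2)]
  refine Finset.sum_congr rfl fun v hv => ?_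
  congr 1
  ext e
  simp only [Finset.mem_filter]
  constructor
  · rintro ⟨h, rfl⟩; exact ⟨⟨h, hv⟩, rfl⟩
  · rintro ⟨⟨h, _⟩, rfl⟩; exact ⟨h, rfl⟩

theorem sum_in {G : STDigraph α} (S : Finset α) :
    ∑ v ∈ S, (G.edges.filter (fun e => e.2 = v)).card = (G.edges.filter (fun e => e.2 ∈ S)).card := by
  rw [Finset.card_eq_sum_card_fiberwise (s := G.edges.filter (fun e => e.2 ∈ S)) (f := Prod.snd)
    (t := S) (fun e he => (Finset.mem_filter.1 he).2)]
  refine Finset.sum_congr rfl fun v hv => ?_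
  congr 1
  ext e
  simp only [Finset.mem_filter]
  constructor
  · rintro ⟨h, rfl⟩; exact ⟨⟨h, hv⟩, rfl⟩
  · rintro ⟨⟨h, _⟩, rfl⟩; exact ⟨h, rfl⟩

theorem IsReduced.trim {G : STDigraph α} (hr : G.IsReduced) (hp : G.paths.Nonempty) : G.Trim := by
  obtain ⟨P, hP⟩ := hp
  intro v hv
  by_cases h : v ≠ G.s ∧ v ≠ G.t
  · by_contra hn
    refine hr _ (Step.vert G v hv h.1 h.2 fun P hP hvP => hn (hP.reach_mem hvP))
  · by_cases hs : v = G.s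
    · exact hs ▸ hP.reach_mem hP.head_mem
    · have ht : v = G.t := by tauto
      exact ht ▸ hP.reach_mem hP.last_mem

theorem IsReduced.of_paths_eq_empty {G : STDigraph α} (hr : G.IsReduced) (hp : G.paths = ∅) :
    G.verts ⊆ {G.s, G.t} ∧ G.edges = ∅ := by
  constructor
  · intro v hv
    by_contra hn
    simp only [Finset.mem_insert, Finset.mem_singleton, not_or] at hn
    exact hr _ (Step.vert G v hv hn.1 hn.2 fun P hP => by simp [hp] at hP)
  · refine Finset.eq_empty_of_forall_notMem fun ⟨u, v⟩ h => ?_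
    exact hr _ (Step.edge G u v h fun P hP => by simp [hp] at hP)

/-- Let A be the set of inner vertices of degree two, B the rest, and S the sum of the degrees in B.
By the third rule no edge joins two vertices of A, so each vertex of A sends one edge into B and
receives one from B, and 2|A| ≤ S. Inner vertices of B have degree at least three, and s and t have
degree at least two by the second rule, so 3|B| ≤ S + 2. Together with 2m = 2|A| + S and m + 2 ≤ n +
p this gives n ≤ 5p. -/
theorem IsReduced.card_verts_le {G : STDigraph α} (hr : G.IsReduced) (hG : G.IsDAG)
    (hp : G.paths.Nonempty) : G.verts.card ≤ 5 * G.paths.ncard := by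
  have hT := hr.trim hp
  have hm := hG.card_edges_add_two_le hT
  -- If s = t, every vertex is reachable from s and reaches s, so acyclicity leaves only s.
  by_cases hst : G.s = G.t
  · have : G.verts ⊆ {G.s} := fun v hv => by
      have := hT v hv
      rw [← hst] at this
      exact Finset.mem_singleton.2 (hG.antisymm this.2 this.1)
    have := Finset.card_le_card this
    have := (Set.ncard_pos hG.finite_paths).2 hp
    simp at *
    omega
  have hin : ∀ v ∈ G.verts, v ≠ G.s → 0 < (G.edges.filter (fun e => e.2 = v)).card :=
    fun v hv h => in_pos (hT.exists_pred hv h).choose_spec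
  have hout : ∀ v ∈ G.verts, v ≠ G.t → 0 < (G.edges.filter (fun e => e.1 = v)).card :=
    fun v hv h => out_pos (hT.exists_succ hv h).choose_spec
  have hs : 2 ≤ G.deg G.s := by
    by_contra h
    refine hr _ (Step.source G _ hst ?_ (hT.exists_succ hG.s_mem hst).choose_spec)
    have := hout _ hG.s_mem hst
    unfold deg at h ⊢
    omega
  have ht : 2 ≤ G.deg G.t := by
    by_contra h
    refine hr _ (Step.dest G _ hst ?_ (hT.exists_pred hG.t_mem (Ne.symm hst)).choose_spec)
    have := hin _ hG.t_mem (Ne.symm hst)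
    unfold deg at h ⊢
    omega
  let p : α → Prop := fun v => v ≠ G.s ∧ v ≠ G.t ∧ G.deg v = 2
  let A := G.verts.filter p
  let B := G.verts.filter fun v => ¬ p v
  have hAB : A.card + B.card = G.verts.card := Finset.card_filter_add_card_filter_not _
  have hnoA : ∀ a ∈ A, ∀ b ∈ A, ¬ G.Adj a b := by
    intro a ha b hb hab
    obtain ⟨_, ha1, ha2, ha3⟩ := Finset.mem_filter.1 ha
    obtain ⟨hb0, hb1, hb2, hb3⟩ := Finset.mem_filter.1 hb
    obtain ⟨c, hc⟩ := hT.exists_succ hb0 hb2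
    exact hr _ (Step.degTwo G a b c hab hc ha3 hb3 ha1 ha2 hb1 hb2)
  have hB : ∀ a ∈ G.verts, a ∉ A → a ∈ B := fun a ha h =>
    Finset.mem_filter.2 ⟨ha, fun h' => h (Finset.mem_filter.2 ⟨ha, h'⟩)⟩
  have h1 : A.card ≤ (G.edges.filter (fun e => e.2 ∈ B)).card := by
    have : A ⊆ (G.edges.filter (fun e => e.2 ∈ B)).image Prod.fst := by
      intro a ha
      have ha' := Finset.mem_filter.1 ha
      obtain ⟨c, hc⟩ := hT.exists_succ ha'.1 ha'.2.2.1
      exact Finset.mem_image.2 ⟨(a, c), Finset.mem_filter.2 ⟨hc, hB _ (hG.edges_mem _ hc).2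
        fun h => hnoA a ha c h hc⟩, rfl⟩
    exact (Finset.card_le_card this).trans Finset.card_image_le
  have h2 : A.card ≤ (G.edges.filter (fun e => e.1 ∈ B)).card := by
    have : A ⊆ (G.edges.filter (fun e => e.1 ∈ B)).image Prod.snd := by
      intro a ha
      have ha' := Finset.mem_filter.1 ha
      obtain ⟨c, hc⟩ := hT.exists_pred ha'.1 ha'.2.1
      exact Finset.mem_image.2 ⟨(c, a), Finset.mem_filter.2 ⟨hc, hB _ (hG.edges_mem _ hc).1
        fun h => hnoA c h a ha hc⟩, rfl⟩
    exact (Finset.card_le_card this).trans Finset.card_image_le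
  have hsum : ∀ S : Finset α, ∑ v ∈ S, G.deg v = (G.edges.filter (fun e => e.1 ∈ S)).card +
      (G.edges.filter (fun e => e.2 ∈ S)).card := fun S => by
    rw [← sum_out, ← sum_in, ← Finset.sum_add_distrib]
    rfl
  have hA2 : ∑ v ∈ A, G.deg v = A.card * 2 :=
    Finset.sum_const_nat fun v hv => (Finset.mem_filter.1 hv).2.2.2
  have hAll : ∑ v ∈ A, G.deg v + ∑ v ∈ B, G.deg v = G.edges.card + G.edges.card := by
    rw [Finset.sum_filter_add_sum_filter_not, hsum,
      Finset.filter_true_of_mem fun e he => (hG.edges_mem e he).1,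
      Finset.filter_true_of_mem fun e he => (hG.edges_mem e he).2]
  -- The summand 2 makes up for s and t, whose degrees may be two only.
  have hB3 : 3 * B.card ≤ ∑ v ∈ B, G.deg v + 2 := by
    have : ∑ v ∈ B, 3 ≤ ∑ v ∈ B, (G.deg v + ((if v = G.s then 1 else 0) +
        (if v = G.t then 1 else 0))) := by
      refine Finset.sum_le_sum fun v hv => ?_
      obtain ⟨hv, hvp⟩ := Finset.mem_filter.1 hv
      by_cases e1 : v = G.s
      · subst e1; simp; omega
      by_cases e2 : v = G.t
      · subst e2; simp; omega
      have := hin v hv e1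
      have := hout v hv e2
      have h3 : G.deg v ≠ 2 := fun h => hvp ⟨e1, e2, h⟩
      unfold deg at h3 ⊢
      omega
    rw [Finset.sum_const, Finset.sum_add_distrib, Finset.sum_add_distrib, Finset.sum_ite_eq',
      Finset.sum_ite_eq', smul_eq_mul] at this
    split_ifs at this <;> omega
  -- The path bound gives S + 4 ≤ 2|B| + 2p, and with 3|B| ≤ S + 2 this becomes S + 8 ≤ 6p. Then |A|
  -- ≤ S/2 and |B| ≤ (S + 2)/3 add up to at most 5p.
  have := hsum B
  omega

theorem IsDAG.reduced_spec {G G' : STDigraph α} (hG : G.IsDAG) (h : ReflTransGen Step G G')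
    (hr : G'.IsReduced) : G'.IsDAG ∧ (∀ k, G.IsYes k ↔ G'.IsYes k) ∧
      (G'.paths.Nonempty → (G'.verts.card : ℝ) / 5 ≤ (G'.paths.ncard : ℝ)) ∧
      (∀ k, G.IsYes k → G'.verts.card ≤ 5 * 2 ^ k) ∧
      (∀ T ⊆ G'.verts, G'.IsTrackingSet T ↔ G'.TrackingSetCondition T) := by
  obtain ⟨hG', hk⟩ := hG.of_steps h
  refine ⟨hG', hk, fun hp => ?_, fun k hy => ?_, fun T hT => ?_⟩
  · have := hr.card_verts_le hG' hp
    rw [div_le_iff₀ (by norm_num), mul_comm]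
    exact_mod_cast this
  · rcases G'.paths.eq_empty_or_nonempty with hp | hp
    -- Without any path only the terminals survive, and 2 ≤ 5·2^k.
    · have := Finset.card_le_card (hr.of_paths_eq_empty hp).1
      have h2 := Finset.card_le_two (a := G'.s) (b := G'.t)
      have := Nat.one_le_two_pow (n := k)
      omega
    · obtain ⟨T, hT, hTk⟩ := (hk k).1 hy
      have := hr.card_verts_le hG' hp
      have h2 := hT.paths_ncard_le
      have := Nat.pow_le_pow_right (n := 2) (by norm_num) hTk
      omega
  · rcases G'.paths.eq_empty_or_nonempty with hp | hp
    -- Without any path every set tracks, and the reduced graph has no edges, so the condition holds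
    -- because all paths in it are single vertices.
    · refine iff_of_true (isTrackingSet_iff.2 ⟨hT, fun P hP => by simp [hp] at hP⟩) ?_
      intro u _ v _ P₁ P₂ h₁ h₂
      rw [induce_isPath] at h₁ h₂
      have he := (hr.of_paths_eq_empty hp).2
      have key : ∀ P, G'.IsPath u v P → P = [u] := by
        intro P hP
        obtain _ | ⟨a, _ | ⟨b, P⟩⟩ := P
        · exact (hP.ne_nil rfl).elim
        · simpa using hP.head_eq
        · have := hP.chain
          rw [List.isChain_cons_cons, he] at this
          simp at this
      rw [key _ h₁.1, key _ h₂.1]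
    · exact hG'.isTrackingSet_iff_condition (hr.trim hp) hT

end STDigraph

/-! ### Topologically sorted edge lists, trimming, and chain heads -/

namespace STDigraph

open Relation

section

variable {α : Type*}

/-- No edge of the list starts where a later edge ends, and there are no loops. -/
def TopoSorted (E : List (α × α)) : Prop :=
  E.Pairwise (fun e f => e.1 ≠ f.2) ∧ ∀ e ∈ E, e.1 ≠ e.2

theorem TopoSorted.of_append {E F : List (α × α)} (h : TopoSorted (E ++ F)) : TopoSorted E :=
  ⟨(List.pairwise_append.1 h.1).1, fun e he => h.2 e (List.mem_append_left _ he)⟩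

theorem TopoSorted.filter {E : List (α × α)} (h : TopoSorted E) (p : α × α → Bool) :
    TopoSorted (E.filter p) :=
  ⟨h.1.filter p, fun e he => h.2 e (List.mem_of_mem_filter he)⟩

/-- The head of the last edge has no out-edge in the list. This is why appending an edge can change
reachability only at that head, so one pass through the list suffices. -/
theorem TopoSorted.not_mem {E : List (α × α)} {a b : α} (h : TopoSorted (E ++ [(a, b)])) (c : α) :
    (b, c) ∉ E := fun hc =>
  (List.pairwise_append.1 h.1).2.2 _ hc (a, b) (by simp) rfl

theorem TopoSorted.reverse {E : List (α × α)} (h : TopoSorted E) :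
    TopoSorted (E.reverse.map Prod.swap) := by
  constructor
  · rw [List.pairwise_map, List.pairwise_reverse]
    exact h.1.imp fun h => Ne.symm h
  · intro e he
    obtain ⟨f, hf, rfl⟩ := List.mem_map.1 he
    exact Ne.symm (h.2 f (List.mem_reverse.1 hf))

/-- How reachability along a class of edges changes when an edge is appended to a sorted list. -/
theorem TopoSorted.reach_append {E : List (α × α)} {a b : α} (h : TopoSorted (E ++ [(a, b)]))
    (p : α → Prop) {u v : α} :
    ReflTransGen (fun x y => (x, y) ∈ E ++ [(a, b)] ∧ p x) u v ↔
      ReflTransGen (fun x y => (x, y) ∈ E ∧ p x) u v ∨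
        (ReflTransGen (fun x y => (x, y) ∈ E ∧ p x) u a ∧ p a) ∧ v = b := by
  constructor
  · intro hr
    induction hr with
    | refl => exact .inl .refl
    | @tail v w _ hvw ih =>
      obtain ⟨hvw, hp⟩ := hvw
      rcases ih with ih | ⟨ih, rfl⟩
      · rcases List.mem_append.1 hvw with hvw | hvw
        · exact .inl (ih.tail ⟨hvw, hp⟩)
        · simp only [List.mem_singleton, Prod.mk.injEq] at hvw
          obtain ⟨rfl, rfl⟩ := hvw
          exact .inr ⟨⟨ih, hp⟩, rfl⟩
      · rcases List.mem_append.1 hvw with hvw | hvw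
        · exact (h.not_mem _ hvw).elim
        · simp only [List.mem_singleton, Prod.mk.injEq] at hvw
          exact (h.2 (a, v) (by simp) hvw.1.symm).elim
  · have hm : ∀ {x y}, ReflTransGen (fun x y => (x, y) ∈ E ∧ p x) x y →
        ReflTransGen (fun x y => (x, y) ∈ E ++ [(a, b)] ∧ p x) x y := fun {x y} h =>
      ReflTransGen.mono (fun x y h => ⟨List.mem_append_left _ h.1, h.2⟩) x y h
    rintro (h' | ⟨⟨h', hp⟩, rfl⟩)
    · exact hm h'
    · exact (hm h').tail ⟨by simp, hp⟩

/-- By induction on the list: a cycle using the last edge would have to leave its head, which is a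
sink. -/
theorem TopoSorted.acyclic {E : List (α × α)} (h : TopoSorted E) (v : α) :
    ¬ TransGen (fun a b => (a, b) ∈ E) v v := by
  induction E using List.reverseRecOn generalizing v with
  | nil => intro h; obtain ⟨_, h, _⟩ := TransGen.head'_iff.1 h; simp at h
  | append_singleton E e ih =>
    obtain ⟨a, b⟩ := e
    intro hv
    obtain ⟨w, hvw, hr⟩ := TransGen.head'_iff.1 hv
    have hreach : ∀ {u v}, ReflTransGen (fun x y => (x, y) ∈ E ++ [(a, b)]) u v →
        ReflTransGen (fun x y => (x, y) ∈ E) u v ∨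
        ReflTransGen (fun x y => (x, y) ∈ E) u a ∧ v = b := fun hr => by
      simpa using (h.reach_append (fun _ => True)).1 (by simpa using hr)
    have hb : ∀ v, ReflTransGen (fun x y => (x, y) ∈ E) b v → v = b := fun v hv => by
      rcases reflTransGen_iff_eq_or_transGen.1 hv with h' | h'
      · exact h'
      · obtain ⟨w, hw, -⟩ := TransGen.head'_iff.1 h'
        exact (h.not_mem _ hw).elim
    have hab : a ≠ b := h.2 (a, b) (by simp)
    rcases List.mem_append.1 hvw with hvw' | hvw'
    · rcases hreach hr with hr | ⟨-, rfl⟩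
      · exact ih h.of_append v (.head' hvw' hr)
      · exact h.not_mem _ hvw'
    · simp only [List.mem_singleton, Prod.mk.injEq] at hvw'
      obtain ⟨rfl, rfl⟩ := hvw'
      rcases hreach hr with hr | ⟨hr, -⟩ <;> exact hab (hb _ hr)

/-- How clashes change when an edge is appended to a sorted list. -/
theorem TopoSorted.clash_append {E : List (α × α)} {a b : α} (h : TopoSorted (E ++ [(a, b)]))
    (hn : (a, b) ∉ E) (p : α → Prop) {u : α} :
    Clash (fun x y => (x, y) ∈ E ++ [(a, b)] ∧ p x) u ↔
      Clash (fun x y => (x, y) ∈ E ∧ p x) u ∨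
        (ReflTransGen (fun x y => (x, y) ∈ E ∧ p x) u a ∧ p a) ∧
          ∃ a', ReflTransGen (fun x y => (x, y) ∈ E ∧ p x) u a' ∧ (a', b) ∈ E ∧ p a' := by
  have hab : a ≠ b := h.2 (a, b) (by simp)
  -- The new edge makes at most b newly reachable, and b is the tail of no edge; so tails of edges
  -- are reachable exactly when they were before.
  have hr : ∀ {x y}, (x, y) ∈ E ++ [(a, b)] →
      ReflTransGen (fun x y => (x, y) ∈ E ++ [(a, b)] ∧ p x) u x →
      ReflTransGen (fun x y => (x, y) ∈ E ∧ p x) u x := by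
    intro x y hxy hx
    rcases (h.reach_append p).1 hx with hx | ⟨-, rfl⟩
    · exact hx
    · rcases List.mem_append.1 hxy with hxy | hxy
      · exact (h.not_mem _ hxy).elim
      · simp only [List.mem_singleton, Prod.mk.injEq] at hxy
        exact (hab hxy.1.symm).elim
  constructor
  · rintro ⟨a₁, a₂, c, hne, h1, h2, ⟨e1, p1⟩, e2, p2⟩
    replace h1 := hr e1 h1
    replace h2 := hr e2 h2
    simp only [List.mem_append, List.mem_singleton, Prod.mk.injEq] at e1 e2
    rcases e1 with e1 | ⟨rfl, rfl⟩ <;> rcases e2 with e2 | ⟨rfl, e2⟩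
    · exact .inl ⟨a₁, a₂, c, hne, h1, h2, ⟨e1, p1⟩, e2, p2⟩
    · subst e2
      exact .inr ⟨⟨h2, p2⟩, a₁, h1, e1, p1⟩
    · exact .inr ⟨⟨h1, p1⟩, a₂, h2, e2, p2⟩
    · exact (hne rfl).elim
  · have hm : ∀ {x y}, ReflTransGen (fun x y => (x, y) ∈ E ∧ p x) x y →
        ReflTransGen (fun x y => (x, y) ∈ E ++ [(a, b)] ∧ p x) x y := fun {x y} h =>
      ReflTransGen.mono (fun x y h => ⟨List.mem_append_left _ h.1, h.2⟩) x y h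
    rintro (⟨a₁, a₂, c, hne, h1, h2, ⟨e1, p1⟩, e2, p2⟩ | ⟨⟨h1, p1⟩, a', h2, e2, p2⟩)
    · exact ⟨a₁, a₂, c, hne, hm h1, hm h2, ⟨by simp [e1], p1⟩, by simp [e2], p2⟩
    · exact ⟨a, a', b, by rintro rfl; exact hn e2, hm h1, hm h2, ⟨by simp, p1⟩, by simp [e2], p2⟩

open Classical in
/-- The subgraph of the vertices and edges on walks from the source to the destination. -/
noncomputable def trim (G : STDigraph α) : STDigraph α where
  verts := G.verts.filter fun v => ReflTransGen G.Adj G.s v ∧ ReflTransGen G.Adj v G.t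
  edges := G.edges.filter fun e => ReflTransGen G.Adj G.s e.1 ∧ ReflTransGen G.Adj e.2 G.t
  s := G.s
  t := G.t

theorem trim_adj {G : STDigraph α} {a b : α} : G.trim.Adj a b ↔
    G.Adj a b ∧ ReflTransGen G.Adj G.s a ∧ ReflTransGen G.Adj b G.t := by
  simp [trim, Adj]

theorem mem_trim {G : STDigraph α} {a : α} : a ∈ G.trim.verts ↔
    a ∈ G.verts ∧ ReflTransGen G.Adj G.s a ∧ ReflTransGen G.Adj a G.t := by
  simp [trim]

theorem IsDAG.trim {G : STDigraph α} (hG : G.IsDAG) (h : ReflTransGen G.Adj G.s G.t) :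
    G.trim.IsDAG where
  s_mem := mem_trim.2 ⟨hG.s_mem, .refl, h⟩
  t_mem := mem_trim.2 ⟨hG.t_mem, h, .refl⟩
  edges_mem := by
    rintro ⟨a, b⟩ he
    obtain ⟨h1, h2, h3⟩ := trim_adj.1 he
    exact ⟨mem_trim.2 ⟨(hG.edges_mem _ h1).1, h2, h3.head h1⟩,
      mem_trim.2 ⟨(hG.edges_mem _ h1).2, h2.tail h1, h3⟩⟩
  acyclic v hv := hG.acyclic v (TransGen.mono (fun a b h => (trim_adj.1 h).1) v v hv)

theorem trim_trim (G : STDigraph α) : G.trim.Trim := by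
  have key : ∀ a b, ReflTransGen G.Adj G.s a → ReflTransGen G.Adj a b → ReflTransGen G.Adj b G.t →
      ReflTransGen G.trim.Adj a b := by
    intro a b ha hab hb
    induction hab with
    | refl => exact .refl
    | tail h1 h2 ih =>
      exact (ih (hb.head h2)).tail (trim_adj.2 ⟨h2, ha.trans h1, hb⟩)
  intro v hv
  obtain ⟨_, h1, h2⟩ := mem_trim.1 hv
  exact ⟨key _ _ .refl h1 h2, key _ _ h1 h2 .refl⟩

theorem IsDAG.trim_paths {G : STDigraph α} (hG : G.IsDAG) (h : ReflTransGen G.Adj G.s G.t)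
    (P : List α) : P ∈ G.trim.paths ↔ P ∈ G.paths := by
  constructor
  · intro hP
    exact hG.isPath hG.s_mem hP.head_eq hP.last_eq (hP.chain.imp fun a b h => (trim_adj.1 h).1)
  · intro hP
    refine (hG.trim h).isPath (hG.trim h).s_mem hP.head_eq hP.last_eq ?_
    exact hP.chain.imp_of_mem_imp fun a b ha hb hab =>
      trim_adj.2 ⟨hab, (hP.reach_mem ha).1, (hP.reach_mem hb).2⟩

end

variable {α : Type*} [DecidableEq α]

theorem IsDAG.trim_isYes {G : STDigraph α} (hG : G.IsDAG) (h : ReflTransGen G.Adj G.s G.t) (k : ℕ) :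
    G.trim.IsYes k ↔ G.IsYes k := by
  have hp := hG.trim_paths h
  constructor
  · intro h
    exact h.transfer id id (fun v hv => (mem_trim.1 hv).1) (fun P hP => (hp P).2 hP)
      (fun _ _ _ _ h => h) (fun _ _ _ _ _ _ h => h)
  · intro hy
    classical
    -- Trackers outside the trimmed graph lie on no path and are moved to s.
    refine hy.transfer (fun v => if v ∈ G.trim.verts then v else G.s) id ?_
      (fun P hP => (hp P).1 hP) (fun _ _ _ _ h => h) ?_
    · intro v _
      by_cases hv : v ∈ G.trim.verts
      · simp [hv]
      · simp only [hv, if_false]; exact (hG.trim h).s_mem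
    · intro v _ P₁ h₁ P₂ h₂ h
      by_cases hv : v ∈ G.trim.verts
      · simp only [hv, if_true] at h; exact h
      · exact iff_of_false (fun h => hv (h₁.mem_verts v h)) (fun h => hv (h₂.mem_verts v h))

/-- If there is no `s`-`t` path, the empty set is a tracking set. -/
theorem isYes_of_not_reach {G : STDigraph α} (h : ¬ ReflTransGen G.Adj G.s G.t) (k : ℕ) :
    G.IsYes k :=
  ⟨∅, isTrackingSet_iff.2 ⟨by simp, fun P hP => (h (IsPath.reach hP)).elim⟩, by simp⟩

/-- The first vertices of the maximal chains of edges `u → v` where `u` has no other out-neighbour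
and `v` has no other in-neighbour. -/
def chainHeads (G : STDigraph α) : Finset α :=
  G.verts.filter fun v => (G.edges.filter (fun e => e.2 = v)).card ≠ 1 ∨
    ∃ e ∈ G.edges, e.2 = v ∧ 1 < (G.edges.filter (fun f => f.1 = e.1)).card

/-- A head other than s either has in-degree at least two or is entered by an edge whose tail has
out-degree at least two. There are at most m - n + 1 heads of the first kind and at most 2(m - n) +
2 such edges. Since m - n ≤ p - 2, the total with s is at most 3p - 2. -/
theorem IsDAG.chainHeads_card_le {G : STDigraph α} (hG : G.IsDAG) (hT : G.Trim) :
    G.chainHeads.card ≤ 3 * G.paths.ncard := by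
  have hm := hG.card_edges_add_two_le hT
  let i : α → ℕ := fun v => (G.edges.filter (fun e => e.2 = v)).card
  let o : α → ℕ := fun v => (G.edges.filter (fun e => e.1 = v)).card
  have hi : ∑ v ∈ G.verts, i v = G.edges.card := by
    rw [sum_in, Finset.filter_true_of_mem fun e he => (hG.edges_mem e he).2]
  have ho : ∑ v ∈ G.verts, o v = G.edges.card := by
    rw [sum_out, Finset.filter_true_of_mem fun e he => (hG.edges_mem e he).1]
  let I := G.verts.filter fun v => 1 < i v
  let O := G.verts.filter fun v => 1 < o v
  have hsub : G.chainHeads ⊆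
      insert G.s (I ∪ (G.edges.filter (fun e => e.1 ∈ O)).image Prod.snd) := by
    intro v hv
    obtain ⟨hv, h⟩ := Finset.mem_filter.1 hv
    rw [Finset.mem_insert, Finset.mem_union]
    by_cases hs : v = G.s
    · exact .inl hs
    rcases h with h | ⟨e, he, rfl, h⟩
    · obtain ⟨w, hw⟩ := hT.exists_pred hv hs
      have := in_pos hw
      exact .inr (.inl (Finset.mem_filter.2 ⟨hv, by show 1 < Finset.card _; omega⟩))
    · exact .inr (.inr (Finset.mem_image.2 ⟨e, Finset.mem_filter.2 ⟨he,
        Finset.mem_filter.2 ⟨(hG.edges_mem e he).1, h⟩⟩, rfl⟩))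
  have h1 : G.chainHeads.card ≤ I.card + ∑ v ∈ O, o v + 1 := by
    refine (Finset.card_le_card hsub).trans ((Finset.card_insert_le _ _).trans ?_)
    refine Nat.add_le_add_right ((Finset.card_union_le _ _).trans ?_) 1
    exact Nat.add_le_add_left (Finset.card_image_le.trans (sum_out _).ge) _
  have h2 : I.card + G.verts.card ≤ G.edges.card + 1 := by
    have : ∑ v ∈ G.verts, ((if 1 < i v then 1 else 0) + 1) ≤
        ∑ v ∈ G.verts, (i v + if v = G.s then 1 else 0) := by
      refine Finset.sum_le_sum fun v hv => ?_
      by_cases hs : v = G.s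
      · simp only [hs, if_true]; split_ifs <;> omega
      · obtain ⟨w, hw⟩ := hT.exists_pred hv hs
        have : 0 < i v := in_pos hw
        split_ifs <;> omega
    rw [Finset.sum_add_distrib, Finset.sum_add_distrib, hi, Finset.sum_ite_eq', if_pos hG.s_mem,
      Finset.sum_boole, Finset.sum_const] at this
    simpa using this
  -- At every vertex with positive out-degree o, the contribution of o to this sum plus 2 is at most
  -- 2o: equality holds for o = 1, and o + 2 ≤ 2o for o ≥ 2. Only t may have out-degree zero, which
  -- costs 2.
  have h3 : ∑ v ∈ O, o v + 2 * G.verts.card ≤ 2 * G.edges.card + 2 := by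
    have : ∑ v ∈ G.verts, ((if 1 < o v then o v else 0) + 2) ≤
        ∑ v ∈ G.verts, (2 * o v + if v = G.t then 2 else 0) := by
      refine Finset.sum_le_sum fun v hv => ?_
      by_cases hs : v = G.t
      · simp only [hs, if_true]; split_ifs <;> omega
      · obtain ⟨w, hw⟩ := hT.exists_succ hv hs
        have : 0 < o v := out_pos hw
        split_ifs <;> omega
    rw [Finset.sum_add_distrib, Finset.sum_add_distrib, ← Finset.mul_sum, ho, Finset.sum_ite_eq',
      if_pos hG.t_mem, ← Finset.sum_filter, Finset.sum_const, smul_eq_mul] at this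
    show ∑ v ∈ G.verts.filter fun v => 1 < o v, o v + _ ≤ _
    omega
  omega

/-- Nothing enters s, so its in-degree is not one. Consequently there is always at least one head,
which the enumeration of tuples needs. -/
theorem IsDAG.source_mem_chainHeads {G : STDigraph α} (hG : G.IsDAG) (hT : G.Trim) :
    G.s ∈ G.chainHeads := by
  refine Finset.mem_filter.2 ⟨hG.s_mem, .inl ?_⟩
  rw [Finset.filter_eq_empty_iff.2]
  · simp
  · rintro ⟨a, b⟩ he rfl
    exact hG.not_reach he (hT a (hG.edges_mem _ he).1).1

/-- A vertex v that is not a head has a single in-edge, and this edge is the single out-edge of its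
tail u. Hence a path visits v if and only if it visits u. Going backwards in this way ends at a head
by well-foundedness. -/
theorem IsDAG.exists_chainHead {G : STDigraph α} (hG : G.IsDAG) (hT : G.Trim) {v : α}
    (hv : v ∈ G.verts) : ∃ r ∈ G.chainHeads, ∀ P ∈ G.paths, v ∈ P ↔ r ∈ P := by
  induction v using hG.wellFounded.induction with
  | _ v ih =>
    by_cases hh : v ∈ G.chainHeads
    · exact ⟨v, hh, fun _ _ => Iff.rfl⟩
    have hs : v ≠ G.s := by rintro rfl; exact hh (hG.source_mem_chainHeads hT)
    obtain ⟨u, hu⟩ := hT.exists_pred hv hs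
    obtain ⟨r, hr, hP⟩ := ih u hu (hG.edges_mem _ hu).1
    refine ⟨r, hr, fun P hPp => ?_⟩
    rw [← hP P hPp]
    simp only [chainHeads, Finset.mem_filter, hv, true_and, not_or, not_not, not_exists,
      not_and, not_lt] at hh
    constructor
    · intro h
      obtain ⟨A, B, rfl⟩ := List.append_of_mem h
      rcases List.eq_nil_or_concat A with rfl | ⟨A, a, rfl⟩
      · exact (hs (by simpa using hPp.head_eq)).elim
      · have hc : ([a, v]).IsChain G.Adj := hPp.chain.infix ⟨A, B, by simp⟩
        simp only [List.isChain_pair] at hc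
        obtain rfl := exists_in_of_deg hu hh.1.le hc
        simp
    · intro h
      obtain ⟨A, B, rfl⟩ := List.append_of_mem h
      obtain _ | ⟨b, B⟩ := B
      · obtain rfl : u = G.t := by simpa using hPp.last_eq
        -- The path cannot stop at u: otherwise u = t, although v lies behind u and reaches t.
        exact (hG.not_reach hu (hT v hv).2).elim
      · have hc : ([u, b]).IsChain G.Adj := hPp.chain.infix ⟨A, B, by simp⟩
        simp only [List.isChain_pair] at hc
        obtain rfl := exists_out_of_deg hu (hh.2 (u, v) hu rfl) hc
        simp

/-- It suffices to look for tracking sets among the chain heads. -/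
theorem IsDAG.isYes_iff_chainHeads {G : STDigraph α} (hG : G.IsDAG) (hT : G.Trim) (k : ℕ) :
    G.IsYes k ↔ ∃ f : ℕ → α, (∀ i < k, f i ∈ G.chainHeads) ∧
      G.IsTrackingSet ((Finset.range k).image f) := by
  constructor
  · rintro ⟨T, hTr, hk⟩
    have hrep : ∀ v, ∃ r, r ∈ G.chainHeads ∧ (v ∈ G.verts → ∀ P ∈ G.paths, v ∈ P ↔ r ∈ P) := by
      intro v
      by_cases hv : v ∈ G.verts
      · obtain ⟨r, hr, h⟩ := hG.exists_chainHead hT hv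
        exact ⟨r, hr, fun _ => h⟩
      · exact ⟨G.s, hG.source_mem_chainHeads hT, fun h => (hv h).elim⟩
    choose r hr hrP using hrep
    have hsub : G.chainHeads ⊆ G.verts := Finset.filter_subset _ _
    have h1 : G.IsTrackingSet (T.image r) := hTr.transfer r id (fun v _ => hsub (hr v))
      (fun P h => h) (fun _ _ _ _ h => h) fun v hv P₁ h₁ P₂ h₂ h => by
        rw [id, id, hrP v hv P₁ h₁, hrP v hv P₂ h₂, h]
    -- The tuple lists the representatives and is padded by s to length k. Padding is harmless
    -- because supersets of tracking sets track.
    let f : ℕ → α := fun i => (T.toList.map r).getD i (G.s)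
    have hf : ∀ i, f i ∈ G.chainHeads := by
      intro i
      by_cases h : i < (T.toList.map r).length
      · have : f i = (T.toList.map r)[i] := List.getD_eq_getElem _ _ h
        rw [this]
        obtain ⟨v, -, hv⟩ := List.mem_map.1 (List.getElem_mem h)
        rw [← hv]
        exact hr v
      · have : f i = G.s := List.getD_eq_default _ _ (by omega)
        rw [this]
        exact hG.source_mem_chainHeads hT
    refine ⟨f, fun i _ => hf i, h1.mono ?_ ?_⟩
    · intro x hx
      have hx : x ∈ T.toList.map r := by simpa using hx
      obtain ⟨i, hi, rfl⟩ := List.mem_iff_getElem.1 hx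
      refine Finset.mem_image.2 ⟨i, ?_, List.getD_eq_getElem _ _ hi⟩
      simp at hi ⊢
      omega
    · intro x hx
      obtain ⟨i, -, rfl⟩ := Finset.mem_image.1 hx
      exact hsub (hf i)
  · rintro ⟨f, -, hf⟩
    exact ⟨_, hf, Finset.card_image_le.trans (by simp)⟩

end STDigraph

/-! ### Program logic for the word RAM, with step counts -/

namespace RAM

/-- `p`, started in `σ`, halts within the bound `B`, and the final state and the number of steps
satisfy `Q`. -/
def wp (B : ℕ) (p : Prog) (Q : State → ℕ → Prop) (σ : State) : Prop :=
  ∃ σ' τ, Exec B p σ σ' τ ∧ Q σ' τ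

variable {B : ℕ} {p q : Prog} {Q R : State → ℕ → Prop} {σ : State}

theorem wp.mono (h : wp B p Q σ) (hQ : ∀ σ' τ, Q σ' τ → R σ' τ) : wp B p R σ := by
  obtain ⟨σ', τ, h1, h2⟩ := h
  exact ⟨σ', τ, h1, hQ _ _ h2⟩

/-- The rules for programs without loops are equivalences, so rewriting with them executes such code
symbolically and leaves the word bounds as side conditions. -/
theorem wp_skip : wp B .skip Q σ ↔ Q σ 1 := by
  constructor
  · rintro ⟨_, _, h, hQ⟩
    cases h
    exact hQ
  · exact fun h => ⟨_, _, .skip σ, h⟩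

theorem wp_assign {x : ℕ} {e : Expr} : wp B (.assign x e) Q σ ↔
    (e.eval σ ≤ B ∧ ∀ A i, e = .read A i → i.eval σ ≤ B) ∧ Q (σ.setVar x (e.eval σ)) 1 := by
  constructor
  · rintro ⟨_, _, h, hQ⟩
    cases h
    exact ⟨⟨by assumption, by assumption⟩, hQ⟩
  · exact fun h => ⟨_, _, .assign σ x e h.1.1 h.1.2, h.2⟩

theorem wp_atom {x : ℕ} {a : Operand} : wp B (.assign x (.atom a)) Q σ ↔
    a.eval σ ≤ B ∧ Q (σ.setVar x (a.eval σ)) 1 := by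
  simp [wp_assign, Expr.eval]

theorem wp_add {x : ℕ} {a b : Operand} : wp B (.assign x (.add a b)) Q σ ↔
    a.eval σ + b.eval σ ≤ B ∧ Q (σ.setVar x (a.eval σ + b.eval σ)) 1 := by
  simp [wp_assign, Expr.eval]

theorem wp_sub {x : ℕ} {a b : Operand} : wp B (.assign x (.sub a b)) Q σ ↔
    a.eval σ - b.eval σ ≤ B ∧ Q (σ.setVar x (a.eval σ - b.eval σ)) 1 := by
  simp [wp_assign, Expr.eval]

theorem wp_read {x A : ℕ} {i : Operand} : wp B (.assign x (.read A i)) Q σ ↔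
    (i.eval σ ≤ B ∧ σ.arrs A (i.eval σ) ≤ B) ∧ Q (σ.setVar x (σ.arrs A (i.eval σ))) 1 := by
  simp only [wp_assign, Expr.eval, Expr.read.injEq]
  refine and_congr_left fun _ => ⟨fun h => ⟨h.2 A i ⟨rfl, rfl⟩, h.1⟩, fun h => ⟨h.2, ?_⟩⟩
  rintro A' i' ⟨rfl, rfl⟩
  exact h.1

theorem wp_store {A : ℕ} {i a : Operand} : wp B (.store A i a) Q σ ↔
    (i.eval σ ≤ B ∧ a.eval σ ≤ B) ∧ Q (σ.setArr A (i.eval σ) (a.eval σ)) 1 := by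
  constructor
  · rintro ⟨_, _, h, hQ⟩
    cases h
    exact ⟨⟨by assumption, by assumption⟩, hQ⟩
  · exact fun h => ⟨_, _, .store σ A i a h.1.1 h.1.2, h.2⟩

theorem wp_seq : wp B (.seq p q) Q σ ↔
    wp B p (fun σ' τ => wp B q (fun σ'' τ' => Q σ'' (τ + τ')) σ') σ := by
  constructor
  · rintro ⟨_, _, h, hQ⟩
    cases h with
    | seq h1 h2 => exact ⟨_, _, h1, _, _, h2, hQ⟩
  · rintro ⟨_, _, h1, _, _, h2, hQ⟩
    exact ⟨_, _, .seq h1 h2, hQ⟩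

open Classical in
theorem wp_ite {b : Test} : wp B (.ite b p q) Q σ ↔
    if b.Holds σ then wp B p (fun σ' τ => Q σ' (τ + 1)) σ
    else wp B q (fun σ' τ => Q σ' (τ + 1)) σ := by
  constructor
  · rintro ⟨_, _, h, hQ⟩
    cases h with
    | ite_true hb h => rw [if_pos hb]; exact ⟨_, _, h, hQ⟩
    | ite_false hb h => rw [if_neg hb]; exact ⟨_, _, h, hQ⟩
  · split_ifs with hb
    · rintro ⟨_, _, h, hQ⟩
      exact ⟨_, _, .ite_true hb h, hQ⟩
    · rintro ⟨_, _, h, hQ⟩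
      exact ⟨_, _, .ite_false hb h, hQ⟩

/-- The programs of a list, run one after the other. -/
def block : List Prog → Prog
  | [] => .skip
  | p :: l => .seq p (block l)

theorem wp_block_nil : wp B (block []) Q σ ↔ Q σ 1 := wp_skip

theorem wp_block_cons {l : List Prog} : wp B (block (p :: l)) Q σ ↔
    wp B p (fun σ' τ => wp B (block l) (fun σ'' τ' => Q σ'' (τ + τ')) σ') σ := wp_seq

@[simp] theorem eval_const (c : ℕ) : (Operand.const c).eval σ = c := rfl

@[simp] theorem eval_var (x : ℕ) : (Operand.var x).eval σ = σ.vars x := rfl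

@[simp] theorem holds_lt (a b : Operand) : (Test.lt a b).Holds σ ↔ a.eval σ < b.eval σ := Iff.rfl

@[simp] theorem holds_eq (a b : Operand) : (Test.eq a b).Holds σ ↔ a.eval σ = b.eval σ := Iff.rfl

@[simp] theorem holds_ne (a b : Operand) : (Test.ne a b).Holds σ ↔ a.eval σ ≠ b.eval σ := Iff.rfl

@[simp] theorem setVar_vars (x v y : ℕ) :
    (σ.setVar x v).vars y = if y = x then v else σ.vars y := by
  simp [State.setVar, Function.update_apply]

@[simp] theorem setVar_arrs (x v : ℕ) : (σ.setVar x v).arrs = σ.arrs := rfl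

@[simp] theorem setArr_vars (A i v : ℕ) : (σ.setArr A i v).vars = σ.vars := rfl

@[simp] theorem setArr_arrs (A i v A' : ℕ) : (σ.setArr A i v).arrs A' =
    if A' = A then Function.update (σ.arrs A) i v else σ.arrs A' := by
  simp [State.setArr, Function.update_apply]

/-- The program does not write to the variable `x`. -/
def Prog.keepsVar (x : ℕ) : Prog → Bool
  | .skip => true
  | .assign y _ => y != x
  | .store _ _ _ => true
  | .seq p q => p.keepsVar x && q.keepsVar x
  | .ite _ p q => p.keepsVar x && q.keepsVar x
  | .while _ p => p.keepsVar x

/-- The program does not write to the array `A`. -/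
def Prog.keepsArr (A : ℕ) : Prog → Bool
  | .skip => true
  | .assign _ _ => true
  | .store A' _ _ => A' != A
  | .seq p q => p.keepsArr A && q.keepsArr A
  | .ite _ p q => p.keepsArr A && q.keepsArr A
  | .while _ p => p.keepsArr A

/-- `σ` and `σ'` agree on whatever the program `p` does not write to. -/
structure Frame (p : Prog) (σ σ' : State) : Prop where
  vars : ∀ x, p.keepsVar x = true → σ'.vars x = σ.vars x
  arrs : ∀ A, p.keepsArr A = true → σ'.arrs A = σ.arrs A

theorem Frame.refl (p : Prog) (σ : State) : Frame p σ σ := ⟨fun _ _ => rfl, fun _ _ => rfl⟩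

theorem Frame.trans {p : Prog} {σ σ' σ'' : State} (h : Frame p σ σ') (h' : Frame p σ' σ'') :
    Frame p σ σ'' :=
  ⟨fun x hx => (h'.vars x hx).trans (h.vars x hx), fun x hx => (h'.arrs x hx).trans (h.arrs x hx)⟩

/-- Loop invariants need to mention only what changes. Everything else is recovered from a syntactic
check, which for a concrete program holds by computation. -/
theorem Exec.frame {σ' : State} {τ : ℕ} (h : Exec B p σ σ' τ) : Frame p σ σ' := by
  induction h with
  | skip => exact Frame.refl _ _
  | assign σ x e =>
    refine ⟨fun y hy => ?_, fun _ _ => rfl⟩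
    have : y ≠ x := Ne.symm (by simpa [Prog.keepsVar] using hy)
    simp [this]
  | store σ A i a =>
    refine ⟨fun _ _ => rfl, fun A' hA => ?_⟩
    have : A' ≠ A := Ne.symm (by simpa [Prog.keepsArr] using hA)
    simp [this]
  | seq _ _ ih1 ih2 =>
    constructor
    · intro x hx
      simp only [Prog.keepsVar, Bool.and_eq_true] at hx
      exact (ih2.vars x hx.2).trans (ih1.vars x hx.1)
    · intro x hx
      simp only [Prog.keepsArr, Bool.and_eq_true] at hx
      exact (ih2.arrs x hx.2).trans (ih1.arrs x hx.1)
  | ite_true _ _ ih =>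
    constructor
    · intro x hx
      simp only [Prog.keepsVar, Bool.and_eq_true] at hx
      exact ih.vars x hx.1
    · intro x hx
      simp only [Prog.keepsArr, Bool.and_eq_true] at hx
      exact ih.arrs x hx.1
  | ite_false _ _ ih =>
    constructor
    · intro x hx
      simp only [Prog.keepsVar, Bool.and_eq_true] at hx
      exact ih.vars x hx.2
    · intro x hx
      simp only [Prog.keepsArr, Bool.and_eq_true] at hx
      exact ih.arrs x hx.2
  | while_true _ _ _ ih1 ih2 =>
    exact ⟨fun x hx => (ih2.vars x hx).trans (ih1.vars x hx),
      fun x hx => (ih2.arrs x hx).trans (ih1.arrs x hx)⟩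
  | while_false => exact Frame.refl _ _

theorem wp.frame (h : wp B p Q σ) : wp B p (fun σ' τ => Q σ' τ ∧ Frame p σ σ') σ := by
  obtain ⟨σ', τ, h1, h2⟩ := h
  exact ⟨σ', τ, h1, h2, h1.frame⟩

/-- The rule for loops: `r` in `I r` bounds the remaining number of steps. -/
theorem wp_while {b : Test} (I : ℕ → State → Prop) {r : ℕ} (h0 : I r σ)
    (step : ∀ r' σ', I r' σ' → Frame p σ σ' → b.Holds σ' →
      wp B p (fun σ'' τ => ∃ r'', I r'' σ'' ∧ τ + 1 + r'' ≤ r') σ') :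
    wp B (.while b p) (fun σ' τ => (∃ r', I r' σ' ∧ τ + r' ≤ r + 1) ∧ ¬ b.Holds σ' ∧
      Frame p σ σ') σ := by
  suffices h : ∀ r σ', I r σ' → Frame p σ σ' → wp B (.while b p)
      (fun σ'' τ => (∃ r', I r' σ'' ∧ τ + r' ≤ r + 1) ∧ ¬ b.Holds σ'' ∧ Frame p σ σ'') σ' from
    h r σ h0 (Frame.refl _ _)
  intro r
  -- Every pass spends at least the step of its test, so the budget r strictly decreases; this gives
  -- termination together with the time bound. The failing test at the end is the extra step in r +
  -- 1.
  induction r using Nat.strong_induction_on with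
  | _ r ih =>
    intro σ' hI hF
    by_cases hb : b.Holds σ'
    · obtain ⟨σ₁, τ₁, e₁, r₁, hI₁, hr₁⟩ := step r σ' hI hF hb
      obtain ⟨σ₂, τ₂, e₂, ⟨r₂, hI₂, hr₂⟩, hb₂, hF₂⟩ := ih r₁ (by omega) σ₁ hI₁ (hF.trans e₁.frame)
      exact ⟨σ₂, _, .while_true hb e₁ e₂, ⟨r₂, hI₂, by omega⟩, hb₂, hF₂⟩
    · exact ⟨σ', _, .while_false hb, ⟨r, hI, by omega⟩, hb, hF⟩

/-- Run `body` and increment the variable `i`, as long as `i` is less than `N`. -/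
def loop (i : ℕ) (N : Operand) (body : Prog) : Prog :=
  .while (.lt (.var i) N) (.seq body (.assign i (.add (.var i) (.const 1))))

/-- A pass costs at most c steps for the body, one for the increment and one for the test; the
failing test adds one. The invariant is required after the increment, so it must survive the write
to the counter. -/
theorem wp_loop {i m c j₀ : ℕ} {N : Operand} {body : Prog} (I : ℕ → State → Prop)
    (hk : body.keepsVar i = true) (hi : σ.vars i = j₀) (hj : j₀ ≤ m) (hm : m ≤ B)
    (hN : ∀ σ', Frame (loop i N body) σ σ' → N.eval σ' = m) (h0 : I j₀ σ)
    (step : ∀ j σ', j₀ ≤ j → j < m → σ'.vars i = j → I j σ' → Frame (loop i N body) σ σ' →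
      wp B body (fun σ'' τ => I (j + 1) (σ''.setVar i (j + 1)) ∧ τ ≤ c) σ') :
    wp B (loop i N body) (fun σ' τ => I m σ' ∧ σ'.vars i = m ∧ τ ≤ (m - j₀) * (c + 2) + 1 ∧
      Frame (loop i N body) σ σ') σ := by
  have := wp_while (B := B) (b := .lt (.var i) N)
    (p := .seq body (.assign i (.add (.var i) (.const 1))))
    (fun r σ' => ∃ j, σ'.vars i = j ∧ j₀ ≤ j ∧ j ≤ m ∧ I j σ' ∧ r = (m - j) * (c + 2)) (σ := σ)
    (r := (m - j₀) * (c + 2)) ⟨j₀, hi, le_rfl, hj, h0, rfl⟩ ?_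
  · refine this.mono ?_
    rintro σ' τ ⟨⟨r, ⟨j, hj1, hj2, hj3, hI, rfl⟩, hr⟩, hb, hF⟩
    have hF' : Frame (loop i N body) σ σ' := ⟨hF.vars, hF.arrs⟩
    simp only [holds_lt, eval_var, hN σ' hF', hj1, not_lt] at hb
    obtain rfl : j = m := by omega
    exact ⟨hI, hj1, by omega, hF'⟩
  · rintro r σ' ⟨j, hj1, hj2, hj3, hI, rfl⟩ hF hb
    have hF' : Frame (loop i N body) σ σ' := ⟨hF.vars, hF.arrs⟩
    simp only [holds_lt, eval_var, hN σ' hF', hj1] at hb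
    rw [wp_seq]
    refine (step j σ' hj2 hb hj1 hI hF').frame.mono ?_
    rintro σ'' τ ⟨⟨hI', hτ⟩, hF''⟩
    have hj' := (hF''.vars i hk).trans hj1
    rw [wp_add]
    simp only [eval_var, eval_const, hj']
    refine ⟨by omega, _, ⟨j + 1, by simp, by omega, by omega, hI', rfl⟩, ?_⟩
    obtain ⟨d, rfl⟩ : ∃ d, m = j + 1 + d := ⟨m - (j + 1), by omega⟩
    have h1 : j + 1 + d - j = d + 1 := by omega
    have h2 : j + 1 + d - (j + 1) = d := by omega
    rw [h1, h2, Nat.add_mul]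
    omega

/-- Run `body` for `i = 0, …, N - 1`. -/
def forLt (i : ℕ) (N : Operand) (body : Prog) : Prog :=
  .seq (.assign i (.atom (.const 0))) (loop i N body)

theorem wp_forLt {i m c : ℕ} {N : Operand} {body : Prog} (I : ℕ → State → Prop)
    (hk : body.keepsVar i = true) (hm : m ≤ B)
    (hN : ∀ σ', Frame (forLt i N body) σ σ' → N.eval σ' = m) (h0 : I 0 (σ.setVar i 0))
    (step : ∀ j σ', j < m → σ'.vars i = j → I j σ' → Frame (forLt i N body) σ σ' →
      wp B body (fun σ'' τ => I (j + 1) (σ''.setVar i (j + 1)) ∧ τ ≤ c) σ') :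
    wp B (forLt i N body) (fun σ' τ => I m σ' ∧ τ ≤ m * (c + 2) + 2 ∧
      Frame (forLt i N body) σ σ') σ := by
  have hF : ∀ σ', Frame (loop i N body) (σ.setVar i 0) σ' → Frame (forLt i N body) σ σ' := by
    intro σ' h
    constructor
    · intro x hx
      simp only [forLt, Prog.keepsVar, Bool.and_eq_true, bne_iff_ne, ne_eq] at hx
      rw [h.vars x hx.2]
      simp [Ne.symm hx.1]
    · intro x hx
      simp only [forLt, Prog.keepsArr, Bool.and_eq_true] at hx
      rw [h.arrs x hx.2]
      simp
  rw [forLt, wp_seq, wp_atom]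
  refine ⟨Nat.zero_le _, ?_⟩
  refine (wp_loop (j₀ := 0) (m := m) (c := c) I hk (by simp) (Nat.zero_le _) hm
    (fun σ' h => hN σ' (hF σ' h)) h0
    (fun j σ' _ hj hi hI h => step j σ' hj hi hI (hF σ' h))).mono ?_
  rintro σ' τ ⟨h1, _, h3, h4⟩
  refine ⟨h1, ?_, hF σ' h4⟩
  rw [Nat.sub_zero] at h3
  omega

/-- The arrays `a` and `b` hold the first and the second components of the entries of `E`. -/
def EdgesAt (a b : ℕ → ℕ) (E : List (ℕ × ℕ)) : Prop :=
  ∀ i, (h : i < E.length) → a i = E[i].1 ∧ b i = E[i].2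

/-- The array `a` holds the entries of `l`. -/
def ListAt (a : ℕ → ℕ) (l : List ℕ) : Prop := ∀ i, (h : i < l.length) → a i = l[i]

theorem EdgesAt.append {a b : ℕ → ℕ} {E : List (ℕ × ℕ)} (h : EdgesAt a b E) (e : ℕ × ℕ) {m : ℕ}
    (hm : m = E.length) :
    EdgesAt (Function.update a m e.1) (Function.update b m e.2) (E ++ [e]) := by
  subst hm
  intro i hi
  rcases Nat.lt_or_ge i E.length with h' | h'
  · rw [Function.update_of_ne h'.ne, Function.update_of_ne h'.ne, List.getElem_append_left h']
    exact h i h'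
  · obtain rfl : i = E.length := by simp at hi; omega
    simp

theorem ListAt.append {a : ℕ → ℕ} {l : List ℕ} (h : ListAt a l) (x : ℕ) {m : ℕ}
    (hm : m = l.length) : ListAt (Function.update a m x) (l ++ [x]) := by
  subst hm
  intro i hi
  rcases Nat.lt_or_ge i l.length with h' | h'
  · rw [Function.update_of_ne h'.ne, List.getElem_append_left h']
    exact h i h'
  · obtain rfl : i = l.length := by simp at hi; omega
    simp

/-- Run `body` for the edges stored in the arrays `A₁` and `A₂`, the number of which is in the
variable `m`. The ends of the edge are put in the variables `6` and `7`. -/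
def edgeLoop (m A₁ A₂ : ℕ) (body : Prog) : Prog :=
  forLt 5 (.var m) (block [.assign 6 (.read A₁ (.var 5)), .assign 7 (.read A₂ (.var 5)), body])

/-- Run `body` for the edges in reverse order, with the ends of each edge exchanged. -/
def edgeLoopRev (m A₁ A₂ : ℕ) (body : Prog) : Prog :=
  forLt 5 (.var m) (block [.assign 8 (.sub (.var m) (.var 5)),
    .assign 8 (.sub (.var 8) (.const 1)),
    .assign 6 (.read A₂ (.var 8)), .assign 7 (.read A₁ (.var 8)), body])

/-- The invariant refers to the list of edges processed so far, which hides the counter; it must not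
depend on the scratch variables. Per edge, five steps are added to c: two reads, the end of the
block, the increment and the test. -/
theorem wp_edgeLoop {m A₁ A₂ c : ℕ} {body : Prog} {E : List (ℕ × ℕ)}
    (I : List (ℕ × ℕ) → State → Prop)
    (hI : ∀ l σ x v, x ∈ [5, 6, 7] → I l σ → I l (σ.setVar x v))
    (hm : σ.vars m = E.length) (hE : EdgesAt (σ.arrs A₁) (σ.arrs A₂) E) (hB : E.length ≤ B)
    (hEB : ∀ e ∈ E, e.1 ≤ B ∧ e.2 ≤ B) (hk : body.keepsVar 5 = true)
    (hkm : (edgeLoop m A₁ A₂ body).keepsVar m = true)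
    (hk1 : body.keepsArr A₁ = true) (hk2 : body.keepsArr A₂ = true) (h0 : I [] σ)
    (step : ∀ l e σ', l ++ [e] <+: E → I l σ' → Frame (edgeLoop m A₁ A₂ body) σ σ' →
      σ'.vars 6 = e.1 → σ'.vars 7 = e.2 → wp B body (fun σ'' τ => I (l ++ [e]) σ'' ∧ τ ≤ c) σ') :
    wp B (edgeLoop m A₁ A₂ body) (fun σ' τ => I E σ' ∧ τ ≤ E.length * (c + 5) + 2 ∧
      Frame (edgeLoop m A₁ A₂ body) σ σ') σ := by
  refine (wp_forLt (m := E.length) (c := c + 3) (fun j σ => I (E.take j) σ) ?_ hB ?_ ?_ ?_).mono ?_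
  · simp [Prog.keepsVar, block, hk]
  · intro σ' hF
    rw [eval_var, hF.vars m hkm, hm]
  · exact hI _ _ _ _ (by simp) (by simpa using h0)
  · intro j σ' hj hj' hI' hF
    have e1 : σ'.arrs A₁ = σ.arrs A₁ := hF.arrs _ (by simp [forLt, loop, Prog.keepsArr, block, hk1])
    have e2 : σ'.arrs A₂ = σ.arrs A₂ := hF.arrs _ (by simp [forLt, loop, Prog.keepsArr, block, hk2])
    have e3 := hE j hj
    have e4 := hEB E[j] (List.getElem_mem hj)
    simp only [wp_block_cons, wp_read, eval_var, hj', e1, e3.1, setVar_vars, setVar_arrs, e2, e3.2,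
      if_neg (show (5 : ℕ) ≠ 6 by decide)]
    refine ⟨⟨by omega, e4.1⟩, ⟨by omega, e4.2⟩, ?_⟩
    refine (step (E.take j) E[j] _ ?_ (hI _ _ _ _ (by simp) (hI _ _ _ _ (by simp) hI')) ?_
      (by simp) (by simp)).mono ?_
    · rw [List.take_append_getElem]
      exact List.take_prefix _ _
    · constructor
      · intro x hx
        have hx' := hx
        simp only [edgeLoop, forLt, loop, Prog.keepsVar, block, Bool.and_eq_true, bne_iff_ne,
          ne_eq] at hx'
        rw [← hF.vars x hx]
        simp [Ne.symm hx'.2.1.1, Ne.symm hx'.2.1.2.1]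
      · intro x hx
        rw [← hF.arrs x hx]
        simp
    · rintro σ'' τ ⟨h1, h2⟩
      rw [wp_block_nil]
      refine ⟨?_, by omega⟩
      rw [List.take_append_getElem] at h1
      exact hI _ _ _ _ (by simp) h1
  · rintro σ' τ ⟨h1, h2, h3⟩
    rw [List.take_length] at h1
    exact ⟨h1, h2, h3⟩

/-- Reversing a sorted list and swapping the ends of its edges gives a sorted list again. Backward
reachability is thus computed by the same body as forward reachability. -/
theorem wp_edgeLoopRev {m A₁ A₂ c : ℕ} {body : Prog} {E : List (ℕ × ℕ)}
    (I : List (ℕ × ℕ) → State → Prop)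
    (hI : ∀ l σ x v, x ∈ [5, 6, 7, 8] → I l σ → I l (σ.setVar x v))
    (hm : σ.vars m = E.length) (hE : EdgesAt (σ.arrs A₁) (σ.arrs A₂) E) (hB : E.length ≤ B)
    (hEB : ∀ e ∈ E, e.1 ≤ B ∧ e.2 ≤ B) (hk : body.keepsVar 5 = true)
    (hkm : (edgeLoopRev m A₁ A₂ body).keepsVar m = true)
    (hk1 : body.keepsArr A₁ = true) (hk2 : body.keepsArr A₂ = true) (h0 : I [] σ)
    (step : ∀ l e σ', l ++ [e] <+: E.reverse.map Prod.swap → I l σ' →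
      Frame (edgeLoopRev m A₁ A₂ body) σ σ' →
      σ'.vars 6 = e.1 → σ'.vars 7 = e.2 → wp B body (fun σ'' τ => I (l ++ [e]) σ'' ∧ τ ≤ c) σ') :
    wp B (edgeLoopRev m A₁ A₂ body) (fun σ' τ => I (E.reverse.map Prod.swap) σ' ∧
      τ ≤ E.length * (c + 7) + 2 ∧ Frame (edgeLoopRev m A₁ A₂ body) σ σ') σ := by
  set E' := E.reverse.map Prod.swap with hE'
  have hlen : E'.length = E.length := by simp [hE']
  have hmv : m ≠ 5 ∧ m ≠ 6 ∧ m ≠ 7 ∧ m ≠ 8 := by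
    simp [edgeLoopRev, forLt, loop, Prog.keepsVar, block] at hkm
    omega
  refine (wp_forLt (m := E.length) (c := c + 5) (fun j σ => I (E'.take j) σ) ?_ hB ?_ ?_ ?_).mono ?_
  · simp [Prog.keepsVar, block, hk]
  · intro σ' hF
    rw [eval_var, hF.vars m hkm, hm]
  · exact hI _ _ _ _ (by simp) (by simpa using h0)
  · intro j σ' hj hj' hI' hF
    have e0 : σ'.vars m = E.length := (hF.vars m hkm).trans hm
    have e1 : σ'.arrs A₁ = σ.arrs A₁ := hF.arrs _ (by simp [forLt, loop, Prog.keepsArr, block, hk1])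
    have e2 : σ'.arrs A₂ = σ.arrs A₂ := hF.arrs _ (by simp [forLt, loop, Prog.keepsArr, block, hk2])
    have hj2 : E.length - j - 1 < E.length := by omega
    have hjE : j < E'.length := by omega
    have hget : E'[j] = (E[E.length - j - 1].2, E[E.length - j - 1].1) := by
      simp only [hE', List.getElem_map, List.getElem_reverse, Prod.swap]
      have : E.length - 1 - j = E.length - j - 1 := by omega
      simp [this]
    have e3 := hE _ hj2
    have e4 := hEB _ (List.getElem_mem hj2)
    simp only [wp_block_cons, wp_sub, wp_read, eval_var, eval_const, hj', e1, e2, setVar_vars,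
      setVar_arrs, e0, if_neg (show (8 : ℕ) ≠ 6 by decide), if_true]
    refine ⟨by omega, by omega, ⟨by omega, e3.2 ▸ e4.2⟩, ⟨by omega, e3.1 ▸ e4.1⟩, ?_⟩
    refine (step (E'.take j) E'[j] _ ?_ (hI _ _ _ _ (by simp) (hI _ _ _ _ (by simp)
      (hI _ _ _ _ (by simp) (hI _ _ _ _ (by simp) hI')))) ?_
      (by simp [hget, e3.2]) (by simp [hget, e3.1])).mono ?_
    · rw [List.take_append_getElem]
      exact List.take_prefix _ _
    · constructor
      · intro x hx
        have hx' := hx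
        simp only [edgeLoopRev, forLt, loop, Prog.keepsVar, block, Bool.and_eq_true, bne_iff_ne,
          ne_eq] at hx'
        rw [← hF.vars x hx]
        simp [Ne.symm hx'.2.1.1, Ne.symm hx'.2.1.2.2.1, Ne.symm hx'.2.1.2.2.2.1]
      · intro x hx
        rw [← hF.arrs x hx]
        simp
    · rintro σ'' τ ⟨h1, h2⟩
      rw [wp_block_nil]
      refine ⟨?_, by omega⟩
      rw [List.take_append_getElem] at h1
      exact hI _ _ _ _ (by simp) h1
  · rintro σ' τ ⟨h1, h2, h3⟩
    rw [← hlen, List.take_length] at h1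
    exact ⟨h1, h2, h3⟩

end RAM

/-! ### Trimming and collecting chain heads on the machine -/

namespace RAM

attribute [simp] wp_skip wp_atom wp_add wp_sub wp_read wp_store wp_seq wp_ite wp_block_nil
  wp_block_cons

open Relation STDigraph

/-- Reachability along the edges of a list. -/
abbrev Reach (E : List (ℕ × ℕ)) (u v : ℕ) : Prop := ReflTransGen (fun a b => (a, b) ∈ E) u v

theorem reach_append {E : List (ℕ × ℕ)} {a b : ℕ} (h : TopoSorted (E ++ [(a, b)])) {u v : ℕ} :
    Reach (E ++ [(a, b)]) u v ↔ Reach E u v ∨ Reach E u a ∧ v = b := by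
  simpa only [and_true] using h.reach_append (fun _ => True) (u := u) (v := v)

theorem reach_reverse {E : List (ℕ × ℕ)} {u v : ℕ} :
    Reach (E.reverse.map Prod.swap) u v ↔ Reach E v u := by
  rw [Reach, ← reflTransGen_swap]
  have : (fun a b => (a, b) ∈ E.reverse.map Prod.swap) = Function.swap (fun a b => (a, b) ∈ E) := by
    funext a b
    simp [Function.swap]
  rw [this]

/-- The input of the second phase of the algorithm: a sorted list of edges. -/
structure Input (B n : ℕ) (E : List (ℕ × ℕ)) (s t k : ℕ) (σ : State) : Prop where
  n_eq : σ.vars 0 = n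
  s_eq : σ.vars 1 = s
  t_eq : σ.vars 2 = t
  k_eq : σ.vars 3 = k
  e_eq : σ.vars 4 = E.length
  edges : EdgesAt (σ.arrs 4) (σ.arrs 5) E
  s_lt : s < n
  t_lt : t < n
  edges_lt : ∀ e ∈ E, e.1 < n ∧ e.2 < n
  sorted : TopoSorted E
  nodup : E.Nodup
  bound : 9 * (n + E.length + k + 2) ≤ B

theorem Input.frame {B n : ℕ} {E : List (ℕ × ℕ)} {s t k : ℕ} {σ σ' : State} {p : Prog}
    (h : Input B n E s t k σ) (hF : Frame p σ σ')
    (hv : ([0, 1, 2, 3, 4].all fun x => p.keepsVar x) = true)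
    (ha : ([4, 5].all fun x => p.keepsArr x) = true) : Input B n E s t k σ' := by
  simp only [List.all_cons, List.all_nil, Bool.and_true, Bool.and_eq_true] at hv ha
  obtain ⟨h0, h1, h2, h3, h4⟩ := hv
  exact ⟨(hF.vars _ h0).trans h.n_eq, (hF.vars _ h1).trans h.s_eq, (hF.vars _ h2).trans h.t_eq,
    (hF.vars _ h3).trans h.k_eq, (hF.vars _ h4).trans h.e_eq,
    by rw [hF.arrs _ ha.1, hF.arrs _ ha.2]; exact h.edges, h.s_lt, h.t_lt, h.edges_lt, h.sorted,
    h.nodup, h.bound⟩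

theorem TopoSorted.of_prefix {E F : List (ℕ × ℕ)} (h : TopoSorted E) (hF : F <+: E) :
    TopoSorted F := by
  obtain ⟨G, rfl⟩ := hF
  exact h.of_append

/-- Mark the end of an edge if its start is marked. -/
def reachBody (F : ℕ) : Prog :=
  block [.assign 9 (.read F (.var 6)),
    .ite (.eq (.var 9) (.const 1)) (.store F (.var 7) (.const 1)) .skip]

open Classical in
-- In a sorted list all edges into the tail of the current edge have been processed, so the mark of
-- the tail is final and only the mark of the head can change.
theorem wp_reachBody {B F u : ℕ} {l : List (ℕ × ℕ)} {e : ℕ × ℕ} {σ : State}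
    (hs : TopoSorted (l ++ [e])) (hB : 1 ≤ B) (he : e.1 ≤ B ∧ e.2 ≤ B)
    (h : ∀ v, σ.arrs F v = if Reach l u v then 1 else 0)
    (h6 : σ.vars 6 = e.1) (h7 : σ.vars 7 = e.2) :
    wp B (reachBody F) (fun σ' τ => (∀ v, σ'.arrs F v = if Reach (l ++ [e]) u v then 1 else 0) ∧
      τ ≤ 4) σ := by
  obtain ⟨a, b⟩ := e
  by_cases hr : Reach l u a
  · simp [reachBody, h6, h7, he, h, hr, hB]
    intro v
    rw [reach_append hs, Function.update_apply, h]
    by_cases hv : v = b <;> simp [hv, hr]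
  · simp [reachBody, h6, he, h, hr, hB]
    intro v
    rw [reach_append hs]
    simp [hr]

/-- Mark the vertices reachable from the source in the array `6`, and those from which the
destination is reachable in the array `7`. -/
def markReach : Prog :=
  block [.store 6 (.var 1) (.const 1), edgeLoop 4 4 5 (reachBody 6),
    .store 7 (.var 2) (.const 1), edgeLoopRev 4 4 5 (reachBody 7)]

theorem reach_nil {u v : ℕ} : Reach [] u v ↔ v = u := by
  rw [Reach, reflTransGen_iff_eq]
  simp

open Classical in
theorem wp_markReach {B n : ℕ} {E : List (ℕ × ℕ)} {s t k : ℕ} {σ : State}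
    (h : Input B n E s t k σ) (h6 : ∀ v, σ.arrs 6 v = 0) (h7 : ∀ v, σ.arrs 7 v = 0) :
    wp B markReach (fun σ' τ => (∀ v, σ'.arrs 6 v = if Reach E s v then 1 else 0) ∧
      (∀ v, σ'.arrs 7 v = if Reach E v t then 1 else 0) ∧ τ ≤ 30 * (E.length + 1)) σ := by
  have hb := h.bound
  have hsl := h.s_lt
  have htl := h.t_lt
  have hEB : ∀ e ∈ E, e.1 ≤ B ∧ e.2 ≤ B := fun e he => by have := h.edges_lt e he; omega
  simp only [markReach, wp_block_cons, wp_store, wp_block_nil, eval_var, eval_const, h.s_eq]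
  refine ⟨by omega, ?_⟩
  refine wp.mono (wp_edgeLoop (E := E) (c := 4)
    (fun l σ' => ∀ v, σ'.arrs 6 v = if Reach l s v then 1 else 0) ?_ h.e_eq ?_ (by omega) hEB (by rfl)
    (by rfl) (by rfl) (by rfl) ?_ ?_) ?_
  · intro l σ x v _ h
    simpa using h
  · simpa using h.edges
  · intro v
    simp [Function.update_apply, h6, reach_nil]
  · intro l e σ' hl hI hF h6 h7
    refine wp_reachBody (TopoSorted.of_prefix h.sorted hl) (by omega) (hEB e ?_) hI h6 h7
    exact hl.subset (by simp)
  · rintro σ₁ τ₁ ⟨hI₁, hτ₁, hF₁⟩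
    have ht : σ₁.vars 2 = t := (hF₁.vars 2 rfl).trans h.t_eq
    rw [ht]
    refine ⟨by omega, ?_⟩
    refine wp.mono (wp_edgeLoopRev (E := E) (c := 4)
      (fun l σ' => ∀ v, σ'.arrs 7 v = if Reach l t v then 1 else 0) ?_ ?_ ?_ (by omega) hEB (by rfl)
      (by rfl) (by rfl) (by rfl) ?_ ?_) ?_
    · intro l σ x v _ h
      simpa using h
    · exact (hF₁.vars 4 rfl).trans h.e_eq
    · have e4 := hF₁.arrs 4 rfl
      have e5 := hF₁.arrs 5 rfl
      simp [e4, e5]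
      exact h.edges
    · intro v
      have e7 := hF₁.arrs 7 rfl
      simp [e7, Function.update_apply, h7, reach_nil]
    · intro l e σ' hl hI hF h6 h7
      refine wp_reachBody (TopoSorted.of_prefix h.sorted.reverse hl) (by omega) ?_ hI h6 h7
      have : e ∈ E.reverse.map Prod.swap := hl.subset (by simp)
      obtain ⟨f, hf, rfl⟩ := List.mem_map.1 this
      have := hEB f (List.mem_reverse.1 hf)
      exact ⟨this.2, this.1⟩
    · rintro σ₂ τ₂ ⟨hI₂, hτ₂, hF₂⟩
      refine ⟨?_, fun v => ?_, by omega⟩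
      · have := hF₂.arrs 6 rfl
        simp only [this, setArr_arrs]
        exact hI₁
      · rw [hI₂]
        simp only [reach_reverse]

open Classical in
/-- The edges on walks from `s` to `t`. -/
noncomputable def trimEdges (E : List (ℕ × ℕ)) (s t : ℕ) : List (ℕ × ℕ) :=
  E.filter fun e => Reach E s e.1 ∧ Reach E e.2 t

/-- Copy the edges on walks from the source to the destination, and count the edges that leave
and that enter each vertex. -/
def copyEdges : Prog :=
  block [.assign 11 (.atom (.const 0)), edgeLoop 4 4 5 (block
    [.assign 9 (.read 6 (.var 6)), .assign 10 (.read 7 (.var 7)),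
      .ite (.eq (.var 9) (.const 1)) (.ite (.eq (.var 10) (.const 1)) (block
        [.store 8 (.var 11) (.var 6), .store 9 (.var 11) (.var 7),
          .assign 11 (.add (.var 11) (.const 1)),
          .assign 9 (.read 10 (.var 6)), .assign 9 (.add (.var 9) (.const 1)),
          .store 10 (.var 6) (.var 9),
          .assign 9 (.read 11 (.var 7)), .assign 9 (.add (.var 9) (.const 1)),
          .store 11 (.var 7) (.var 9)]) .skip) .skip])]

theorem wp_copyEdges {B n : ℕ} {E : List (ℕ × ℕ)} {s t k : ℕ} {σ : State}
    (h : Input B n E s t k σ)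
    (h6 : ∀ v, σ.arrs 6 v = open Classical in if Reach E s v then 1 else 0)
    (h7 : ∀ v, σ.arrs 7 v = open Classical in if Reach E v t then 1 else 0)
    (h10 : ∀ v, σ.arrs 10 v = 0) (h11 : ∀ v, σ.arrs 11 v = 0) :
    wp B copyEdges (fun σ' τ => EdgesAt (σ'.arrs 8) (σ'.arrs 9) (trimEdges E s t) ∧
      σ'.vars 11 = (trimEdges E s t).length ∧
      (∀ v, σ'.arrs 10 v = (trimEdges E s t).countP (fun e => e.1 = v)) ∧
      (∀ v, σ'.arrs 11 v = (trimEdges E s t).countP (fun e => e.2 = v)) ∧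
      τ ≤ 30 * (E.length + 1)) σ := by
  classical
  have hb := h.bound
  have hEB : ∀ e ∈ E, e.1 ≤ B ∧ e.2 ≤ B := fun e he => by have := h.edges_lt e he; omega
  simp only [copyEdges, wp_block_cons, wp_atom, wp_block_nil, eval_const]
  refine ⟨by omega, ?_⟩
  set P : ℕ × ℕ → Bool := fun e => decide (Reach E s e.1 ∧ Reach E e.2 t) with hP
  have htrim : trimEdges E s t = E.filter P := by
    simp only [trimEdges, hP]
  refine wp.mono (wp_edgeLoop (E := E) (c := 20)
    (fun l σ' => EdgesAt (σ'.arrs 8) (σ'.arrs 9) (l.filter P) ∧ σ'.vars 11 = (l.filter P).length ∧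
      (∀ v, σ'.arrs 10 v = (l.filter P).countP (fun e => e.1 = v)) ∧
      (∀ v, σ'.arrs 11 v = (l.filter P).countP (fun e => e.2 = v)))
    ?_ (by simpa using h.e_eq) (by simpa using h.edges) (by omega) hEB (by rfl) (by rfl) (by rfl) (by rfl) ?_ ?_) ?_
  · intro l σ x v hx h
    have : 11 ≠ x := by rintro rfl; simp at hx
    simpa [this] using h
  · simp [EdgesAt, h10, h11]
  · rintro l ⟨a, b⟩ σ' hl ⟨i1, i2, i3, i4⟩ hF h6' h7'
    have e6 := hF.arrs 6 rfl
    have e7 := hF.arrs 7 rfl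
    have hab := hEB (a, b) (hl.subset (by simp))
    have hl' : l.length + 1 ≤ E.length := by simpa using hl.length_le
    have hfl : (l.filter P).length ≤ l.length := List.length_filter_le _ _
    have hc1 : ∀ v, (l.filter P).countP (fun e => e.1 = v) ≤ l.length :=
      fun v => List.countP_le_length.trans hfl
    have hc2 : ∀ v, (l.filter P).countP (fun e => e.2 = v) ≤ l.length :=
      fun v => List.countP_le_length.trans hfl
    have := hc1 a
    have := hc2 b
    by_cases p1 : Reach E s a
    · by_cases p2 : Reach E b t
      · have hPe : P (a, b) = true := by simp [hP, p1, p2]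
        simp only at hab h6' h7'
        simp [h6', h7', e6, e7, h6, h7, p1, p2, i2, i3, i4, hPe, List.filter_append,
          Function.update_apply]
        and_intros
        any_goals omega
        · exact i1.append (a, b) rfl
        · intro v
          by_cases e : v = a <;> simp [e, eq_comm (a := a)]
        · intro v
          by_cases e : v = b <;> simp [e, eq_comm (a := b)]
      · have hPe : P (a, b) = false := by simp [hP, p2]
        simp only at hab h6' h7'
        simp [h6', h7', e6, e7, h6, h7, p1, p2, i2, hPe, List.filter_append]
        and_intros <;> omega
    · have hPe : P (a, b) = false := by simp [hP, p1]
      have : (if Reach E b t then 1 else 0) ≤ B := by split_ifs <;> omega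
      simp only at hab h6' h7'
      simp [h6', h7', e6, e7, h6, h7, p1, i2, hPe, List.filter_append, this]
      and_intros <;> omega
  · rintro σ₁ τ₁ ⟨⟨i1, i2, i3, i4⟩, hτ, -⟩
    rw [htrim]
    exact ⟨i1, i2, i3, i4, by omega⟩

/-- Mark the vertices entered by an edge whose start has another out-neighbour. -/
def markHeads : Prog :=
  edgeLoop 11 8 9 (block [.assign 9 (.read 10 (.var 6)),
    .ite (.lt (.const 1) (.var 9)) (.store 12 (.var 7) (.const 1)) .skip])

open Classical in
theorem wp_markHeads {B : ℕ} {E : List (ℕ × ℕ)} {σ : State}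
    (h11 : σ.vars 11 = E.length) (hE : EdgesAt (σ.arrs 8) (σ.arrs 9) E) (hl : E.length < B)
    (hB : ∀ e ∈ E, e.1 ≤ B ∧ e.2 ≤ B)
    (h10 : ∀ v, σ.arrs 10 v = E.countP (fun e => e.1 = v)) (h12 : ∀ v, σ.arrs 12 v = 0) :
    wp B markHeads (fun σ' τ => (∀ v, σ'.arrs 12 v = if ∃ e ∈ E, e.2 = v ∧
      1 < E.countP (fun f => f.1 = e.1) then 1 else 0) ∧ τ ≤ 30 * (E.length + 1)) σ := by
  refine wp.mono (wp_edgeLoop (E := E) (c := 20) (fun l σ' => ∀ v, σ'.arrs 12 v = if ∃ e ∈ l, e.2 = v ∧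
      1 < E.countP (fun f => f.1 = e.1) then 1 else 0)
    ?_ h11 hE (by omega) hB (by rfl) (by rfl) (by rfl) (by rfl) ?_ ?_) ?_
  · intro l σ x v hx h
    simpa using h
  · simpa using h12
  · rintro l ⟨a, b⟩ σ' hl i1 hF h6' h7'
    have e10 := hF.arrs 10 rfl
    have hab := hB (a, b) (hl.subset (by simp))
    have := List.countP_le_length (l := E) (p := fun f => decide (f.1 = a))
    simp only at hab h6' h7'
    by_cases hc : 1 < E.countP (fun f => f.1 = a)
    · simp [h6', h7', e10, h10, hc]
      refine ⟨by omega, by omega, fun v => ?_⟩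
      rw [Function.update_apply]
      by_cases e : v = b
      · rw [if_pos e, if_pos (.inr e.symm)]
      · rw [if_neg e, i1]
        refine if_congr ?_ rfl rfl
        simp [Ne.symm e]
    · simp [h6', e10, h10, hc]
      refine ⟨by omega, fun v => ?_⟩
      rw [i1]
      refine if_congr ?_ rfl rfl
      simp only [Prod.exists]
      constructor
      · rintro ⟨c, _, h1, rfl, h3⟩
        exact ⟨c, h1, h3⟩
      · rintro ⟨c, h1, h3⟩
        exact ⟨c, v, h1, rfl, h3⟩
  · rintro σ₁ τ₁ ⟨i1, hτ, -⟩
    exact ⟨i1, by omega⟩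

/-- Collect the chain heads in the array `13`. -/
def collectHeads : Prog :=
  block [.assign 12 (.atom (.const 0)), forLt 5 (.var 0) (block
    [.assign 9 (.read 6 (.var 5)), .ite (.eq (.var 9) (.const 1)) (block
      [.assign 9 (.read 7 (.var 5)), .ite (.eq (.var 9) (.const 1)) (block
        [.assign 9 (.read 11 (.var 5)), .assign 10 (.read 12 (.var 5)),
          .ite (.ne (.var 9) (.const 1)) (.assign 10 (.atom (.const 1))) .skip,
          .ite (.eq (.var 10) (.const 1)) (block
            [.store 13 (.var 12) (.var 5), .assign 12 (.add (.var 12) (.const 1))]) .skip])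
        .skip]) .skip])]

theorem wp_collectHeads {B n : ℕ} {p₁ p₂ p₃ : ℕ → Prop} {f : ℕ → ℕ} {σ : State}
    (h0 : σ.vars 0 = n) (hn : n < B) (hf : ∀ v, f v ≤ B)
    (h6 : ∀ v, σ.arrs 6 v = open Classical in if p₁ v then 1 else 0)
    (h7 : ∀ v, σ.arrs 7 v = open Classical in if p₂ v then 1 else 0)
    (h11 : ∀ v, σ.arrs 11 v = f v)
    (h12 : ∀ v, σ.arrs 12 v = open Classical in if p₃ v then 1 else 0) :
    wp B collectHeads (fun σ' τ => ListAt (σ'.arrs 13) ((List.range n).filter fun v =>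
        open Classical in decide (p₁ v ∧ p₂ v ∧ (f v ≠ 1 ∨ p₃ v))) ∧
      σ'.vars 12 = ((List.range n).filter fun v =>
        open Classical in decide (p₁ v ∧ p₂ v ∧ (f v ≠ 1 ∨ p₃ v))).length ∧
      τ ≤ 30 * (n + 1)) σ := by
  classical
  simp only [collectHeads, wp_block_cons, wp_atom, wp_block_nil, eval_const]
  refine ⟨by omega, ?_⟩
  set P : ℕ → Bool := fun v => decide (p₁ v ∧ p₂ v ∧ (f v ≠ 1 ∨ p₃ v)) with hP
  refine wp.mono (wp_forLt (m := n) (c := 20)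
    (fun j σ' => ListAt (σ'.arrs 13) ((List.range j).filter P) ∧
      σ'.vars 12 = ((List.range j).filter P).length) (by rfl) hn.le ?_ ?_ ?_) ?_
  · intro σ' hF
    rw [eval_var, hF.vars 0 rfl]
    simpa using h0
  · simp [ListAt]
  · rintro j σ' hj h5 ⟨i1, i2⟩ hF
    have e6 := hF.arrs 6 rfl
    have e7 := hF.arrs 7 rfl
    have e11 := hF.arrs 11 rfl
    have e12 := hF.arrs 12 rfl
    have hfl : ((List.range j).filter P).length ≤ j := by
      simpa using List.length_filter_le P (List.range j)
    have := hf j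
    have hr : ∀ b, P j = b → (List.range (j + 1)).filter P =
        (List.range j).filter P ++ if b = true then [j] else [] := by
      intro b hb
      rw [List.range_succ, List.filter_append]
      cases b <;> simp [hb]
    by_cases q1 : p₁ j
    · by_cases q2 : p₂ j
      · by_cases q : f j = 1
        · by_cases q3 : p₃ j
          · have := hr true (by simp [hP, q1, q2, q3])
            simp [h5, e6, e7, e11, e12, h6, h7, h11, h12, q1, q2, q, q3, i2, this]
            and_intros <;> first | omega | exact i1.append _ rfl
          · have := hr false (by simp [hP, q1, q2, q3, q])
            simp [h5, e6, e7, e11, e12, h6, h7, h11, h12, q1, q2, q, q3, i2, this]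
            and_intros <;> omega
        · have := hr true (by simp [hP, q1, q2, q])
          have h' : (if p₃ j then 1 else 0) ≤ B := by split_ifs <;> omega
          simp [h5, e6, e7, e11, e12, h6, h7, h11, h12, q1, q2, q, i2, this, h']
          and_intros <;> first | omega | exact i1.append _ rfl
      · have := hr false (by simp [hP, q1, q2])
        simp [h5, e6, e7, h6, h7, q1, q2, i2, this]
        and_intros <;> omega
    · have := hr false (by simp [hP, q1])
      simp [h5, e6, h6, q1, i2, this]
      and_intros <;> omega
  · rintro σ₁ τ₁ ⟨⟨i1, i2⟩, hτ, -⟩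
    exact ⟨i1, i2, by omega⟩

/-- Compute in the variable `13` a power of two that is `2 ^ k`, or at least `n`. -/
def clampPow : Prog :=
  block [.assign 13 (.atom (.const 1)), forLt 14 (.var 3)
    (.ite (.lt (.var 13) (.var 0)) (.assign 13 (.add (.var 13) (.var 13))) .skip)]

/-- The number 2^k may exceed the word bound, so doubling stops once n is reached. At most n heads
exist, hence the comparison of their number with 3·2^k has the same outcome for the clamped power.
-/
theorem wp_clampPow {B n k : ℕ} {σ : State} (h0 : σ.vars 0 = n) (h3 : σ.vars 3 = k) (hk : k ≤ B)
    (hn : 2 * n + 1 ≤ B) :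
    wp B clampPow (fun σ' τ => σ'.vars 13 ≤ 2 ^ k ∧ σ'.vars 13 ≤ 2 * n + 1 ∧
      (σ'.vars 13 = 2 ^ k ∨ n ≤ σ'.vars 13) ∧ τ ≤ 10 * (k + 1)) σ := by
  simp only [clampPow, wp_block_cons, wp_atom, wp_block_nil, eval_const]
  refine ⟨by omega, ?_⟩
  refine wp.mono (wp_forLt (m := k) (c := 2)
    (fun j σ' => σ'.vars 13 ≤ 2 ^ j ∧ σ'.vars 13 ≤ 2 * n + 1 ∧
      (σ'.vars 13 = 2 ^ j ∨ n ≤ σ'.vars 13)) (by rfl) hk ?_ ?_ ?_) ?_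
  · intro σ' hF
    rw [eval_var, hF.vars 3 rfl]
    simpa using h3
  · simp
  · rintro j σ' hj h5 ⟨i1, i2, i3⟩ hF
    have e0 : σ'.vars 0 = n := by rw [hF.vars 0 rfl]; simpa using h0
    by_cases hlt : σ'.vars 13 < n
    · simp [e0, hlt, pow_succ]
      omega
    · simp [e0, hlt, pow_succ]
      omega
  · rintro σ₁ τ₁ ⟨⟨i1, i2, i3⟩, hτ, -⟩
    exact ⟨i1, i2, i3, by omega⟩

/-- The edges of the list that leave `u` or a vertex outside of `T`. -/
abbrev AvoidList (E : List (ℕ × ℕ)) (T : Finset ℕ) (u a b : ℕ) : Prop :=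
  (a, b) ∈ E ∧ (a = u ∨ a ∉ T)

/-! ### Testing and enumerating candidate tracking sets -/

theorem enter_append {E : List (ℕ × ℕ)} {T : Finset ℕ} {u a b : ℕ}
    (h : TopoSorted (E ++ [(a, b)])) {v : ℕ} :
    (∃ c, ReflTransGen (AvoidList (E ++ [(a, b)]) T u) u c ∧ AvoidList (E ++ [(a, b)]) T u c v) ↔
      (∃ c, ReflTransGen (AvoidList E T u) u c ∧ AvoidList E T u c v) ∨
        (ReflTransGen (AvoidList E T u) u a ∧ (a = u ∨ a ∉ T)) ∧ v = b := by
  have hab : a ≠ b := h.2 (a, b) (by simp)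
  have hr := fun {v} => h.reach_append (fun x => x = u ∨ x ∉ T) (u := u) (v := v)
  constructor
  · rintro ⟨c, h1, h2, h3⟩
    rcases hr.1 h1 with h1' | ⟨-, rfl⟩
    · rcases List.mem_append.1 h2 with h2 | h2
      · exact .inl ⟨c, h1', h2, h3⟩
      · simp only [List.mem_singleton, Prod.mk.injEq] at h2
        obtain ⟨rfl, rfl⟩ := h2
        exact .inr ⟨⟨h1', h3⟩, rfl⟩
    · rcases List.mem_append.1 h2 with h2 | h2
      · exact (h.not_mem _ h2).elim
      · simp only [List.mem_singleton, Prod.mk.injEq] at h2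
        exact (hab h2.1.symm).elim
  · rintro (⟨c, h1, h2, h3⟩ | ⟨⟨h1, h2⟩, rfl⟩)
    · exact ⟨c, hr.2 (.inl h1), by simp [h2], h3⟩
    · exact ⟨a, hr.2 (.inl h1), by simp, h2⟩

/-- The search never re-enters its starting vertex. So the mark of u persists, and the mark of a
newly entered vertex depends only on whether it lies in T. -/
theorem reach_ne {E : List (ℕ × ℕ)} {T : Finset ℕ} {u a b : ℕ} (h : TopoSorted (E ++ [(a, b)]))
    (hr : ReflTransGen (AvoidList E T u) u a) : b ≠ u := by
  rintro rfl
  rcases reflTransGen_iff_eq_or_transGen.1 hr with h' | h'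
  · exact h.2 (a, b) (by simp) h'
  · obtain ⟨c, hc, -⟩ := TransGen.head'_iff.1 h'
    exact h.not_mem _ hc.1

/-- Propagate the mark in the array `16` along an edge. The array `17` holds the vertices entered so
far; when a vertex is entered for the second time, the variable `16` is cleared. -/
def clashBody : Prog :=
  block [.assign 9 (.read 16 (.var 6)), .ite (.eq (.var 9) (.const 1)) (block
    [.assign 10 (.read 17 (.var 7)),
      .ite (.eq (.var 10) (.const 1)) (.assign 16 (.atom (.const 0))) .skip,
      .store 17 (.var 7) (.const 1), .assign 10 (.read 15 (.var 7)),
      .assign 10 (.sub (.const 1) (.var 10)), .store 16 (.var 7) (.var 10)]) .skip]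

/-- Clear the variable `16` if there is a clash for the vertex in the variable `18`. -/
def clashTest : Prog :=
  block [forLt 5 (.var 0) (block [.store 16 (.var 5) (.const 0), .store 17 (.var 5) (.const 0)]),
    .store 16 (.var 18) (.const 1), edgeLoop 11 8 9 clashBody]

open Classical in
-- A vertex is active if it is reached by admissible edges and may be left by one: it is u or lies
-- outside T. When an edge is processed, the status of its tail is final because the list is sorted.
-- A clash therefore shows up as a second edge with active tail into the same head, and one linear
-- pass detects it.
theorem wp_clashTest {B n u ok : ℕ} {E : List (ℕ × ℕ)} {T : Finset ℕ} {σ : State}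
    (h0 : σ.vars 0 = n) (hn : n < B) (h11 : σ.vars 11 = E.length)
    (hE : EdgesAt (σ.arrs 8) (σ.arrs 9) E) (hl : E.length < B) (hlt : ∀ e ∈ E, e.1 < n ∧ e.2 < n)
    (hs : TopoSorted E) (hnd : E.Nodup) (hu : u < n) (h18 : σ.vars 18 = u)
    (h15 : ∀ v < n, σ.arrs 15 v = if v ∈ T then 1 else 0) (h16 : σ.vars 16 = ok) :
    wp B clashTest (fun σ' τ => (σ'.vars 16 = if Clash (AvoidList E T u) u then 0 else ok) ∧
      τ ≤ 20 * (n + E.length + 1)) σ := by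
  simp only [clashTest, wp_block_cons, wp_block_nil]
  refine wp.mono (wp_forLt (m := n) (c := 3)
    (fun j σ' => ∀ v < j, σ'.arrs 16 v = 0 ∧ σ'.arrs 17 v = 0) (by rfl) hn.le ?_ ?_ ?_) ?_
  · intro σ' hF
    rw [eval_var, hF.vars 0 rfl, h0]
  · simp
  · intro j σ' hj h5 hI hF
    simp [h5]
    refine ⟨by omega, fun v hv => ?_⟩
    simp only [Function.update_apply]
    by_cases e : v = j
    · simp [e]
    · simpa [e] using hI v (by omega)
  rintro σ₁ τ₁ ⟨hI₁, hτ₁, hF₁⟩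
  have h18' : σ₁.vars 18 = u := (hF₁.vars 18 rfl).trans h18
  simp only [wp_store, eval_var, eval_const, h18']
  refine ⟨by omega, ?_⟩
  refine wp.mono (wp_edgeLoop (E := E) (c := 14)
    (fun l σ' => (∀ v < n, σ'.arrs 17 v =
        if ∃ c, ReflTransGen (AvoidList l T u) u c ∧ AvoidList l T u c v then 1 else 0) ∧
      (∀ v < n, σ'.arrs 16 v =
        if ReflTransGen (AvoidList l T u) u v ∧ (v = u ∨ v ∉ T) then 1 else 0) ∧
      σ'.vars 16 = if Clash (AvoidList l T u) u then 0 else ok)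
    ?_ ?_ ?_ hl.le (fun e he => by have := hlt e he; omega) (by rfl) (by rfl) (by rfl) (by rfl)
    ?_ ?_) ?_
  · intro l σ x v hx h
    have : 16 ≠ x := by rintro rfl; simp at hx
    simpa [this] using h
  · exact (hF₁.vars 11 rfl).trans h11
  · simpa [hF₁.arrs 8 rfl, hF₁.arrs 9 rfl] using hE
  · have hre : ∀ v, ReflTransGen (AvoidList [] T u) u v ↔ v = u := fun v => by
      rw [reflTransGen_iff_eq]
      simp
    refine ⟨fun v hv => ?_, fun v hv => ?_, ?_⟩
    · rw [if_neg]
      · simpa using (hI₁ v hv).2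
      · rintro ⟨c, -, h, -⟩
        simp at h
    · rw [hre]
      by_cases e : v = u <;> simp [e, (hI₁ v hv).1]
    · rw [if_neg]
      · simpa [h16] using hF₁.vars 16 rfl
      · rintro ⟨_, _, _, _, _, _, h, _⟩
        simpa using h.1
  · rintro l ⟨a, b⟩ σ' hl' ⟨i1, i2, i3⟩ hF h6 h7
    have hs' := TopoSorted.of_prefix hs hl'
    have hnd' : (l ++ [(a, b)]).Nodup := hnd.sublist hl'.sublist
    have hn' : (a, b) ∉ l := fun h => (List.nodup_append.1 hnd').2.2 _ h _ (by simp) rfl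
    have hab := hlt (a, b) (hl'.subset (by simp))
    have e15 : σ'.arrs 15 = σ.arrs 15 := by
      rw [hF.arrs 15 rfl]
      simpa using hF₁.arrs 15 rfl
    have c1 := fun v => hs'.reach_append (fun x => x = u ∨ x ∉ T) (u := u) (v := v)
    have c2 := hs'.clash_append hn' (fun x => x = u ∨ x ∉ T) (u := u)
    have c3 := fun v => enter_append (T := T) (u := u) hs' (v := v)
    simp only at h6 h7 hab
    have ha := i2 a hab.1
    have hb := i1 b hab.2
    have hb' := h15 b hab.2
    -- Only an edge with active tail changes anything. Its head b differs from u, so b becomes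
    -- active exactly if b ∉ T, which is the value 1 minus the indicator of T.
    by_cases hact : ReflTransGen (AvoidList l T u) u a ∧ (a = u ∨ a ∉ T)
    · have hbu := reach_ne hs' hact.1
      rw [if_pos hact] at ha
      have k1 : ∀ v < n, Function.update (σ'.arrs 17) b 1 v = if ∃ c,
          ReflTransGen (AvoidList (l ++ [(a, b)]) T u) u c ∧ AvoidList (l ++ [(a, b)]) T u c v
          then 1 else 0 := by
        intro v hv
        rw [Function.update_apply, if_congr (c3 v) rfl rfl]
        by_cases e : v = b
        · rw [if_pos e, if_pos (.inr ⟨hact, e⟩)]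
        · rw [if_neg e, i1 v hv]
          simp [e]
      have k2 : ∀ v < n, Function.update (σ'.arrs 16) b (1 - σ'.arrs 15 b) v =
          if ReflTransGen (AvoidList (l ++ [(a, b)]) T u) u v ∧ (v = u ∨ v ∉ T) then 1 else 0 := by
        intro v hv
        rw [Function.update_apply, if_congr (and_congr_left' (c1 v)) rfl rfl]
        by_cases e : v = b
        · subst e
          rw [if_pos rfl, e15, hb']
          by_cases hT : v ∈ T
          · simp [hT, hbu]
          · simp [hT, hact]
        · rw [if_neg e, i2 v hv]
          simp [e]
      have k3 : Clash (AvoidList (l ++ [(a, b)]) T u) u ↔ Clash (AvoidList l T u) u ∨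
          ∃ c, ReflTransGen (AvoidList l T u) u c ∧ AvoidList l T u c b :=
        c2.trans (or_congr_right (and_iff_right hact))
      have hb1 : σ'.arrs 15 b ≤ 1 := by rw [e15, hb']; split_ifs <;> omega
      by_cases hseen : ∃ c, ReflTransGen (AvoidList l T u) u c ∧ AvoidList l T u c b
      · rw [if_pos hseen] at hb
        rw [if_pos (k3.2 (.inr hseen))]
        simp only [clashBody, wp_block_cons, wp_block_nil, wp_read, wp_atom, wp_ite, wp_sub,
          wp_store, wp_skip, eval_var, eval_const, setVar_vars, setVar_arrs, setArr_vars,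
          setArr_arrs, holds_eq, h6, h7, ha, hb, if_true, if_false, Nat.reduceEqDiff]
        exact ⟨by omega, by omega, by omega, by omega, by omega, by omega, by omega,
          ⟨k1, k2, trivial⟩, by omega⟩
      · rw [if_neg hseen] at hb
        rw [if_congr (k3.trans (or_iff_left hseen)) rfl rfl]
        simp only [clashBody, wp_block_cons, wp_block_nil, wp_read, wp_atom, wp_ite, wp_sub,
          wp_store, wp_skip, eval_var, eval_const, setVar_vars, setVar_arrs, setArr_vars,
          setArr_arrs, holds_eq, h6, h7, ha, hb, if_true, if_false, Nat.reduceEqDiff, zero_ne_one]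
        exact ⟨by omega, by omega, by omega, by omega, by omega, by omega, ⟨k1, k2, i3⟩, by omega⟩
    · rw [if_neg hact] at ha
      have k3 : Clash (AvoidList (l ++ [(a, b)]) T u) u ↔ Clash (AvoidList l T u) u :=
        c2.trans (or_iff_left fun h => hact h.1)
      simp [clashBody, h6, ha]
      refine ⟨by omega, fun v hv => ?_, fun v hv => ?_, ?_⟩
      · rw [if_congr ((c3 v).trans (or_iff_left fun h => hact h.1)) rfl rfl, i1 v hv]
      · rw [if_congr (and_congr_left' ((c1 v).trans (or_iff_left fun h => hact h.1))) rfl rfl,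
          i2 v hv]
      · rw [if_congr k3 rfl rfl, i3]
  · rintro σ₂ τ₂ ⟨⟨_, _, i3⟩, hτ₂, -⟩
    exact ⟨i3, by omega⟩

/-- Set the variable `16` to `1` if the vertices selected by the array `14` form a tracking set, and
to `0` otherwise. -/
def trackTest : Prog :=
  block [forLt 5 (.var 0) (.store 15 (.var 5) (.const 0)),
    forLt 14 (.var 3) (block [.assign 9 (.read 14 (.var 14)), .assign 9 (.read 13 (.var 9)),
      .store 15 (.var 9) (.const 1)]),
    .assign 16 (.atom (.const 1)),
    forLt 14 (.var 3) (block [.assign 18 (.read 14 (.var 14)), .assign 18 (.read 13 (.var 18)),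
      clashTest]),
    .assign 18 (.atom (.var 1)), clashTest]

open Classical in
-- One clash search for each entry of the tuple and one for s; the flag in variable 16 can only be
-- cleared, so it ends as the conjunction. Repeated entries merely repeat a search.
theorem wp_trackTest {B n s k : ℕ} {E : List (ℕ × ℕ)} {d x : ℕ → ℕ} {σ : State}
    (h0 : σ.vars 0 = n) (hn : n < B) (h1 : σ.vars 1 = s) (hsn : s < n) (h3 : σ.vars 3 = k)
    (hk : k < B) (h11 : σ.vars 11 = E.length) (hE : EdgesAt (σ.arrs 8) (σ.arrs 9) E)
    (hl : E.length < B) (hlt : ∀ e ∈ E, e.1 < n ∧ e.2 < n) (hs : TopoSorted E) (hnd : E.Nodup)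
    (h14 : ∀ i < k, σ.arrs 14 i = d i) (hd : ∀ i < k, d i ≤ B)
    (h13 : ∀ i < k, σ.arrs 13 (d i) = x i) (hx : ∀ i < k, x i < n) :
    wp B trackTest (fun σ' τ => (σ'.vars 16 = if ∀ u ∈ insert s ((Finset.range k).image x),
        ¬ Clash (AvoidList E ((Finset.range k).image x) u) u then 1 else 0) ∧
      τ ≤ 60 * ((k + 1) * (n + E.length + 1))) σ := by
  set T := (Finset.range k).image x with hT
  simp only [trackTest, wp_block_cons, wp_block_nil]
  refine wp.mono (wp_forLt (m := n) (c := 3) (fun j σ' => ∀ v < j, σ'.arrs 15 v = 0)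
    (by rfl) hn.le ?_ ?_ ?_) ?_
  · intro σ' hF
    rw [eval_var, hF.vars 0 rfl, h0]
  · simp
  · intro j σ' hj h5 hI hF
    simp [h5]
    refine ⟨by omega, fun v hv => ?_⟩
    rw [Function.update_apply]
    by_cases e : v = j
    · simp [e]
    · simpa [e] using hI v (by omega)
  rintro σ₁ τ₁ ⟨hI₁, hτ₁, hF₁⟩
  refine wp.mono (wp_forLt (m := k) (c := 4) (fun j σ' => ∀ v < n, σ'.arrs 15 v =
    if v ∈ (Finset.range j).image x then 1 else 0) (by rfl) hk.le ?_ ?_ ?_) ?_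
  · intro σ' hF
    rw [eval_var, hF.vars 3 rfl, hF₁.vars 3 rfl, h3]
  · simpa using hI₁
  · intro j σ' hj h5 hI hF
    have e14 : σ'.arrs 14 = σ.arrs 14 := (hF.arrs 14 rfl).trans (hF₁.arrs 14 rfl)
    have e13 : σ'.arrs 13 = σ.arrs 13 := (hF.arrs 13 rfl).trans (hF₁.arrs 13 rfl)
    have := hd j hj
    have := hx j hj
    simp [h5, e14, e13, h14 j hj, h13 j hj]
    refine ⟨by omega, by omega, by omega, fun v hv => ?_⟩
    rw [Function.update_apply]
    by_cases e : v = x j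
    · rw [if_pos e, if_pos ⟨j, by omega, e.symm⟩]
    · rw [if_neg e, hI v hv]
      refine if_congr ?_ rfl rfl
      simp only [Finset.mem_image, Finset.mem_range]
      constructor
      · rintro ⟨i, hi, rfl⟩
        exact ⟨i, by omega, rfl⟩
      · rintro ⟨i, hi, rfl⟩
        exact ⟨i, by by_contra h; exact e (by rw [show i = j by omega]), rfl⟩
  rintro σ₂ τ₂ ⟨hI₂, hτ₂, hF₂⟩
  have hF₂' : ∀ x, x ≠ 5 → x ≠ 9 → x ≠ 14 → σ₂.vars x = σ.vars x := fun x a b c =>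
    (hF₂.vars x (by simp [forLt, loop, block, Prog.keepsVar]; omega)).trans
      (hF₁.vars x (by simp [forLt, loop, Prog.keepsVar]; omega))
  have hA₂ : ∀ x, x ≠ 15 → σ₂.arrs x = σ.arrs x := fun x a =>
    (hF₂.arrs x (by simp [forLt, loop, block, Prog.keepsArr]; omega)).trans
      (hF₁.arrs x (by simp [forLt, loop, Prog.keepsArr]; omega))
  simp only [wp_atom, eval_const]
  refine ⟨by omega, ?_⟩
  refine wp.mono (wp_forLt (m := k) (c := 20 * (n + E.length + 1) + 3) (fun j σ' => σ'.vars 16 =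
    if ∀ i < j, ¬ Clash (AvoidList E T (x i)) (x i) then 1 else 0) (by rfl) hk.le ?_ ?_ ?_) ?_
  · intro σ' hF
    rw [eval_var, hF.vars 3 rfl]
    simp [hF₂' 3, h3]
  · simp
  · intro j σ' hj h5 hI hF
    have e14 : σ'.arrs 14 = σ.arrs 14 := (hF.arrs 14 rfl).trans (by simp [hA₂ 14])
    have e13 : σ'.arrs 13 = σ.arrs 13 := (hF.arrs 13 rfl).trans (by simp [hA₂ 13])
    have := hd j hj
    have := hx j hj
    simp only [wp_block_cons, wp_block_nil, wp_read, eval_var, setVar_vars, setVar_arrs, h5, e14,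
      e13, h14 j hj, h13 j hj, if_true]
    refine ⟨by omega, by omega, ?_⟩
    refine wp.mono (wp_clashTest (E := E) (T := T) (u := x j) (ok := σ'.vars 16)
      ?_ hn ?_ ?_ hl hlt hs hnd (hx j hj) (by simp) ?_ (by simp)) ?_
    · simp [hF.vars 0 rfl, hF₂' 0, h0]
    · simp [hF.vars 11 rfl, hF₂' 11, h11]
    · simp only [setVar_arrs, hF.arrs 8 rfl, hF.arrs 9 rfl, hA₂ 8 (by omega), hA₂ 9 (by omega)]
      exact hE
    · simp only [setVar_arrs, hF.arrs 15 rfl]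
      exact hI₂
    · rintro σ₃ τ₃ ⟨hI₃, hτ₃⟩
      refine ⟨?_, by omega⟩
      simp only [if_neg (show (16 : ℕ) ≠ 14 by decide), hI₃, hI]
      by_cases hc : Clash (AvoidList E T (x j)) (x j)
      · rw [if_pos hc, if_neg (fun h => h j (by omega) hc)]
      · rw [if_neg hc]
        refine if_congr ⟨fun h i hi => ?_, fun h i hi => h i (by omega)⟩ rfl rfl
        rcases Nat.lt_or_ge i j with h' | h'
        · exact h i h'
        · rwa [show i = j by omega]
  rintro σ₃ τ₃ ⟨hI₃, hτ₃, hF₃⟩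
  have e1 : σ₃.vars 1 = s := by simp [hF₃.vars 1 rfl, hF₂' 1, h1]
  simp only [eval_var, e1]
  refine ⟨by omega, ?_⟩
  refine wp.mono (wp_clashTest (E := E) (T := T) (u := s) (ok := σ₃.vars 16)
      ?_ hn ?_ ?_ hl hlt hs hnd hsn (by simp) ?_ (by simp)) ?_
  · simp [hF₃.vars 0 rfl, hF₂' 0, h0]
  · simp [hF₃.vars 11 rfl, hF₂' 11, h11]
  · simp only [setVar_arrs, hF₃.arrs 8 rfl, hF₃.arrs 9 rfl, hA₂ 8 (by omega), hA₂ 9 (by omega)]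
    exact hE
  · simp only [setVar_arrs, hF₃.arrs 15 rfl]
    exact hI₂
  · rintro σ₄ τ₄ ⟨hI₄, hτ₄⟩
    constructor
    · rw [hI₄, hI₃]
      by_cases hc : Clash (AvoidList E T s) s
      · rw [if_pos hc, if_neg (fun h => h s (by simp) hc)]
      · rw [if_neg hc]
        refine if_congr ⟨fun h u hu => ?_, fun h i hi => h _ ?_⟩ rfl rfl
        · rcases Finset.mem_insert.1 hu with rfl | hu
          · exact hc
          · obtain ⟨i, hi, rfl⟩ := Finset.mem_image.1 hu
            exact h i (Finset.mem_range.1 hi)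
        · exact Finset.mem_insert_of_mem (Finset.mem_image_of_mem x (Finset.mem_range.2 hi))
    · generalize hW : n + E.length + 1 = W at *
      have e1 : k * (20 * W + 3 + 2) = 20 * (k * W) + 5 * k := by ring
      have e2 : 60 * ((k + 1) * W) = 60 * (k * W) + 60 * W := by ring
      have e3 : k ≤ k * W := Nat.le_mul_of_pos_right k (by omega)
      omega

/-- Replace the number with the `k` digits in the array `14`, to a base in the variable `12`, by
its successor, and clear the variable `15` in case of an overflow. -/
def increment : Prog :=
  block [.assign 9 (.atom (.const 1)), forLt 14 (.var 3) (block
    [.assign 10 (.read 14 (.var 14)), .assign 10 (.add (.var 10) (.var 9)),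
      .assign 9 (.atom (.const 0)),
      .ite (.eq (.var 10) (.var 12)) (block
        [.assign 10 (.atom (.const 0)), .assign 9 (.atom (.const 1))]) .skip,
      .store 14 (.var 14) (.var 10)]),
    .ite (.eq (.var 9) (.const 1)) (.assign 15 (.atom (.const 0))) .skip]

/-- When 1 is added to v in base N, the carry into place i is 1 exactly if N^i divides v + 1. Base 1
is allowed, since there may be a single head: all digits are then zero and every carry is passed on.
This is why N = 1 is treated apart. -/
theorem succ_digit {N v i : ℕ} (hN : 0 < N) :
    (v + 1) / N ^ i % N = (if v / N ^ i % N + (if N ^ i ∣ v + 1 then 1 else 0) = N then 0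
      else v / N ^ i % N + (if N ^ i ∣ v + 1 then 1 else 0)) ∧
    (N ^ (i + 1) ∣ v + 1 ↔ v / N ^ i % N + (if N ^ i ∣ v + 1 then 1 else 0) = N) := by
  have hlt := Nat.mod_lt (v / N ^ i) hN
  rw [Nat.succ_div]
  by_cases h : N ^ i ∣ v + 1
  · simp only [h, if_true]
    have h2 : N ^ (i + 1) ∣ v + 1 ↔ v / N ^ i % N + 1 = N := by
      have e : (v + 1) / N ^ i = v / N ^ i + 1 := by rw [Nat.succ_div, if_pos h]
      rw [pow_succ, ← Nat.dvd_div_iff_mul_dvd h, e, Nat.dvd_iff_mod_eq_zero, Nat.add_mod]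
      constructor
      · intro h0
        by_contra hne
        rcases Nat.eq_or_lt_of_le (Nat.succ_le_of_lt hN) with h1 | h1
        · have : N = 1 := h1.symm
          subst this
          omega
        · rw [Nat.mod_eq_of_lt (show 1 < N from h1), Nat.mod_eq_of_lt (by omega)] at h0
          omega
      · intro h0
        rcases Nat.eq_or_lt_of_le (Nat.succ_le_of_lt hN) with h1 | h1
        · have : N = 1 := h1.symm
          subst this
          omega
        · rw [Nat.mod_eq_of_lt (show 1 < N from h1), h0, Nat.mod_self]
    refine ⟨?_, h2⟩
    by_cases h3 : v / N ^ i % N + 1 = N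
    · rw [if_pos h3]
      rw [Nat.add_mod]
      rcases Nat.eq_or_lt_of_le (Nat.succ_le_of_lt hN) with h1 | h1
      · have : N = 1 := h1.symm
        subst this
        omega
      · rw [Nat.mod_eq_of_lt (show 1 < N from h1), h3, Nat.mod_self]
    · rw [if_neg h3, Nat.add_mod]
      rw [Nat.mod_eq_of_lt (show 1 < N by omega), Nat.mod_eq_of_lt (by omega)]
  · simp only [h, if_false, add_zero]
    rw [if_neg (by omega)]
    refine ⟨rfl, iff_of_false (fun h' => h ?_) (by omega)⟩
    exact (Dvd.intro _ (pow_succ N i).symm).trans h'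

theorem wp_increment {B N k v : ℕ} {σ : State} (hk : k ≤ B) (hNB : N < B) (hN : 0 < N)
    (h3 : σ.vars 3 = k) (h12 : σ.vars 12 = N) (hv : v < N ^ k)
    (h14 : ∀ i < k, σ.arrs 14 i = v / N ^ i % N) :
    wp B increment (fun σ' τ => (∀ i < k, σ'.arrs 14 i = (v + 1) / N ^ i % N) ∧
      (σ'.vars 15 = if v + 1 = N ^ k then 0 else σ.vars 15) ∧ τ ≤ 20 * (k + 1)) σ := by
  simp only [increment, wp_block_cons, wp_block_nil, wp_atom, eval_const]
  refine ⟨by omega, ?_⟩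
  refine wp.mono (wp_forLt (m := k) (c := 11) (fun j σ' =>
    (∀ i < j, σ'.arrs 14 i = (v + 1) / N ^ i % N) ∧
    (∀ i, j ≤ i → i < k → σ'.arrs 14 i = v / N ^ i % N) ∧
    σ'.vars 9 = if N ^ j ∣ v + 1 then 1 else 0) (by rfl) hk ?_ ?_ ?_) ?_
  · intro σ' hF
    rw [eval_var, hF.vars 3 rfl]
    simpa using h3
  · refine ⟨by simp, fun i _ hi => by simpa using h14 i hi, by simp⟩
  · rintro j σ' hj h5 ⟨i1, i2, i3⟩ hF
    have e12 : σ'.vars 12 = N := by rw [hF.vars 12 rfl]; simpa using h12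
    obtain ⟨hd1, hd2⟩ := succ_digit (v := v) (i := j) hN
    rw [← i3] at hd1 hd2
    have hlt := Nat.mod_lt (v / N ^ j) hN
    have h9 : σ'.vars 9 ≤ 1 := by rw [i3]; split_ifs <;> omega
    have hgen : ∀ x, x = (v + 1) / N ^ j % N →
        (∀ i < j + 1, Function.update (σ'.arrs 14) j x i = (v + 1) / N ^ i % N) ∧
        ∀ i, j + 1 ≤ i → i < k → Function.update (σ'.arrs 14) j x i = v / N ^ i % N := by
      intro x hx
      constructor
      · intro i hi
        rw [Function.update_apply]
        split_ifs with e
        · rw [e, hx]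
        · exact i1 i (by omega)
      · intro i hi hik
        rw [Function.update_of_ne (by omega)]
        exact i2 i (by omega) hik
    by_cases hc : v / N ^ j % N + σ'.vars 9 = N
    · rw [if_pos hc] at hd1
      simp [h5, i2 j le_rfl hj, e12, hc, hd2.2 hc]
      obtain ⟨g1, g2⟩ := hgen 0 hd1.symm
      exact ⟨by omega, by omega, by omega, by omega, fun i hi => g1 i (by omega), g2⟩
    · rw [if_neg hc] at hd1
      have hc' := mt hd2.1 hc
      simp [h5, i2 j le_rfl hj, e12, hc, hc']
      obtain ⟨g1, g2⟩ := hgen _ hd1.symm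
      exact ⟨by omega, by omega, by omega, fun i hi => g1 i (by omega), g2⟩
  · rintro σ₁ τ₁ ⟨⟨i1, i2, i3⟩, hτ, hF⟩
    have e15 : σ₁.vars 15 = σ.vars 15 := by rw [hF.vars 15 rfl]; simp
    -- A carry out of the last place means that N^k divides v + 1; as v < N^k, the last tuple has
    -- just been left.
    have hiff : N ^ k ∣ v + 1 ↔ v + 1 = N ^ k :=
      ⟨fun h => le_antisymm hv (Nat.le_of_dvd (by omega) h), fun h => h ▸ dvd_rfl⟩
    rw [if_congr hiff rfl rfl] at i3
    by_cases h : v + 1 = N ^ k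
    · simp [i3, h]
      exact ⟨by rw [← h]; exact i1, by omega⟩
    · simp [i3, h, e15]
      exact ⟨i1, by omega⟩

/-- Test all `k`-tuples of entries of the array `13`, of which there are as many as the variable
`12` says, and set the variable `17` to `1` if one of them forms a tracking set. -/
def enumerate : Prog :=
  block [.assign 17 (.atom (.const 0)), .assign 15 (.atom (.const 1)),
    .while (.eq (.var 15) (.const 1)) (block [trackTest,
      .ite (.eq (.var 16) (.const 1)) (block [.assign 17 (.atom (.const 1)),
        .assign 15 (.atom (.const 0))]) increment])]

/-- The entries of `X` selected by the digits of `v`. -/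
def digits (X : List ℕ) (v i : ℕ) : ℕ := X.getD (v / X.length ^ i % X.length) 0

/-- Every k-tuple of indices is the digit sequence of some v < N^k, so counting upwards reaches all
tuples. -/
theorem exists_digits {N k : ℕ} {g : ℕ → ℕ} (hg : ∀ i < k, g i < N) :
    ∃ v < N ^ k, ∀ i < k, v / N ^ i % N = g i := by
  induction k generalizing g with
  | zero => exact ⟨0, by simp, by simp⟩
  | succ k ih =>
    obtain ⟨v, hv, h⟩ := ih (g := fun i => g (i + 1)) fun i hi => hg (i + 1) (by omega)
    have h0 := hg 0 (by omega)
    refine ⟨g 0 + N * v, ?_, fun i hi => ?_⟩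
    · calc g 0 + N * v < N * (v + 1) := by rw [Nat.mul_add]; omega
        _ ≤ N * N ^ k := Nat.mul_le_mul_left _ hv
        _ = N ^ (k + 1) := by ring
    · cases i with
      | zero => simp [Nat.mod_eq_of_lt h0]
      | succ i =>
        rw [pow_succ', ← Nat.div_div_eq_div_mul, Nat.add_mul_div_left _ _ (by omega),
          Nat.div_eq_of_lt h0, zero_add]
        exact h i (by omega)

/-- The entries of `X` selected by the digits of `v` cause no clash. -/
def GoodTuple (E : List (ℕ × ℕ)) (X : List ℕ) (s k v : ℕ) : Prop :=
  ∀ u ∈ insert s ((Finset.range k).image (digits X v)),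
    ¬ Clash (AvoidList E ((Finset.range k).image (digits X v)) u) u

open Classical in
theorem wp_enumerate {B n s k : ℕ} {E : List (ℕ × ℕ)} {X : List ℕ} {σ : State}
    (h0 : σ.vars 0 = n) (hn : n < B) (h1 : σ.vars 1 = s) (hsn : s < n) (h3 : σ.vars 3 = k)
    (hk : k < B) (h11 : σ.vars 11 = E.length) (hE : EdgesAt (σ.arrs 8) (σ.arrs 9) E)
    (hl : E.length < B) (hlt : ∀ e ∈ E, e.1 < n ∧ e.2 < n) (hs : TopoSorted E) (hnd : E.Nodup)
    (h14 : ∀ i, σ.arrs 14 i = 0) (h12 : σ.vars 12 = X.length) (h13 : ListAt (σ.arrs 13) X)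
    (hXn : ∀ x ∈ X, x < n) (hX : 0 < X.length) (hXB : X.length < B) :
    wp B enumerate (fun σ' τ =>
      (σ'.vars 17 = if ∃ v < X.length ^ k, GoodTuple E X s k v then 1 else 0) ∧
      τ ≤ (X.length ^ k + 1) * (100 * ((k + 1) * (n + E.length + 1)))) σ := by
  set N := X.length with hN
  set c := 100 * ((k + 1) * (n + E.length + 1)) with hc
  have hc1 : k + 1 ≤ (k + 1) * (n + E.length + 1) := Nat.le_mul_of_pos_right _ (by omega)
  simp only [enumerate, wp_block_cons, wp_block_nil, wp_atom, eval_const]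
  refine ⟨by omega, by omega, ?_⟩
  -- While the search runs, all tuples with smaller number have failed and the budget is
  -- proportional to the number of tuples left. For k = 0 there is exactly one tuple, the empty one.
  refine wp.mono (wp_while (fun r σ' =>
    (σ'.vars 15 = 1 ∧ σ'.vars 17 = 0 ∧ ∃ v < N ^ k, (∀ i < k, σ'.arrs 14 i = v / N ^ i % N) ∧
      (∀ w < v, ¬ GoodTuple E X s k w) ∧ r = (N ^ k - v) * c) ∨
    (σ'.vars 15 = 0 ∧ (σ'.vars 17 = if ∃ v < N ^ k, GoodTuple E X s k v then 1 else 0) ∧ r = 0))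
    (r := N ^ k * c) ?_ ?_) ?_
  · refine .inl ⟨by simp, by simp, 0, by positivity, fun i _ => by simp [h14], by simp, by simp⟩
  · rintro r σ' (⟨h15', h17', v, hv, hd, hw, rfl⟩ | ⟨h15', -⟩) hF hb
    swap
    · simp [h15'] at hb
    have hFv := fun x hx => hF.vars x hx
    have hdN : ∀ i, v / N ^ i % N < N := fun i => Nat.mod_lt _ hX
    simp only [wp_block_cons, wp_block_nil]
    refine wp.mono (wp_trackTest (n := n) (s := s) (k := k) (E := E) (d := fun i => v / N ^ i % N)
      (x := digits X v) ?_ hn ?_ hsn ?_ hk ?_ ?_ hl hlt hs hnd hd ?_ ?_ ?_).frame ?_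
    · rw [hF.vars 0 rfl]; simpa using h0
    · rw [hF.vars 1 rfl]; simpa using h1
    · rw [hF.vars 3 rfl]; simpa using h3
    · rw [hF.vars 11 rfl]; simpa using h11
    · rw [hF.arrs 8 rfl, hF.arrs 9 rfl]; exact hE
    · intro i _
      have := hdN i
      omega
    · intro i _
      rw [hF.arrs 13 rfl]
      simp only [setVar_arrs, digits]
      rw [h13 _ (hdN i), List.getD_eq_getElem _ _ (hdN i)]
    · intro i _
      simp only [digits]
      rw [List.getD_eq_getElem _ _ (hdN i)]
      exact hXn _ (List.getElem_mem _)
    rintro σ₁ τ₁ ⟨⟨h16, hτ₁⟩, hF₁⟩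
    have hg : σ₁.vars 16 = if GoodTuple E X s k v then 1 else 0 := by
      rw [h16]; exact if_congr Iff.rfl rfl rfl
    obtain ⟨d, hd'⟩ : ∃ d, N ^ k = v + 1 + d := ⟨N ^ k - (v + 1), by omega⟩
    have e1 : (N ^ k - v) * c = d * c + c := by
      rw [show N ^ k - v = d + 1 by omega]; ring
    by_cases hgood : GoodTuple E X s k v
    · rw [if_pos hgood] at hg
      simp only [wp_ite, holds_eq, eval_var, eval_const, hg, if_true, wp_block_cons, wp_block_nil,
        wp_atom]
      refine ⟨by omega, by omega, 0, .inr ⟨by simp, ?_, rfl⟩, by omega⟩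
      rw [if_pos ⟨v, hv, hgood⟩]
      simp
    · rw [if_neg hgood] at hg
      simp only [wp_ite, holds_eq, eval_var, eval_const, hg, zero_ne_one, if_false]
      have e3 : σ₁.vars 3 = k := by rw [hF₁.vars 3 rfl, hF.vars 3 rfl]; simpa using h3
      have e12 : σ₁.vars 12 = N := by rw [hF₁.vars 12 rfl, hF.vars 12 rfl]; simpa using h12
      refine (wp_increment (N := N) (k := k) (v := v) hk.le hXB hX e3 e12 hv
        (by rw [hF₁.arrs 14 rfl]; exact hd)).frame.mono ?_
      rintro σ₂ τ₂ ⟨⟨g1, g2, g3⟩, hF₂⟩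
      have e15 : σ₁.vars 15 = 1 := by rw [hF₁.vars 15 rfl]; exact h15'
      have e17 : σ₂.vars 17 = 0 := by rw [hF₂.vars 17 rfl, hF₁.vars 17 rfl]; exact h17'
      by_cases hov : v + 1 = N ^ k
      · rw [if_pos hov] at g2
        refine ⟨0, .inr ⟨g2, ?_, rfl⟩, by omega⟩
        rw [e17, if_neg]
        rintro ⟨w, hw1, hw2⟩
        rcases Nat.lt_or_ge w v with h | h
        · exact hw w h hw2
        · exact hgood (by rwa [show v = w by omega])
      · rw [if_neg hov, e15] at g2
        refine ⟨_, .inl ⟨g2, e17, v + 1, by omega, g1, fun w hw1 => ?_, rfl⟩, ?_⟩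
        · rcases Nat.lt_or_ge w v with h | h
          · exact hw w h
          · rwa [show w = v by omega]
        · rw [show N ^ k - (v + 1) = d by omega]
          omega
  · rintro σ' τ ⟨⟨r, h | h, hτ⟩, hb, -⟩
    · simp [h.1] at hb
    · refine ⟨h.2.1, ?_⟩
      have : (N ^ k + 1) * c = N ^ k * c + c := by ring
      omega

/-- Decide whether there is a tracking set of size at most `k`, given a sorted list of edges. -/
def decideSorted : Prog :=
  block [markReach, .assign 9 (.read 6 (.var 2)), .ite (.eq (.var 9) (.const 1))
    (block [copyEdges, markHeads, collectHeads, clampPow, .assign 9 (.add (.var 13) (.var 13)),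
      .assign 9 (.add (.var 9) (.var 13)),
      .ite (.lt (.var 9) (.var 12)) (.assign 17 (.atom (.const 0))) enumerate])
    (.assign 17 (.atom (.const 1))), .assign 0 (.atom (.var 17))]

/-- The graph with the vertices `0, …, n - 1` and the edges in the list `E`. -/
def ofList (n : ℕ) (E : List (ℕ × ℕ)) (s t : ℕ) : STDigraph ℕ where
  verts := Finset.range n
  edges := E.toFinset
  s := s
  t := t

/-! ### Correctness and running time of the decision procedure for sorted lists -/

theorem ofList_adj {n : ℕ} {E : List (ℕ × ℕ)} {s t : ℕ} :
    (ofList n E s t).Adj = fun a b => (a, b) ∈ E := by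
  funext a b
  simp [ofList, Adj]

theorem ofList_isDAG {n : ℕ} {E : List (ℕ × ℕ)} {s t : ℕ} (hs : s < n) (ht : t < n)
    (hE : ∀ e ∈ E, e.1 < n ∧ e.2 < n) (hE' : TopoSorted E) : (ofList n E s t).IsDAG where
  s_mem := by simpa [ofList] using hs
  t_mem := by simpa [ofList] using ht
  edges_mem e he := by simpa [ofList] using hE e (by simpa [ofList] using he)
  acyclic v h := hE'.acyclic v (by rwa [← ofList_adj (n := n) (s := s) (t := t)])

theorem ofList_trim_edges {n : ℕ} {E : List (ℕ × ℕ)} {s t : ℕ} :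
    (ofList n E s t).trim.edges = (trimEdges E s t).toFinset := by
  ext ⟨a, b⟩
  have := trim_adj (G := ofList n E s t) (a := a) (b := b)
  rw [ofList_adj] at this
  simpa [trimEdges, ofList] using this

theorem card_filter_toFinset {E : List (ℕ × ℕ)} (h : E.Nodup) (p : ℕ × ℕ → Prop) [DecidablePred p] :
    (E.toFinset.filter p).card = E.countP p := by
  rw [List.countP_eq_length_filter, ← List.toFinset_card_of_nodup (h.filter _)]
  congr 1
  ext
  simp

open Classical in
/-- The chain heads of the graph with the edges in the list `E`, trimmed. -/
noncomputable def headList (n : ℕ) (E : List (ℕ × ℕ)) (s t : ℕ) : List ℕ :=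
  (List.range n).filter fun v => Reach E s v ∧ Reach E v t ∧
    ((trimEdges E s t).countP (fun e => e.2 = v) ≠ 1 ∨ ∃ e ∈ trimEdges E s t, e.2 = v ∧
      1 < (trimEdges E s t).countP (fun f => f.1 = e.1))

theorem headList_toFinset {n : ℕ} {E : List (ℕ × ℕ)} {s t : ℕ} (hnd : E.Nodup) :
    (headList n E s t).toFinset = (ofList n E s t).trim.chainHeads := by
  classical
  have hnd' : (trimEdges E s t).Nodup := hnd.filter _
  ext v
  simp only [chainHeads, Finset.mem_filter, mem_trim, ofList_trim_edges, ofList_adj,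
    card_filter_toFinset hnd', headList, List.mem_toFinset, List.mem_filter, List.mem_range,
    decide_eq_true_eq]
  simp [ofList, and_assoc]

theorem goodTuple_iff {n k v : ℕ} {E : List (ℕ × ℕ)} {s t : ℕ} {X : List ℕ}
    (hG : (ofList n E s t).trim.IsDAG)
    (hX : (Finset.range k).image (digits X v) ⊆ (ofList n E s t).trim.verts) :
    GoodTuple (trimEdges E s t) X s k v ↔
      (ofList n E s t).trim.IsTrackingSet ((Finset.range k).image (digits X v)) := by
  rw [hG.isTrackingSet_iff_not_clash (trim_trim _) hX]
  have : ∀ T u, (ofList n E s t).trim.Avoid T u = AvoidList (trimEdges E s t) T u := by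
    intro T u
    funext a b
    simp [Avoid, Adj, ofList_trim_edges]
  simp only [GoodTuple, this]
  rfl

open Classical in
-- A YES instance has at most 3·2^k chain heads, so a larger number means NO. Otherwise all k-tuples
-- of heads are tested: they suffice, and there are few enough of them.
theorem wp_decideSorted {B n : ℕ} {E : List (ℕ × ℕ)} {s t k : ℕ} {σ : State}
    (h : Input B n E s t k σ) (hz : ∀ A, 6 ≤ A → ∀ v, σ.arrs A v = 0) :
    wp B decideSorted (fun σ' τ => (σ'.vars 0 = if (ofList n E s t).IsYes k then 1 else 0) ∧
      τ ≤ 2000 * (2 ^ (k ^ 2 + 3 * k) * (max k 1) ^ 2 * (E.length + n))) σ := by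
  have hb := h.bound
  have hsn := h.s_lt
  have htn := h.t_lt
  have hG := ofList_isDAG h.s_lt h.t_lt h.edges_lt h.sorted
  set G := ofList n E s t with hGdef
  have hreach : ReflTransGen G.Adj G.s G.t ↔ Reach E s t := by rw [ofList_adj]; rfl
  set K := max k 1 with hK
  set P := 2 ^ (k ^ 2 + 3 * k) with hP
  have hP1 : 1 ≤ P := Nat.one_le_two_pow
  have hK1 : 1 ≤ K := le_max_right _ _
  have hkK : k ≤ K := le_max_left _ _
  have hKW : K * (E.length + n) ≤ P * K ^ 2 * (E.length + n) := by
    refine Nat.mul_le_mul_right _ ?_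
    calc K = 1 * K ^ 1 := by simp
      _ ≤ P * K ^ 2 := Nat.mul_le_mul hP1 (Nat.pow_le_pow_right hK1 (by norm_num))
  have hW1 : E.length + n ≤ K * (E.length + n) := Nat.le_mul_of_pos_left _ hK1
  have hW2 : K ≤ K * (E.length + n) := Nat.le_mul_of_pos_right _ (by omega)
  simp only [decideSorted, wp_block_cons, wp_block_nil]
  refine (wp_markReach h (hz 6 le_rfl) (hz 7 (by norm_num))).frame.mono ?_
  rintro σ₁ τ₁ ⟨⟨h6, h7, hτ₁⟩, hF₁⟩
  have i1 := h.frame hF₁ rfl rfl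
  have e6 : σ₁.arrs 6 t = if Reach E s t then 1 else 0 := h6 t
  simp only [wp_read, eval_var, i1.t_eq, e6]
  refine ⟨⟨by omega, by split_ifs <;> omega⟩, ?_⟩
  by_cases hst : Reach E s t
  swap
  · rw [if_pos (isYes_of_not_reach (fun h => hst (hreach.1 h)) k)]
    simp [hst]
    refine ⟨by omega, by omega⟩
  have hst' := hreach.2 hst
  have hGt := hG.trim hst'
  simp only [if_pos hst, wp_ite, holds_eq, eval_var, eval_const, setVar_vars, if_true]
  -- copying the edges
  simp only [wp_block_cons, wp_block_nil]
  have i1' : Input B n E s t k (σ₁.setVar 9 1) :=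
    ⟨i1.n_eq, i1.s_eq, i1.t_eq, i1.k_eq, i1.e_eq, i1.edges, i1.s_lt, i1.t_lt, i1.edges_lt,
      i1.sorted, i1.nodup, i1.bound⟩
  refine (wp_copyEdges i1' h6 h7 (fun v => ?_) (fun v => ?_)).frame.mono ?_
  · rw [setVar_arrs, hF₁.arrs 10 rfl, hz 10 (by norm_num)]
  · rw [setVar_arrs, hF₁.arrs 11 rfl, hz 11 (by norm_num)]
  rintro σ₂ τ₂ ⟨⟨hE', h11, h10', h11', hτ₂⟩, hF₂⟩
  have i2 := i1'.frame hF₂ rfl rfl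
  set E' := trimEdges E s t with hE'def
  have hE'len : E'.length ≤ E.length := List.length_filter_le _ _
  have hE'sub : ∀ e ∈ E', e ∈ E := fun e he => List.mem_of_mem_filter he
  have hE'lt : ∀ e ∈ E', e.1 < n ∧ e.2 < n := fun e he => h.edges_lt e (hE'sub e he)
  have hE'nd : E'.Nodup := h.nodup.filter _
  have hE's : TopoSorted E' := h.sorted.filter _
  -- marking and collecting the chain heads
  refine (wp_markHeads h11 hE' (by omega) (fun e he => by have := hE'lt e he; omega) h10'
    (fun v => ?_)).frame.mono ?_
  · rw [hF₂.arrs 12 rfl, setVar_arrs, hF₁.arrs 12 rfl, hz 12 (by norm_num)]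
  rintro σ₃ τ₃ ⟨⟨h12', hτ₃⟩, hF₃⟩
  have i3 := i2.frame hF₃ rfl rfl
  refine (wp_collectHeads (n := n) (p₁ := fun v => Reach E s v) (p₂ := fun v => Reach E v t)
    (p₃ := fun v => ∃ e ∈ E', e.2 = v ∧ 1 < E'.countP (fun f => f.1 = e.1))
    (f := fun v => E'.countP fun e => e.2 = v) i3.n_eq (by omega) (fun v => ?_) ?_ ?_ ?_
    (fun v => (h12' v).trans ?_)).frame.mono ?_
  · have := List.countP_le_length (l := E') (p := fun e => decide (e.2 = v))
    omega
  · intro v; rw [hF₃.arrs 6 rfl, hF₂.arrs 6 rfl]; exact h6 v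
  · intro v; rw [hF₃.arrs 7 rfl, hF₂.arrs 7 rfl]; exact h7 v
  · intro v; rw [hF₃.arrs 11 rfl]; exact h11' v
  · congr
  rintro σ₄ τ₄ ⟨⟨h13, h12, hτ₄⟩, hF₄⟩
  have i4 := i3.frame hF₄ rfl rfl
  replace h12 : σ₄.vars 12 = (headList n E s t).length := by
    rw [h12]
    exact congrArg _ (List.filter_congr fun v _ => decide_eq_decide.2 Iff.rfl)
  replace h13 : ListAt (σ₄.arrs 13) (headList n E s t) := by
    convert h13 using 1
    exact List.filter_congr fun v _ => decide_eq_decide.2 Iff.rfl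
  have hXfin : (headList n E s t).toFinset = G.trim.chainHeads := headList_toFinset h.nodup
  have hXnd : (headList n E s t).Nodup := List.nodup_range.filter _
  have hXlen : (headList n E s t).length = G.trim.chainHeads.card := by
    rw [← hXfin, List.toFinset_card_of_nodup hXnd]
  have hXn : ∀ x ∈ headList n E s t, x < n := fun x hx =>
    List.mem_range.1 (List.mem_of_mem_filter hx)
  have hXle : (headList n E s t).length ≤ n := by
    exact (List.length_filter_le _ _).trans_eq List.length_range
  have hXpos : 0 < (headList n E s t).length := by
    rw [hXlen]
    exact Finset.card_pos.2 ⟨_, hGt.source_mem_chainHeads (trim_trim G)⟩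
  set X := headList n E s t with hX
  -- comparing their number with `3 * 2 ^ k`
  refine (wp_clampPow i4.n_eq i4.k_eq (by omega) (by omega)).frame.mono ?_
  rintro σ₅ τ₅ ⟨⟨c1, c2, c3, hτ₅⟩, hF₅⟩
  have i5 := i4.frame hF₅ rfl rfl
  have e12 : σ₅.vars 12 = X.length := by rw [hF₅.vars 12 rfl, h12]
  set c := σ₅.vars 13 with hcdef
  simp only [wp_add, eval_var, setVar_vars, ← hcdef, if_true,
    if_neg (show (13 : ℕ) ≠ 9 by decide), if_neg (show (12 : ℕ) ≠ 9 by decide), wp_ite, holds_lt,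
    e12]
  -- The clamped power is at most 2n + 1, so its triple stays within the word bound.
  refine ⟨by omega, by omega, ?_⟩
  have hyes : G.IsYes k → X.length ≤ 3 * 2 ^ k := by
    intro hy
    obtain ⟨T, hT, hTk⟩ := (hG.trim_isYes hst' k).2 hy
    have h1 := hGt.chainHeads_card_le (trim_trim G)
    have h2 := hT.paths_ncard_le
    have h3 := Nat.pow_le_pow_right (n := 2) (by norm_num) hTk
    -- There are at most n heads, so more heads than 3c excludes n ≤ c; thus c = 2^k and the bound
    -- for YES instances is violated.
    omega
  by_cases hlt : c + c + c < X.length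
  · rw [if_pos hlt]
    simp
    refine ⟨fun hy => ?_, by omega⟩
    have := hyes hy
    omega
  · rw [if_neg hlt]
    refine wp.mono (wp_enumerate (B := B) (n := n) (s := s) (k := k) (E := E') (X := X)
      (σ := (σ₅.setVar 9 (c + c)).setVar 9 (c + c + c)) i5.n_eq (by omega) i5.s_eq hsn
      i5.k_eq (by omega) ?_ ?_ (by omega) hE'lt hE's hE'nd (fun i => ?_) e12 ?_ hXn hXpos
      (by omega)) ?_
    · simp only [setVar_vars, if_neg (show (11 : ℕ) ≠ 9 by decide)]
      rw [hF₅.vars 11 rfl, hF₄.vars 11 rfl, hF₃.vars 11 rfl, h11]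
    · simp only [setVar_arrs]
      rw [hF₅.arrs 8 rfl, hF₄.arrs 8 rfl, hF₃.arrs 8 rfl, hF₅.arrs 9 rfl, hF₄.arrs 9 rfl,
        hF₃.arrs 9 rfl]
      exact hE'
    · simp only [setVar_arrs]
      rw [hF₅.arrs 14 rfl, hF₄.arrs 14 rfl, hF₃.arrs 14 rfl, hF₂.arrs 14 rfl, setVar_arrs,
        hF₁.arrs 14 rfl, hz 14 (by norm_num)]
    · simp only [setVar_arrs]
      rw [hF₅.arrs 13 rfl]
      exact h13
    rintro σ₆ τ₆ ⟨h17, hτ₆⟩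
    have hiff : (∃ v < X.length ^ k, GoodTuple E' X s k v) ↔ G.IsYes k := by
      have hsub : ∀ v, (Finset.range k).image (digits X v) ⊆ G.trim.verts := by
        intro v x hx
        obtain ⟨i, -, rfl⟩ := Finset.mem_image.1 hx
        have : digits X v i ∈ X := by
          rw [digits, List.getD_eq_getElem _ _ (Nat.mod_lt _ hXpos)]
          exact List.getElem_mem _
        exact Finset.filter_subset _ _ (hXfin ▸ List.mem_toFinset.2 this)
      rw [← hG.trim_isYes hst']
      constructor
      · rintro ⟨v, -, hv⟩
        exact ⟨_, (goodTuple_iff hGt (hsub v)).1 hv, Finset.card_image_le.trans (by simp)⟩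
      · intro hy
        obtain ⟨f, hf, hT⟩ := (hGt.isYes_iff_chainHeads (trim_trim G) k).1 hy
        -- The indices of the chosen heads in the list X are the digits of the tuple that will
        -- succeed.
        have hg : ∀ i, ∃ j, i < k → ∃ hj : j < X.length, X[j] = f i := by
          intro i
          by_cases hi : i < k
          · have := hf i hi
            rw [← hXfin, List.mem_toFinset, List.mem_iff_getElem] at this
            obtain ⟨j, hj, e⟩ := this
            exact ⟨j, fun _ => ⟨hj, e⟩⟩
          · exact ⟨0, fun h => (hi h).elim⟩
        choose g hg using hg
        obtain ⟨v, hv, hd⟩ := exists_digits (N := X.length) (k := k) (g := g)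
          fun i hi => (hg i hi).1
        refine ⟨v, hv, (goodTuple_iff hGt (hsub v)).2 ?_⟩
        have : (Finset.range k).image (digits X v) = (Finset.range k).image f := by
          refine Finset.image_congr fun i hi => ?_
          have hi : i < k := by simpa using hi
          obtain ⟨hj, e⟩ := hg i hi
          rw [digits, hd i hi, List.getD_eq_getElem _ _ hj, e]
        rw [this]
        exact hT
    rw [if_congr hiff rfl rfl] at h17
    simp only [wp_atom, eval_var, setVar_vars, if_true, h17]
    refine ⟨by split_ifs <;> omega, trivial, ?_⟩
    -- The estimate 3 ≤ 2³ turns (3·2^k)^k into 2^(k² + 3k).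
    have hXk : X.length ^ k ≤ P := by
      calc X.length ^ k ≤ (3 * 2 ^ k) ^ k := Nat.pow_le_pow_left (by omega) _
        _ ≤ (2 ^ 3 * 2 ^ k) ^ k := Nat.pow_le_pow_left (Nat.mul_le_mul_right _ (by norm_num)) _
        _ = P := by rw [hP, ← pow_add, ← pow_mul]; ring
    have t1 : (X.length ^ k + 1) * (100 * ((k + 1) * (n + E'.length + 1))) ≤
        (2 * P) * (100 * ((2 * K) * (2 * (E.length + n)))) := by
      refine Nat.mul_le_mul (by omega) (Nat.mul_le_mul_left _ (Nat.mul_le_mul (by omega) (by omega)))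
    have t2 : (2 * P) * (100 * ((2 * K) * (2 * (E.length + n)))) ≤
        800 * (P * K ^ 2 * (E.length + n)) := by
      have : P * K * (E.length + n) ≤ P * K ^ 2 * (E.length + n) := by
        refine Nat.mul_le_mul_right _ (Nat.mul_le_mul_left _ ?_)
        exact Nat.le_self_pow (by norm_num) K
      calc _ = 800 * (P * K * (E.length + n)) := by ring
        _ ≤ _ := Nat.mul_le_mul_left _ this
    omega

/-- The adjacency lists `L 0, …, L (n - 1)` are stored in the arrays `0` and `1`. -/
structure AdjAt (n : ℕ) (L : ℕ → List ℕ) (σ : State) : Prop where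
  offset : ∀ u ≤ n, σ.arrs 0 u = (((List.range n).map L).take u).flatten.length
  entries : ListAt (σ.arrs 1) ((List.range n).map L).flatten

/-! ### Scanning adjacency lists with a queue -/

theorem take_succ_flatten {n u : ℕ} {L : ℕ → List ℕ} (hu : u < n) :
    (((List.range n).map L).take (u + 1)).flatten =
      (((List.range n).map L).take u).flatten ++ L u := by
  rw [List.take_add_one, List.flatten_append]
  simp [hu]

theorem AdjAt.next {n u : ℕ} {L : ℕ → List ℕ} {σ : State} (h : AdjAt n L σ) (hu : u < n) :
    σ.arrs 0 (u + 1) = σ.arrs 0 u + (L u).length := by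
  rw [h.offset u hu.le, h.offset (u + 1) hu, take_succ_flatten hu, List.length_append]

theorem AdjAt.offset_le {n u : ℕ} {L : ℕ → List ℕ} {σ : State} (h : AdjAt n L σ) (hu : u ≤ n) :
    σ.arrs 0 u ≤ ((List.range n).map L).flatten.length := by
  rw [h.offset u hu]
  exact ((List.take_sublist _ _).flatten).length_le

theorem AdjAt.entry {n u i : ℕ} {L : ℕ → List ℕ} {σ : State} (h : AdjAt n L σ) (hu : u < n)
    (hi : i < (L u).length) : σ.arrs 1 (σ.arrs 0 u + i) = (L u)[i] := by
  obtain ⟨R, hR⟩ : (((List.range n).map L).take u).flatten ++ L u <+: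
      ((List.range n).map L).flatten := by
    rw [← take_succ_flatten hu]
    exact ⟨(((List.range n).map L).drop (u + 1)).flatten, by
      rw [← List.flatten_append, List.take_append_drop]⟩
  have h2 := h.entries
  rw [← hR] at h2
  rw [h.offset u hu.le, h2 _ (by simp; omega)]
  rw [List.getElem_append_left (by simp; omega), List.getElem_append_right (by omega)]
  simp

theorem AdjAt.frame {n : ℕ} {L : ℕ → List ℕ} {σ σ' : State} {p : Prog} (h : AdjAt n L σ)
    (hF : Frame p σ σ') (h0 : p.keepsArr 0 = true) (h1 : p.keepsArr 1 = true) : AdjAt n L σ' :=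
  ⟨by rw [hF.arrs 0 h0]; exact h.offset, by rw [hF.arrs 1 h1]; exact h.entries⟩

/-- Process the vertices in the queue, stored in the array `3`, the length of which is in the
variable `19`. Run `body` for each edge leaving the vertex, with its ends in the variables `6` and
`7`. -/
def scan (body : Prog) : Prog :=
  .while (.lt (.var 20) (.var 19)) (block [.assign 6 (.read 3 (.var 20)),
    .assign 20 (.add (.var 20) (.const 1)), .assign 5 (.read 0 (.var 6)),
    .assign 9 (.add (.var 6) (.const 1)), .assign 21 (.read 0 (.var 9)),
    loop 5 (.var 21) (block [.assign 7 (.read 1 (.var 5)), body])])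

/-- The edges leaving the vertices in `D`. -/
def outEdges (L : ℕ → List ℕ) (D : List ℕ) : List (ℕ × ℕ) :=
  D.flatMap fun u => (L u).map (Prod.mk u)

theorem mem_outEdges {L : ℕ → List ℕ} {D : List ℕ} {e : ℕ × ℕ} :
    e ∈ outEdges L D ↔ e.1 ∈ D ∧ e.2 ∈ L e.1 := by
  obtain ⟨a, b⟩ := e
  simp only [outEdges, List.mem_flatMap, List.mem_map, Prod.mk.injEq]
  constructor
  · rintro ⟨u, hu, v, hv, rfl, rfl⟩
    exact ⟨hu, hv⟩
  · rintro ⟨h1, h2⟩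
    exact ⟨a, h1, b, h2, rfl, rfl⟩

theorem nodup_outEdges {L : ℕ → List ℕ} {D : List ℕ} (hD : D.Nodup) (hL : ∀ u ∈ D, (L u).Nodup) :
    (outEdges L D).Nodup := by
  rw [outEdges, List.nodup_flatMap]
  refine ⟨fun u hu => (hL u hu).map (Prod.mk_right_injective u), hD.imp fun {a b} hab => ?_⟩
  simp only [Function.onFun, List.disjoint_left, List.mem_map]
  rintro _ ⟨x, -, rfl⟩ ⟨y, -, h⟩
  exact hab (Prod.mk.inj h).1.symm

theorem outEdges_append {L : ℕ → List ℕ} {D : List ℕ} {u : ℕ} :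
    outEdges L (D ++ [u]) = outEdges L D ++ (L u).map (Prod.mk u) := by
  simp [outEdges]

/-- Common frame of topological sorting and breadth-first search. The invariant concerns the list S
of scanned edges and the queue Q, which only grows at its end; D is the part of Q already processed.
Queue entries are distinct, so each adjacency list is scanned at most once. The remaining time is
bounded by a sum of costs over the vertices outside D. -/
theorem wp_scan {B n c : ℕ} {L : ℕ → List ℕ} {body : Prog} {Q₀ : List ℕ} {σ : State}
    (I : List (ℕ × ℕ) → List ℕ → State → Prop)
    (hA : AdjAt n L σ) (hL : ∀ u < n, (L u).Nodup ∧ ∀ v ∈ L u, v < n) (hn : n < B)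
    (hM : ((List.range n).map L).flatten.length ≤ B)
    (hI : ∀ S Q σ x v, x ∈ [5, 6, 7, 9, 20, 21] → I S Q σ → I S Q (σ.setVar x v))
    (hQ : ∀ S Q σ, I S Q σ → ListAt (σ.arrs 3) Q ∧ σ.vars 19 = Q.length ∧ Q.Nodup ∧ ∀ v ∈ Q, v < n)
    (hkv : ([5, 6, 20, 21].all fun x => body.keepsVar x) = true)
    (hk0 : body.keepsArr 0 = true) (hk1 : body.keepsArr 1 = true)
    (h20 : σ.vars 20 = 0) (h0 : I [] Q₀ σ)
    (step : ∀ D u v S Q σ', D ++ [u] <+: Q → (∀ e ∈ S ++ [(u, v)], e.1 ∈ D ++ [u] ∧ e.2 ∈ L e.1) →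
      (S ++ [(u, v)]).Nodup → u < n → v < n → I S Q σ' →
      σ'.vars 6 = u → σ'.vars 7 = v →
      wp B body (fun σ'' τ => (∃ R, I (S ++ [(u, v)]) (Q ++ R) σ'') ∧ τ ≤ c) σ') :
    wp B (scan body) (fun σ' τ =>
      (∃ S Q, I S Q σ' ∧ S.Nodup ∧ ∀ e, e ∈ S ↔ e.1 ∈ Q ∧ e.2 ∈ L e.1) ∧
      τ ≤ (∑ v ∈ Finset.range n, ((L v).length * (c + 4) + 8)) + 1) σ := by
  simp only [List.all_cons, List.all_nil, Bool.and_true, Bool.and_eq_true] at hkv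
  obtain ⟨hk5, hk6, hk20, hk21⟩ := hkv
  set w : ℕ → ℕ := fun v => (L v).length * (c + 4) + 8 with hw
  refine wp.mono (wp_while (fun r σ' => ∃ D Q, D <+: Q ∧ σ'.vars 20 = D.length ∧
    I (outEdges L D) Q σ' ∧ r = ∑ v ∈ Finset.range n \ D.toFinset, w v)
    (r := ∑ v ∈ Finset.range n, w v) ⟨[], Q₀, List.nil_prefix, h20, h0, by simp⟩ ?_) ?_
  · rintro r σ' ⟨D, Q, hD, hD20, hI', rfl⟩ hF hb
    have hA' : AdjAt n L σ' := hA.frame hF (by simp [Prog.keepsArr, block, loop, hk0])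
      (by simp [Prog.keepsArr, block, loop, hk1])
    obtain ⟨q3, q19, qnd, qn⟩ := hQ _ _ _ hI'
    simp only [holds_lt, eval_var, hD20, q19] at hb
    obtain ⟨u, Q', rfl⟩ : ∃ u Q', Q = D ++ u :: Q' := by
      obtain ⟨Q', rfl⟩ := hD
      cases Q' with
      | nil => simp at hb
      | cons u Q' => exact ⟨u, Q', rfl⟩
    have hun : u < n := qn u (by simp)
    have huD : u ∉ D := by
      intro h
      rw [List.nodup_append] at qnd
      exact qnd.2.2 u h u (by simp) rfl
    have e3 : σ'.arrs 3 D.length = u := by rw [q3 _ (by simp)]; simp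
    have hlen : D.length ≤ n := by
      have h1 : D.Nodup := (List.nodup_append.1 qnd).1
      have h2 : D.toFinset ⊆ Finset.range n := fun x hx => by
        simpa using qn x (by simp at hx; simp [hx])
      simpa [List.toFinset_card_of_nodup h1] using Finset.card_le_card h2
    have hnext := hA'.next hun
    have hoff := hA'.offset_le (u := u + 1) hun
    have hDu : D ++ [u] <+: D ++ u :: Q' := ⟨Q', by simp⟩
    simp only [wp_block_cons, wp_read, wp_add, eval_var, eval_const, hD20, e3, setVar_vars,
      setVar_arrs, if_true, reduceIte, Nat.reduceEqDiff, hnext]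
    refine ⟨⟨by omega, by omega⟩, by omega, ⟨by omega, by omega⟩, by omega, ⟨by omega, by omega⟩, ?_⟩
    refine wp.mono (wp_loop (B := B) (m := σ'.arrs 0 u + (L u).length) (j₀ := σ'.arrs 0 u)
      (c := c + 2)
      (fun j σ'' => ∃ Q, D ++ [u] <+: Q ∧
        I (outEdges L D ++ ((L u).take (j - σ'.arrs 0 u)).map (Prod.mk u)) Q σ'')
      ?_ ?_ ?_ ?_ ?_ ?_ ?_) ?_
    · simp [Prog.keepsVar, block, hk5]
    · simp
    · omega
    · omega
    · intro σ'' hF''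
      rw [eval_var, hF''.vars 21 (by simp [loop, Prog.keepsVar, block, hk21])]
      simp
    · refine ⟨D ++ u :: Q', hDu, ?_⟩
      simp only [Nat.sub_self, List.take_zero, List.map_nil, List.append_nil]
      refine hI _ _ _ _ _ (by simp) (hI _ _ _ _ _ (by simp) (hI _ _ _ _ _ (by simp)
        (hI _ _ _ _ _ (by simp) (hI _ _ _ _ _ (by simp) hI'))))
    · rintro j σ'' hj1 hj2 hj5 ⟨Q, hQD, hIQ⟩ hF''
      obtain ⟨i, rfl⟩ : ∃ i, j = σ'.arrs 0 u + i := ⟨j - σ'.arrs 0 u, by omega⟩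
      have hi : i < (L u).length := by omega
      have e0 : σ''.arrs 1 = σ'.arrs 1 := by
        rw [hF''.arrs 1 (by simp [Prog.keepsArr, block, loop, hk1])]
        simp
      have e1 := hA'.entry hun hi
      have hv : (L u)[i] < n := (hL u hun).2 _ (List.getElem_mem hi)
      simp only [wp_block_cons, wp_block_nil, wp_read, eval_var, hj5, e0, e1]
      refine ⟨⟨by omega, by omega⟩, ?_⟩
      have h6 : σ''.vars 6 = u := by
        rw [hF''.vars 6 (by simp [loop, Prog.keepsVar, block, hk6])]
        simp
      have e2 : σ'.arrs 0 u + i + 1 - σ'.arrs 0 u = i + 1 := by omega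
      simp only [Nat.add_sub_cancel_left] at hIQ
      have e4 : outEdges L D ++ ((L u).take (i + 1)).map (Prod.mk u) =
          (outEdges L D ++ ((L u).take i).map (Prod.mk u)) ++ [(u, (L u)[i])] := by
        rw [← List.take_append_getElem hi]
        simp only [List.map_append, List.map_cons, List.map_nil, List.append_assoc]
      have hDnd : (D ++ [u]).Nodup := (hQ _ _ _ hIQ).2.2.1.sublist hQD.sublist
      have hsub : (outEdges L D ++ ((L u).take (i + 1)).map (Prod.mk u)).Sublist
          (outEdges L (D ++ [u])) := by
        rw [outEdges_append]
        exact (List.Sublist.refl _).append ((List.take_sublist _ _).map _)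
      refine (step D u (L u)[i] _ Q _ hQD ?_ ?_ hun hv (hI _ _ _ _ _ (by simp) hIQ)
        (by simpa using h6) (by simp)).mono ?_
      · rw [← e4]
        exact fun e he => mem_outEdges.1 (hsub.subset he)
      · rw [← e4]
        refine (nodup_outEdges hDnd fun x hx => (hL x ?_).1).sublist hsub
        exact (hQ _ _ _ hIQ).2.2.2 x (hQD.subset hx)
      · rintro σ₁ τ₁ ⟨⟨R, hR⟩, hτ₁⟩
        refine ⟨⟨Q ++ R, hQD.trans (List.prefix_append _ _), ?_⟩, by omega⟩
        rw [e2, e4]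
        exact hI _ _ _ _ _ (by simp) hR
    · rintro σ₁ τ₁ ⟨⟨Q, hQD, hIQ⟩, -, hτ₁, hF₁⟩
      rw [wp_block_nil]
      refine ⟨_, ⟨D ++ [u], Q, hQD, ?_, ?_, rfl⟩, ?_⟩
      · rw [hF₁.vars 20 (by simp [loop, Prog.keepsVar, block, hk20])]
        simp
      · rw [Nat.add_sub_cancel_left, List.take_length, ← outEdges_append] at hIQ
        exact hIQ
      -- The cost of processing u is exactly what u contributes to the budget.
      · have hmem : u ∈ Finset.range n \ D.toFinset := by simp [hun, huD]
        have : Finset.range n \ (D ++ [u]).toFinset = (Finset.range n \ D.toFinset).erase u := by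
          ext x
          simp
          tauto
        rw [this]
        have h2 := Finset.sum_erase_add _ w hmem
        rw [Nat.add_sub_cancel_left] at hτ₁
        have h3 : w u = (L u).length * (c + 4) + 8 := rfl
        have h4 : c + 2 + 2 = c + 4 := rfl
        rw [h4] at hτ₁
        omega
  · rintro σ' τ ⟨⟨r, ⟨D, Q, hD, hD20, hI', rfl⟩, hτ⟩, hb, hF⟩
    obtain ⟨q3, q19, qnd, qn⟩ := hQ _ _ _ hI'
    simp only [holds_lt, eval_var, hD20, q19, not_lt] at hb
    obtain rfl : D = Q := hD.eq_of_length_le hb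
    refine ⟨⟨_, D, hI', nodup_outEdges qnd fun x hx => (hL x (qn x hx)).1, fun e => mem_outEdges⟩,
      (Nat.le_add_right _ _).trans hτ⟩

theorem TopoSorted.snoc {E : List (ℕ × ℕ)} {a b : ℕ} (h : TopoSorted E) (hab : a ≠ b)
    (hb : ∀ e ∈ E, e.1 ≠ b) : TopoSorted (E ++ [(a, b)]) := by
  constructor
  · rw [List.pairwise_append]
    exact ⟨h.1, List.pairwise_singleton _ _, fun e he f hf => by
      rw [List.mem_singleton.1 hf]; exact hb e he⟩
  · intro e he
    rcases List.mem_append.1 he with he | he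
    · exact h.2 e he
    · rw [List.mem_singleton.1 he]
      exact hab

/-- The queue `Q` of distinct vertices is stored in the array `3`, and its length in the
variable `19`. -/
structure QueueAt (n : ℕ) (Q : List ℕ) (σ : State) : Prop where
  entries : ListAt (σ.arrs 3) Q
  length : σ.vars 19 = Q.length
  nodup : Q.Nodup
  lt : ∀ v ∈ Q, v < n

theorem QueueAt.congr {n : ℕ} {Q : List ℕ} {σ σ' : State} (h : QueueAt n Q σ)
    (ha : σ'.arrs 3 = σ.arrs 3) (hv : σ'.vars 19 = σ.vars 19) : QueueAt n Q σ' :=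
  ⟨by rw [ha]; exact h.entries, by rw [hv]; exact h.length, h.nodup, h.lt⟩

theorem length_le_of_nodup {n : ℕ} {Q : List ℕ} (h : Q.Nodup) (hQ : ∀ v ∈ Q, v < n) :
    Q.length ≤ n := by
  have h2 : Q.toFinset ⊆ Finset.range n := fun x hx => by simpa using hQ x (by simpa using hx)
  simpa [List.toFinset_card_of_nodup h] using Finset.card_le_card h2

/-- Append the vertex in the variable `7` to the queue. -/
def push : Prog := block [.store 3 (.var 19) (.var 7), .assign 19 (.add (.var 19) (.const 1))]

theorem wp_push {B n v : ℕ} {Q : List ℕ} {σ : State} (h : QueueAt n Q σ) (h7 : σ.vars 7 = v)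
    (hv : v < n) (hvQ : v ∉ Q) (hn : n < B) :
    wp B push (fun σ' τ => QueueAt n (Q ++ [v]) σ' ∧ τ ≤ 3) σ := by
  have := length_le_of_nodup h.nodup h.lt
  have hl := h.length
  simp [push, h7, hl]
  refine ⟨⟨by omega, by omega⟩, by omega, ?_, ?_, ?_, ?_⟩
  · simpa using h.entries.append v rfl
  · simp
  · exact h.nodup.append (by simp) (by simpa using hvQ)
  · simpa [or_imp, forall_and, hv] using h.lt

/-- The edges in `S` are stored in the arrays `4` and `5`, and their number in the variable `4`. -/
structure EmitAt (S : List (ℕ × ℕ)) (σ : State) : Prop where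
  entries : EdgesAt (σ.arrs 4) (σ.arrs 5) S
  length : σ.vars 4 = S.length

theorem EmitAt.congr {S : List (ℕ × ℕ)} {σ σ' : State} (h : EmitAt S σ)
    (ha : σ'.arrs 4 = σ.arrs 4) (hb : σ'.arrs 5 = σ.arrs 5) (hv : σ'.vars 4 = σ.vars 4) :
    EmitAt S σ' :=
  ⟨by rw [ha, hb]; exact h.entries, by rw [hv]; exact h.length⟩

/-- Append the edge with the ends in the variables `6` and `7` to the list of edges. -/
def emit : Prog := block [.store 4 (.var 4) (.var 6), .store 5 (.var 4) (.var 7),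
  .assign 4 (.add (.var 4) (.const 1))]

theorem wp_emit {B u v : ℕ} {S : List (ℕ × ℕ)} {σ : State} (h : EmitAt S σ) (h6 : σ.vars 6 = u)
    (h7 : σ.vars 7 = v) (hu : u ≤ B) (hv : v ≤ B) (hS : S.length < B) :
    wp B emit (fun σ' τ => EmitAt (S ++ [(u, v)]) σ' ∧ τ ≤ 4) σ := by
  have hl := h.length
  simp [emit, h6, h7, hl]
  refine ⟨⟨by omega, by omega⟩, ⟨by omega, by omega⟩, by omega, ?_, ?_⟩
  · simpa using h.entries.append (u, v) rfl
  · simp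

/-- Count the edges that enter each vertex in the array `2`. -/
def countIn : Prog :=
  block [.assign 10 (.read 0 (.var 0)), forLt 5 (.var 10) (block [.assign 7 (.read 1 (.var 5)),
    .assign 9 (.read 2 (.var 7)), .assign 9 (.add (.var 9) (.const 1)), .store 2 (.var 7) (.var 9)])]

theorem wp_countIn {B n : ℕ} {L : ℕ → List ℕ} {σ : State} (h0 : σ.vars 0 = n) (hA : AdjAt n L σ)
    (hL : ∀ u < n, ∀ v ∈ L u, v < n) (hB : n + ((List.range n).map L).flatten.length < B)
    (h2 : ∀ v, σ.arrs 2 v = 0) :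
    wp B countIn (fun σ' τ => (∀ v, σ'.arrs 2 v = ((List.range n).map L).flatten.count v) ∧
      τ ≤ ((List.range n).map L).flatten.length * 7 + 4) σ := by
  set A := ((List.range n).map L).flatten with hAdef
  have hoff : σ.arrs 0 n = A.length := by
    rw [hA.offset n le_rfl, List.take_of_length_le (by simp)]
  have hAn : ∀ v ∈ A, v < n := by
    intro v hv
    simp only [hAdef, List.mem_flatten, List.mem_map, List.mem_range] at hv
    obtain ⟨_, ⟨u, hu, rfl⟩, hv⟩ := hv
    exact hL u hu v hv
  simp only [countIn, wp_block_cons, wp_block_nil, wp_read, eval_var, h0, hoff]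
  refine ⟨⟨by omega, by omega⟩, ?_⟩
  refine wp.mono (wp_forLt (m := A.length) (c := 5)
    (fun j σ' => ∀ v, σ'.arrs 2 v = (A.take j).count v) (by rfl) (by omega) ?_ ?_ ?_) ?_
  · intro σ' hF
    rw [eval_var, hF.vars 10 rfl]
    simp
  · intro v
    simp [h2]
  · intro j σ' hj h5 hI hF
    have e1 : σ'.arrs 1 j = A[j] := by
      rw [hF.arrs 1 rfl]
      exact hA.entries j hj
    have hjn := hAn _ (List.getElem_mem hj)
    have hc : (A.take j).count A[j] ≤ j :=
      List.count_le_length.trans (by simp)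
    simp [h5, e1, hI]
    refine ⟨⟨by omega, by omega⟩, ⟨by omega, by omega⟩, by omega, ⟨by omega, by omega⟩, ?_⟩
    intro v
    rw [← List.take_append_getElem hj, List.count_append, Function.update_apply, hI]
    by_cases hv : v = A[j]
    · simp [hv]
    · simp [hv, Ne.symm hv]
  · rintro σ' τ ⟨hI, hτ, -⟩
    rw [List.take_length] at hI
    exact ⟨hI, by omega⟩

/-- Append the vertices that no edge enters to the queue. -/
def pushSources : Prog :=
  forLt 7 (.var 0) (block [.assign 9 (.read 2 (.var 7)), .ite (.eq (.var 9) (.const 0)) push .skip])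

theorem wp_pushSources {B n : ℕ} {σ : State} (h0 : σ.vars 0 = n) (hn : n < B)
    (hQ : QueueAt n [] σ) (h2 : ∀ v, σ.arrs 2 v ≤ B) :
    wp B pushSources (fun σ' τ => (∃ Q, QueueAt n Q σ' ∧ ∀ v, v ∈ Q ↔ v < n ∧ σ.arrs 2 v = 0) ∧
      τ ≤ n * 8 + 2) σ := by
  refine wp.mono (wp_forLt (m := n) (c := 6)
    (fun j σ' => ∃ Q, QueueAt n Q σ' ∧ ∀ v, v ∈ Q ↔ v < j ∧ σ.arrs 2 v = 0) (by rfl) hn.le ?_ ?_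
    ?_) ?_
  · intro σ' hF
    rw [eval_var, hF.vars 0 rfl, h0]
  · exact ⟨[], hQ.congr rfl (by simp), by simp⟩
  · rintro j σ' hj h7 ⟨Q, hQ', hmem⟩ hF
    have e2 : σ'.arrs 2 = σ.arrs 2 := hF.arrs 2 rfl
    have hb := h2 j
    simp only [wp_block_cons, wp_block_nil, wp_read, eval_var, h7, e2, wp_ite, holds_eq, eval_const,
      setVar_vars, if_true]
    refine ⟨⟨by omega, hb⟩, ?_⟩
    by_cases hz : σ.arrs 2 j = 0
    · rw [if_pos hz]
      refine (wp_push (B := B) (v := j) (hQ'.congr (by simp) (by simp)) (by simpa using h7) hj ?_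
        hn).mono ?_
      · rw [hmem]
        omega
      · rintro σ'' τ ⟨h, hτ⟩
        refine ⟨⟨_, h.congr (by simp) (by simp), fun v => ?_⟩, by omega⟩
        rw [List.mem_append, hmem, List.mem_singleton, Nat.lt_succ_iff_lt_or_eq]
        constructor
        · rintro (h | rfl)
          · exact ⟨.inl h.1, h.2⟩
          · exact ⟨.inr rfl, hz⟩
        · rintro ⟨h | rfl, h'⟩
          · exact .inl ⟨h, h'⟩
          · exact .inr rfl
    · rw [if_neg hz, wp_skip]
      refine ⟨⟨Q, hQ'.congr (by simp) (by simp), fun v => ?_⟩, by omega⟩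
      rw [hmem, Nat.lt_succ_iff_lt_or_eq]
      constructor
      · exact fun h => ⟨.inl h.1, h.2⟩
      · rintro ⟨h | rfl, h'⟩
        · exact ⟨h, h'⟩
        · exact absurd h' hz
  · rintro σ' τ ⟨h, hτ, -⟩
    exact ⟨h, hτ⟩

/-- Emit an edge, and append its end to the queue if all edges that enter it have been emitted. -/
def kahnBody : Prog :=
  block [emit, .assign 9 (.read 2 (.var 7)), .assign 9 (.sub (.var 9) (.const 1)),
    .store 2 (.var 7) (.var 9), .ite (.eq (.var 9) (.const 0)) push .skip]

/-- List the edges of an acyclic digraph in a sorted order. -/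
def kahn : Prog := block [countIn, pushSources, scan kahnBody]

/-! ### Topological sorting of the edges of a DAG -/

theorem map_snd_outEdges {L : ℕ → List ℕ} {D : List ℕ} :
    (outEdges L D).map Prod.snd = (D.map L).flatten := by
  simp [outEdges, List.flatMap_def, Function.comp_def]

theorem count_flatten {L : ℕ → List ℕ} {D : List ℕ} {v : ℕ} :
    (D.map L).flatten.count v = (outEdges L D).countP fun e => e.2 = v := by
  rw [← map_snd_outEdges, List.count, List.countP_map]
  refine List.countP_congr fun e _ => ?_
  simp

theorem length_outEdges {L : ℕ → List ℕ} {D : List ℕ} :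
    (outEdges L D).length = (D.map L).flatten.length := by
  rw [← map_snd_outEdges, List.length_map]

theorem sum_length {n : ℕ} {L : ℕ → List ℕ} :
    ∑ v ∈ Finset.range n, (L v).length = ((List.range n).map L).flatten.length := by
  rw [List.length_flatten, List.map_map]
  induction n with
  | zero => rfl
  | succ n ih => rw [Finset.sum_range_succ, ih, List.range_succ]; simp

/-- Array 2 holds the number of edges into a vertex not yet emitted, and the queue consists of the
vertices for which it is zero. When (u, v) is emitted, v is still outside the queue, while the tails
of all emitted edges are in it; so no emitted edge starts at v and the list stays sorted. -/
theorem wp_kahn {B n s t : ℕ} {L : ℕ → List ℕ} {σ : State} (h0 : σ.vars 0 = n) (hA : AdjAt n L σ)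
    (hL : ∀ u < n, (L u).Nodup ∧ ∀ v ∈ L u, v < n)
    (hB : n + ((List.range n).map L).flatten.length < B)
    (hG : (ofList n (outEdges L (List.range n)) s t).IsDAG) (h2 : ∀ v, σ.arrs 2 v = 0)
    (h4 : σ.vars 4 = 0) (h19 : σ.vars 19 = 0) (h20 : σ.vars 20 = 0) :
    wp B kahn (fun σ' τ => (∃ E, EmitAt E σ' ∧ TopoSorted E ∧ E.Nodup ∧
      ∀ e, e ∈ E ↔ e ∈ outEdges L (List.range n)) ∧
      τ ≤ 30 * (((List.range n).map L).flatten.length + n + 1)) σ := by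
  set A := outEdges L (List.range n) with hAdef
  have hlen := length_outEdges (L := L) (D := List.range n)
  rw [← hAdef] at hlen
  have hAnd : A.Nodup := nodup_outEdges List.nodup_range fun u hu => (hL u (List.mem_range.1 hu)).1
  have hAmem : ∀ e, e ∈ A ↔ e.1 < n ∧ e.2 ∈ L e.1 := fun e => by rw [hAdef, mem_outEdges]; simp
  rw [← hlen] at hB ⊢
  simp only [kahn, wp_block_cons, wp_block_nil]
  refine (wp_countIn h0 hA (fun u hu => (hL u hu).2) (hlen ▸ hB) h2).frame.mono ?_
  rintro σ₁ τ₁ ⟨⟨g2, hτ₁⟩, hF₁⟩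
  rw [← hlen] at hτ₁
  replace g2 : ∀ v, σ₁.arrs 2 v = A.countP fun e => e.2 = v := fun v => (g2 v).trans count_flatten
  have hcl : ∀ v, (A.countP fun e => decide (e.2 = v)) ≤ A.length := fun v => List.countP_le_length
  refine (wp_pushSources (n := n) ((hF₁.vars 0 rfl).trans h0) (by omega) ?_ fun v => ?_).frame.mono ?_
  · refine ⟨?_, ?_, List.nodup_nil, by simp⟩
    · intro i hi
      simp at hi
    · rw [hF₁.vars 19 rfl, h19]; rfl
  · have := hcl v
    rw [g2]
    omega
  rintro σ₂ τ₂ ⟨⟨⟨Q₀, hQ₀, hmem₀⟩, hτ₂⟩, hF₂⟩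
  refine wp.mono (wp_scan (n := n) (c := 13) (L := L) (Q₀ := Q₀) (fun S Q σ' =>
    QueueAt n Q σ' ∧ EmitAt S σ' ∧ TopoSorted S ∧
      (∀ v, σ'.arrs 2 v + S.countP (fun e => e.2 = v) = A.countP fun e => e.2 = v) ∧
      ∀ v, v ∈ Q ↔ v < n ∧ σ'.arrs 2 v = 0)
    ((hA.frame hF₁ rfl rfl).frame hF₂ rfl rfl) hL (by omega) (by omega) ?_ ?_ (by rfl) (by rfl)
    (by rfl) ?_ ?_ ?_) ?_
  · rintro S Q σ' x v hx ⟨a1, a2, a3, a4, a5⟩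
    simp only [List.mem_cons, List.not_mem_nil, or_false] at hx
    refine ⟨a1.congr rfl ?_, a2.congr rfl rfl ?_, a3, a4, a5⟩
    · rw [setVar_vars, if_neg (by omega)]
    · rw [setVar_vars, if_neg (by omega)]
  · rintro S Q σ' ⟨a1, -⟩
    exact ⟨a1.1, a1.2, a1.3, a1.4⟩
  · rw [hF₂.vars 20 rfl, hF₁.vars 20 rfl, h20]
  · refine ⟨hQ₀, ⟨?_, ?_⟩, ⟨List.Pairwise.nil, by simp⟩, ?_, ?_⟩
    · intro i hi
      simp at hi
    · rw [hF₂.vars 4 rfl, hF₁.vars 4 rfl, h4]; rfl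
    · intro v
      rw [hF₂.arrs 2 rfl, g2]
      simp
    · intro v
      rw [hF₂.arrs 2 rfl, hmem₀]
  · rintro D u v S Q σ' hDQ hS hSnd hu hv ⟨a1, a2, a3, a4, a5⟩ h6 h7
    have hSA : ∀ e ∈ S ++ [(u, v)], e ∈ A := fun e he =>
      (hAmem e).2 ⟨a1.lt _ (hDQ.subset (hS e he).1), (hS e he).2⟩
    have hsp := hSnd.subperm hSA
    have hcp := fun v => hsp.countP_le fun e => decide (e.2 = v)
    -- The edge (u, v) itself has not been emitted yet, so it is still counted.
    have hpos : σ'.arrs 2 v ≠ 0 := by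
      have h1 := hcp v
      have h2 := a4 v
      simp [List.countP_append] at h1
      omega
    have hvQ : v ∉ Q := fun h => hpos ((a5 v).1 h).2
    have hne : ∀ e ∈ S ++ [(u, v)], e.1 ≠ v := fun e he h => hvQ (h ▸ hDQ.subset (hS e he).1)
    have hlS : S.length < A.length := by
      have := hsp.length_le
      simp at this
      omega
    have hle : σ'.arrs 2 v ≤ A.length := by
      have := a4 v
      have := hcl v
      omega
    simp only [kahnBody, wp_block_cons, wp_block_nil]
    refine (wp_emit a2 h6 h7 (by omega) (by omega) (by omega)).frame.mono ?_
    rintro σ₃ τ₃ ⟨⟨b1, hτ₃⟩, hF₃⟩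
    have e7 : σ₃.vars 7 = v := (hF₃.vars 7 rfl).trans h7
    have e2 : σ₃.arrs 2 = σ'.arrs 2 := hF₃.arrs 2 rfl
    have c1 : QueueAt n Q σ₃ := a1.congr (hF₃.arrs 3 rfl) (hF₃.vars 19 rfl)
    have c3 : TopoSorted (S ++ [(u, v)]) :=
      TopoSorted.snoc a3 (hne (u, v) (by simp)) fun e he => hne e (by simp [he])
    have c4 : ∀ w, Function.update (σ'.arrs 2) v (σ'.arrs 2 v - 1) w +
        (S ++ [(u, v)]).countP (fun e => e.2 = w) = A.countP fun e => e.2 = w := by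
      intro w
      have := a4 w
      rw [Function.update_apply, List.countP_append]
      by_cases hw : w = v
      · subst hw
        simp
        omega
      · simpa [hw, Ne.symm hw] using this
    simp only [wp_read, wp_sub, wp_store, wp_ite, eval_var, eval_const, e7, e2, setVar_vars,
      holds_eq, if_true, Nat.reduceEqDiff, setArr_vars, if_false]
    refine ⟨⟨by omega, by omega⟩, by omega, ⟨by omega, by omega⟩, ?_⟩
    by_cases hz : σ'.arrs 2 v - 1 = 0
    · rw [if_pos hz]
      refine (wp_push (v := v) (c1.congr ?_ ?_) ?_ hv hvQ (by omega)).frame.mono ?_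
      · simp
      · simp
      · simpa using e7
      rintro σ₄ τ₄ ⟨⟨d1, hτ₄⟩, hF₄⟩
      have f2 := hF₄.arrs 2 rfl
      simp only [setArr_arrs, setVar_arrs, if_true, e2] at f2
      refine ⟨⟨[v], d1, b1.congr ?_ ?_ ?_, c3, ?_, ?_⟩, by omega⟩
      · rw [hF₄.arrs 4 rfl]; simp
      · rw [hF₄.arrs 5 rfl]; simp
      · rw [hF₄.vars 4 rfl]; simp
      · rw [f2]; exact c4
      · intro w
        rw [f2, Function.update_apply, List.mem_append, List.mem_singleton, a5]
        by_cases hw : w = v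
        · simp [hw, hz, hv]
        · simp [hw]
    · rw [if_neg hz, wp_skip]
      refine ⟨⟨[], ?_, b1.congr ?_ ?_ ?_, c3, ?_, ?_⟩, by omega⟩
      · rw [List.append_nil]
        exact c1.congr (by simp) (by simp)
      · simp
      · simp
      · simp
      · simp only [setArr_arrs, setVar_arrs, if_true, e2]
        exact c4
      · intro w
        simp only [setArr_arrs, setVar_arrs, if_true, e2]
        rw [Function.update_apply, List.append_nil, a5]
        by_cases hw : w = v
        · simp [hw, hz, hpos]
        · simp [hw]
  · rintro σ₃ τ₃ ⟨⟨S, Q, ⟨a1, a2, a3, a4, a5⟩, hSnd, hS⟩, hτ₃⟩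
    -- By acyclicity every vertex is queued eventually: if all predecessors of v have been queued,
    -- all edges into v have been emitted and the counter of v is zero.
    have hall : ∀ v, v < n → v ∈ Q := by
      intro v
      induction v using hG.wellFounded.induction with
      | _ v ih =>
        intro hv
        refine (a5 v).2 ⟨hv, ?_⟩
        have h1 : ∀ e ∈ A, e.2 = v → e ∈ S := by
          intro e he hev
          have he' := (hAmem e).1 he
          refine (hS e).2 ⟨ih e.1 ?_ he'.1, he'.2⟩
          rw [ofList_adj, ← hev]
          exact he
        have h2 : (A.countP fun e => decide (e.2 = v)) ≤ S.countP fun e => e.2 = v := by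
          rw [List.countP_eq_length_filter, List.countP_eq_length_filter]
          refine ((hAnd.filter _).subperm fun e he => ?_).length_le
          simp only [List.mem_filter, decide_eq_true_eq] at he ⊢
          exact ⟨h1 e he.1 he.2, he.2⟩
        have h3 := a4 v
        omega
    refine ⟨⟨S, a2, a3, hSnd, fun e => ?_⟩, ?_⟩
    · rw [hS, hAmem]
      exact ⟨fun h => ⟨a1.lt _ h.1, h.2⟩, fun h => ⟨hall _ h.1, h.2⟩⟩
    · rw [Finset.sum_add_distrib, ← Finset.sum_mul, sum_length, ← hlen] at hτ₃
      simp at hτ₃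
      omega

/-- The state of a breadth-first search from `s`: the queue `Q` contains the vertices found so far,
the edges in `S` have been scanned, and `f v` is one more than the distance of `v`, or zero if `v`
has not been found. -/
structure SearchState (s : ℕ) (f : ℕ → ℕ) (S : List (ℕ × ℕ)) (Q : List ℕ) : Prop where
  mem : ∀ v, v ∈ Q ↔ f v ≠ 0
  source : f s = 1
  sorted : Q.Pairwise fun a b => f a ≤ f b
  scanned : ∀ e ∈ S, f e.1 ≠ 0 ∧ f e.2 ≠ 0 ∧ f e.2 ≤ f e.1 + 1
  monotone : S.Pairwise fun e e' => f e.1 ≤ f e'.1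
  parent : ∀ v, f v ≠ 0 → v = s ∨ ∃ e ∈ S, e.2 = v ∧ f v = f e.1 + 1
  le_length : ∀ v, f v ≤ Q.length

/-! ### Breadth-first search -/

namespace SearchState

variable {s u v : ℕ} {f : ℕ → ℕ} {S : List (ℕ × ℕ)} {Q D : List ℕ}

theorem le_of_prefix (h : SearchState s f S Q) (hD : D ++ [u] <+: Q) {x : ℕ} (hx : x ∈ D ++ [u]) :
    f x ≤ f u := by
  have h1 := h.sorted.sublist hD.sublist
  rcases List.mem_append.1 hx with hx | hx
  · exact (List.pairwise_append.1 h1).2.2 x hx u (by simp)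
  · rw [List.mem_singleton.1 hx]

/-- Each found vertex other than s received its label along a scanned edge, whose tail precedes or
equals u in the queue and has label at most that of u. So the labels found while u is processed
never exceed f u + 1. -/
theorem le_succ (h : SearchState s f S Q) (hD : D ++ [u] <+: Q) (hS : ∀ e ∈ S, e.1 ∈ D ++ [u])
    {x : ℕ} (hx : f x ≠ 0) : f x ≤ f u + 1 := by
  rcases h.parent x hx with rfl | ⟨e, he, -, h2⟩
  · rw [h.source]
    omega
  · have := h.le_of_prefix hD (hS e he)
    omega

theorem scan_old (h : SearchState s f S Q) (hD : D ++ [u] <+: Q) (hS : ∀ e ∈ S, e.1 ∈ D ++ [u])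
    (hv : f v ≠ 0) : SearchState s f (S ++ [(u, v)]) Q where
  mem := h.mem
  source := h.source
  sorted := h.sorted
  scanned e he := by
    rcases List.mem_append.1 he with he | he
    · exact h.scanned e he
    · rw [List.mem_singleton.1 he]
      exact ⟨(h.mem u).1 (hD.subset (by simp)), hv, h.le_succ hD hS hv⟩
  monotone := by
    rw [List.pairwise_append]
    refine ⟨h.monotone, List.pairwise_singleton _ _, fun e he e' he' => ?_⟩
    rw [List.mem_singleton.1 he']
    exact h.le_of_prefix hD (hS e he)
  parent v hv := by
    rcases h.parent v hv with h | ⟨e, he, h⟩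
    · exact .inl h
    · exact .inr ⟨e, by simp [he], h⟩
  le_length := h.le_length

/-- The new label f u + 1 is at least every label in the queue, so the queue stays sorted. Scanned
edges have both ends labelled already, hence nothing said about them changes. The bound by the queue
length keeps the labels within the word size. -/
theorem scan_new (h : SearchState s f S Q) (hD : D ++ [u] <+: Q) (hS : ∀ e ∈ S, e.1 ∈ D ++ [u])
    (hv : f v = 0) :
    SearchState s (Function.update f v (f u + 1)) (S ++ [(u, v)]) (Q ++ [v]) := by
  have hu : f u ≠ 0 := (h.mem u).1 (hD.subset (by simp))
  have hold : ∀ x, f x ≠ 0 → Function.update f v (f u + 1) x = f x := by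
    intro x hx
    rw [Function.update_of_ne]
    rintro rfl
    exact hx hv
  have hnew : Function.update f v (f u + 1) v = f u + 1 := Function.update_self ..
  have hSf : ∀ e ∈ S, Function.update f v (f u + 1) e.1 = f e.1 ∧
      Function.update f v (f u + 1) e.2 = f e.2 := fun e he =>
    ⟨hold _ (h.scanned e he).1, hold _ (h.scanned e he).2.1⟩
  constructor
  · intro x
    rw [List.mem_append, List.mem_singleton, h.mem, Function.update_apply]
    by_cases hx : x = v
    · simp [hx]
    · simp [hx]
  · rw [hold s (by rw [h.source]; simp), h.source]
  · rw [List.pairwise_append]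
    refine ⟨h.sorted.imp_of_mem fun {a b} ha hb hab => ?_, List.pairwise_singleton _ _,
      fun x hx y hy => ?_⟩
    · rwa [hold a ((h.mem a).1 ha), hold b ((h.mem b).1 hb)]
    · rw [List.mem_singleton.1 hy, hnew, hold x ((h.mem x).1 hx)]
      exact h.le_succ hD hS ((h.mem x).1 hx)
  · intro e he
    rcases List.mem_append.1 he with he | he
    · rw [(hSf e he).1, (hSf e he).2]
      exact h.scanned e he
    · rw [List.mem_singleton.1 he]
      simp [hold u hu, hu]
  · rw [List.pairwise_append]
    refine ⟨h.monotone.imp_of_mem fun {a b} ha hb hab => ?_, List.pairwise_singleton _ _,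
      fun x hx y hy => ?_⟩
    · rwa [(hSf a ha).1, (hSf b hb).1]
    · rw [List.mem_singleton.1 hy, (hSf x hx).1, hold u hu]
      exact h.le_of_prefix hD (hS x hx)
  · intro x hx
    by_cases hxv : x = v
    · subst hxv
      exact .inr ⟨(u, x), by simp, rfl, by rw [hnew, hold u hu]⟩
    · rw [Function.update_of_ne hxv] at hx ⊢
      rcases h.parent x hx with h | ⟨e, he, h1, h2⟩
      · exact .inl h
      · exact .inr ⟨e, by simp [he], h1, by rw [(hSf e he).1, h2]⟩
  · intro x
    have h1 := h.le_length x
    have h2 := h.le_length u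
    rw [Function.update_apply, List.length_append, List.length_singleton]
    split_ifs <;> omega

/-- Edges are scanned in the order of the labels of their tails. If a selected edge started at the
head of a later one, its tail label would exceed that of the later edge by one. -/
theorem topoSorted (h : SearchState s f S Q) :
    TopoSorted (S.filter fun e => f e.2 = f e.1 + 1) := by
  constructor
  · refine (h.monotone.filter _).imp_of_mem fun {a b} ha hb hab hne => ?_
    have h1 : f b.2 = f b.1 + 1 := by simpa using List.of_mem_filter hb
    rw [hne] at hab
    omega
  · intro e he hne
    have h1 : f e.2 = f e.1 + 1 := by simpa using List.of_mem_filter he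
    rw [hne] at h1
    omega

end SearchState

/-- Record the distance of the end of an edge if it is new, and emit the edge if the distance
increases along it. -/
def searchBody : Prog :=
  block [.assign 9 (.read 2 (.var 7)), .assign 10 (.read 2 (.var 6)),
    .assign 10 (.add (.var 10) (.const 1)),
    .ite (.eq (.var 9) (.const 0)) (block [.store 2 (.var 7) (.var 10), push,
      .assign 9 (.atom (.var 10))]) .skip,
    .ite (.eq (.var 9) (.var 10)) emit .skip]

/-- List the edges along which the distance from the source increases in a sorted order. -/
def search : Prog :=
  block [.store 2 (.var 1) (.const 1), .store 3 (.const 0) (.var 1), .assign 19 (.atom (.const 1)),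
    scan searchBody]

/-- An edge is emitted when its head has the label of its tail plus one. Labels are never revised,
so the decision made when the edge is scanned remains correct. -/
theorem wp_search {B n s : ℕ} {L : ℕ → List ℕ} {σ : State} (h1 : σ.vars 1 = s)
    (hA : AdjAt n L σ) (hL : ∀ u < n, (L u).Nodup ∧ ∀ v ∈ L u, v < n) (hs : s < n)
    (hB : n + ((List.range n).map L).flatten.length + 1 < B) (h2 : ∀ v, σ.arrs 2 v = 0)
    (h4 : σ.vars 4 = 0) (h20 : σ.vars 20 = 0) :
    wp B search (fun σ' τ => (∃ (E : List (ℕ × ℕ)) (f : ℕ → ℕ), EmitAt E σ' ∧ TopoSorted E ∧ E.Nodup ∧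
      (∀ e, e ∈ E ↔ (e.1 < n ∧ e.2 ∈ L e.1) ∧ f e.1 ≠ 0 ∧ f e.2 = f e.1 + 1) ∧ f s = 1 ∧
      (∀ u < n, f u ≠ 0 → ∀ v ∈ L u, f v ≠ 0 ∧ f v ≤ f u + 1) ∧
      ∀ v, f v ≠ 0 → v = s ∨ ∃ u < n, v ∈ L u ∧ f u ≠ 0 ∧ f v = f u + 1) ∧
      τ ≤ 30 * (((List.range n).map L).flatten.length + n + 1)) σ := by
  set A := outEdges L (List.range n) with hAdef
  have hlen := length_outEdges (L := L) (D := List.range n)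
  rw [← hAdef] at hlen
  have hAmem : ∀ e, e ∈ A ↔ e.1 < n ∧ e.2 ∈ L e.1 := fun e => by rw [hAdef, mem_outEdges]; simp
  rw [← hlen] at hB ⊢
  simp only [search, wp_block_cons, wp_block_nil, wp_store, wp_atom, eval_const, eval_var, h1,
    setArr_vars]
  refine ⟨by omega, by omega, by omega, ?_⟩
  refine wp.mono (wp_scan (n := n) (c := 18) (L := L) (Q₀ := [s]) (fun S Q σ' =>
    QueueAt n Q σ' ∧ SearchState s (σ'.arrs 2) S Q ∧
      EmitAt (S.filter fun e => σ'.arrs 2 e.2 = σ'.arrs 2 e.1 + 1) σ')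
    ?_ hL (by omega) (by omega) ?_ ?_ (by rfl) (by rfl) (by rfl) ?_ ?_ ?_) ?_
  · exact ⟨by simpa using hA.offset, by simpa using hA.entries⟩
  · rintro S Q σ' x v hx ⟨a1, a2, a3⟩
    simp only [List.mem_cons, List.not_mem_nil, or_false] at hx
    refine ⟨a1.congr rfl ?_, a2, a3.congr rfl rfl ?_⟩
    · rw [setVar_vars, if_neg (by omega)]
    · rw [setVar_vars, if_neg (by omega)]
  · rintro S Q σ' ⟨a1, -⟩
    exact ⟨a1.1, a1.2, a1.3, a1.4⟩
  · simpa using h20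
  · refine ⟨⟨?_, by simp, by simp, by simpa using hs⟩, ?_, ⟨?_, by simpa using h4⟩⟩
    · intro i hi
      obtain rfl : i = 0 := by simpa using hi
      simp
    · constructor <;> simp [Function.update_apply, h2]
      intro v
      split_ifs <;> omega
    · intro i hi
      simp at hi
  · rintro D u v S Q σ' hDQ hS hSnd hu hv ⟨a1, a2, a3⟩ h6 h7
    set f := σ'.arrs 2 with hf
    have hQn := length_le_of_nodup a1.nodup a1.lt
    have hfB : ∀ x, f x ≤ n := fun x => (a2.le_length x).trans hQn
    have hS' : ∀ e ∈ S, e.1 ∈ D ++ [u] := fun e he => (hS e (by simp [he])).1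
    have hfu : f u ≠ 0 := (a2.mem u).1 (hDQ.subset (by simp))
    have hlS : (S.filter fun e => f e.2 = f e.1 + 1).length < B := by
      have h1 := (hSnd.subperm (l₂ := A) fun e he =>
        (hAmem e).2 ⟨a1.lt _ (hDQ.subset (hS e he).1), (hS e he).2⟩).length_le
      have h2 := List.length_filter_le (fun e : ℕ × ℕ => decide (f e.2 = f e.1 + 1)) S
      simp at h1
      omega
    have hfv := hfB v
    have hfu' := hfB u
    simp only [searchBody, wp_block_cons, wp_block_nil, wp_read, wp_add, eval_var, eval_const, h6,
      h7, setVar_vars, setVar_arrs, ← hf, if_true, Nat.reduceEqDiff, if_false]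
    refine ⟨⟨by omega, by omega⟩, ⟨by omega, by omega⟩, by omega, ?_⟩
    rw [wp_ite]
    simp only [holds_eq, eval_var, eval_const, setVar_vars, Nat.reduceEqDiff, if_false, if_true]
    by_cases hz : f v = 0
    · have hvQ : v ∉ Q := fun h => (a2.mem v).1 h hz
      rw [if_pos hz]
      simp only [wp_block_cons, wp_block_nil, wp_store, wp_atom, eval_var, setVar_vars,
        Nat.reduceEqDiff, if_false, if_true, h7]
      refine ⟨⟨by omega, by omega⟩, ?_⟩
      refine (wp_push (B := B) (v := v) (a1.congr (by simp) (by simp)) (by simpa using h7) hv hvQ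
        (by omega)).frame.mono ?_
      rintro σ₂ τ₂ ⟨⟨b1, hτ₂⟩, hF₂⟩
      have e10 : σ₂.vars 10 = f u + 1 := by rw [hF₂.vars 10 rfl]; simp
      have e2 : σ₂.arrs 2 = Function.update f v (f u + 1) := by
        rw [hF₂.arrs 2 rfl]; simp [hf]
      simp only [e10, wp_ite, holds_eq, eval_var, setVar_vars, if_true, Nat.reduceEqDiff, if_false]
      refine ⟨by omega, ?_⟩
      have c2 := a2.scan_new hDQ hS' hz
      -- Labelling v does not change the selection among the earlier edges, because none of them has
      -- v as an end.
      have hfil : (S ++ [(u, v)]).filter (fun e => Function.update f v (f u + 1) e.2 =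
          Function.update f v (f u + 1) e.1 + 1) =
          (S.filter fun e => f e.2 = f e.1 + 1) ++ [(u, v)] := by
        rw [List.filter_append]
        congr 1
        · refine List.filter_congr fun e he => ?_
          have h3 := a2.scanned e he
          have h4 : e.1 ≠ v := fun h => h3.1 (by rw [h, hz])
          have h5 : e.2 ≠ v := fun h => h3.2.1 (by rw [h, hz])
          rw [Function.update_of_ne h4, Function.update_of_ne h5]
        · have : u ≠ v := fun h => hfu (by rw [h, hz])
          simp [this]
      refine (wp_emit (u := u) (v := v) (S := S.filter fun e => f e.2 = f e.1 + 1)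
        (a3.congr ?_ ?_ ?_) ?_ ?_ (by omega) (by omega) hlS).frame.mono ?_
      · rw [setVar_arrs, hF₂.arrs 4 rfl]; simp
      · rw [setVar_arrs, hF₂.arrs 5 rfl]; simp
      · simp [hF₂.vars 4 rfl]
      · simp [hF₂.vars 6 rfl, h6]
      · simp [hF₂.vars 7 rfl, h7]
      rintro σ₃ τ₃ ⟨⟨d1, hτ₃⟩, hF₃⟩
      have e2' : σ₃.arrs 2 = Function.update f v (f u + 1) := by
        rw [hF₃.arrs 2 rfl, setVar_arrs, e2]
      refine ⟨⟨[v], b1.congr ?_ ?_, ?_, ?_⟩, by omega⟩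
      · rw [hF₃.arrs 3 rfl, setVar_arrs]
      · rw [hF₃.vars 19 rfl]; simp
      · rw [e2']; exact c2
      · rw [e2', hfil]; exact d1
    · rw [if_neg hz, wp_skip]
      have c2 := a2.scan_old hDQ hS' hz
      simp only [wp_ite, holds_eq, eval_var, setVar_vars, if_true, Nat.reduceEqDiff, if_false]
      by_cases he : f v = f u + 1
      · rw [if_pos he]
        refine (wp_emit (u := u) (v := v) (S := S.filter fun e => f e.2 = f e.1 + 1)
          (a3.congr ?_ ?_ ?_) ?_ ?_ (by omega) (by omega) hlS).frame.mono ?_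
        · simp
        · simp
        · simp
        · simp [h6]
        · simp [h7]
        rintro σ₃ τ₃ ⟨⟨d1, hτ₃⟩, hF₃⟩
        have e2' : σ₃.arrs 2 = f := by rw [hF₃.arrs 2 rfl]; simp [hf]
        refine ⟨⟨[], ?_, ?_, ?_⟩, by omega⟩
        · rw [List.append_nil]
          exact a1.congr (by rw [hF₃.arrs 3 rfl]; simp) (by rw [hF₃.vars 19 rfl]; simp)
        · rw [e2', List.append_nil]; exact c2
        · rw [e2', List.filter_append]
          simpa [he] using d1
      · rw [if_neg he, wp_skip]
        refine ⟨⟨[], ?_, ?_, ?_⟩, by omega⟩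
        · rw [List.append_nil]
          exact a1.congr (by simp) (by simp)
        · rw [List.append_nil]
          simpa [← hf] using c2
        · rw [List.filter_append]
          simpa [← hf, he] using a3.congr (by simp) (by simp) (by simp)
  · rintro σ₃ τ₃ ⟨⟨S, Q, ⟨a1, a2, a3⟩, hSnd, hS⟩, hτ₃⟩
    refine ⟨⟨_, σ₃.arrs 2, a3, a2.topoSorted, hSnd.filter _, fun e => ?_, a2.source, ?_, ?_⟩, ?_⟩
    · rw [List.mem_filter, hS, a2.mem, decide_eq_true_eq]
      constructor
      · rintro ⟨⟨h3, h4⟩, h5⟩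
        exact ⟨⟨a1.lt _ ((a2.mem _).2 h3), h4⟩, h3, h5⟩
      · rintro ⟨⟨-, h4⟩, h3, h5⟩
        exact ⟨⟨h3, h4⟩, h5⟩
    · intro u _ hu v hv
      exact (a2.scanned (u, v) ((hS _).2 ⟨(a2.mem u).2 hu, hv⟩)).2
    · intro v hv
      rcases a2.parent v hv with h | ⟨e, he, rfl, h⟩
      · exact .inl h
      · exact .inr ⟨e.1, a1.lt _ ((hS e).1 he).1, ((hS e).1 he).2, (a2.scanned e he).1, h⟩
    · rw [Finset.sum_add_distrib, ← Finset.sum_mul, sum_length, ← hlen] at hτ₃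
      simp at hτ₃
      omega

/-- Adjacency lists of natural numbers. -/
def natLists {n : ℕ} (L : Fin n → List (Fin n)) (u : ℕ) : List ℕ :=
  if h : u < n then (L ⟨u, h⟩).map Fin.val else []

/-! ### Transfer between graphs on `Fin n` and on natural numbers -/

section

variable {n : ℕ} {L : Fin n → List (Fin n)}

@[simp] theorem natLists_val (u : Fin n) : natLists L u = (L u).map Fin.val := by
  simp [natLists]

theorem map_natLists : (List.range n).map (natLists L) = (List.ofFn L).map (List.map Fin.val) := by
  refine List.ext_getElem (by simp) fun i h1 h2 => ?_
  have hi : i < n := by simpa using h1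
  simp [natLists, hi]

theorem flatten_natLists :
    ((List.range n).map (natLists L)).flatten = (List.ofFn L).flatten.map Fin.val := by
  rw [map_natLists, List.map_flatten]

theorem length_flatten_natLists :
    ((List.range n).map (natLists L)).flatten.length = ∑ v, (L v).length := by
  rw [flatten_natLists, List.length_map, List.length_flatten, List.map_ofFn, List.sum_ofFn]
  rfl

theorem init_adjAt (s t : Fin n) (k : ℕ) : AdjAt n (natLists L) (init L s t k) := by
  constructor
  · intro u _
    rw [map_natLists, ← List.map_take, ← List.map_flatten, List.length_map]
    rfl
  · intro i hi
    rw [flatten_natLists] at hi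
    simp only [init, flatten_natLists]
    rw [if_neg (by decide), if_true, List.getD_eq_getElem _ _ hi]

theorem natLists_spec (hL : ∀ v, (L v).Nodup) (u : ℕ) (hu : u < n) :
    (natLists L u).Nodup ∧ ∀ v ∈ natLists L u, v < n := by
  lift u to Fin n using hu
  rw [natLists_val]
  refine ⟨(hL u).map Fin.val_injective, fun v hv => ?_⟩
  obtain ⟨w, -, rfl⟩ := List.mem_map.1 hv
  exact w.2

theorem val_mem_natLists {u v : Fin n} : (v : ℕ) ∈ natLists L u ↔ v ∈ L u := by
  rw [natLists_val, List.mem_map_of_injective Fin.val_injective]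

theorem val_mem_outEdges {u v : Fin n} :
    ((u : ℕ), (v : ℕ)) ∈ outEdges (natLists L) (List.range n) ↔ v ∈ L u := by
  rw [mem_outEdges, val_mem_natLists]
  simp

theorem mem_outEdges_natLists {e : ℕ × ℕ} (he : e ∈ outEdges (natLists L) (List.range n)) :
    ∃ u v : Fin n, e = (↑u, ↑v) := by
  obtain ⟨a, b⟩ := e
  rw [mem_outEdges, List.mem_range] at he
  obtain ⟨ha, hb⟩ := he
  simp only at ha hb
  lift a to Fin n using ha
  rw [natLists_val] at hb
  obtain ⟨v, -, rfl⟩ := List.mem_map.1 hb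
  exact ⟨a, v, rfl⟩

end

/-- Tracking sets for a family of paths through the vertices `0, …, n - 1`. -/
theorem isYes_iff_of_paths {n k : ℕ} {H : STDigraph ℕ} (hH : H.verts = Finset.range n) {ι : Type*}
    (supp : ι → List (Fin n)) (hinj : Function.Injective supp)
    (hpaths : ∀ l, l ∈ H.paths ↔ ∃ i, (supp i).map Fin.val = l) :
    H.IsYes k ↔ ∃ T : Finset (Fin n),
      (∀ i j, (∀ v ∈ T, v ∈ supp i ↔ v ∈ supp j) → i = j) ∧ T.card ≤ k := by
  have hval : ∀ (i : ι) (v : Fin n), (v : ℕ) ∈ (supp i).map Fin.val ↔ v ∈ supp i := fun i v =>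
    List.mem_map_of_injective Fin.val_injective
  constructor
  · rintro ⟨T, hT, hTk⟩
    rw [isTrackingSet_iff, hH] at hT
    refine ⟨Finset.univ.filter fun v => (v : ℕ) ∈ T, fun i j h => ?_, ?_⟩
    · refine hinj (List.map_injective_iff.2 Fin.val_injective (hT.2 _ ((hpaths _).2 ⟨i, rfl⟩) _
        ((hpaths _).2 ⟨j, rfl⟩) fun v hv => ?_))
      have hvn := Finset.mem_range.1 (hT.1 hv)
      lift v to Fin n using hvn
      rw [hval, hval]
      exact h v (by simpa using hv)
    · refine le_trans ?_ hTk
      rw [← Finset.card_map Fin.valEmbedding]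
      refine Finset.card_le_card fun x hx => ?_
      obtain ⟨v, hv, rfl⟩ := Finset.mem_map.1 hx
      simpa using hv
  · rintro ⟨T, hT, hTk⟩
    refine ⟨T.map Fin.valEmbedding, ?_, by rwa [Finset.card_map]⟩
    rw [isTrackingSet_iff, hH]
    constructor
    · intro x hx
      obtain ⟨v, -, rfl⟩ := Finset.mem_map.1 hx
      simp
    · intro P₁ h₁ P₂ h₂ h
      obtain ⟨i, rfl⟩ := (hpaths _).1 h₁
      obtain ⟨j, rfl⟩ := (hpaths _).1 h₂
      rw [hT i j fun v hv => ?_]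
      have := h v (Finset.mem_map_of_mem _ hv)
      rwa [hval, hval] at this

/-- The digraph on `0, …, n - 1` given by a list of edges is the digraph that it lists. -/
theorem ofList_isYes_iff {n k : ℕ} {G : STDigraph (Fin n)} (hG : G.verts = Finset.univ)
    {E : List (ℕ × ℕ)} (hE : ∀ u v : Fin n, ((u : ℕ), (v : ℕ)) ∈ E ↔ (u, v) ∈ G.edges) :
    (ofList n E G.s G.t).IsYes k ↔ G.IsYes k := by
  rw [isYes_iff_of_paths (n := n) rfl (fun P : G.paths => P.1) Subtype.val_injective]
  · constructor
    · rintro ⟨T, hT, hTk⟩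
      refine ⟨T, isTrackingSet_iff.2 ⟨hG ▸ Finset.subset_univ T, fun P₁ h₁ P₂ h₂ h => ?_⟩, hTk⟩
      exact congrArg Subtype.val (hT ⟨P₁, h₁⟩ ⟨P₂, h₂⟩ h)
    · rintro ⟨T, hT, hTk⟩
      exact ⟨T, fun P₁ P₂ h => Subtype.ext ((isTrackingSet_iff.1 hT).2 _ P₁.2 _ P₂.2 h), hTk⟩
  · have key : ∀ l : List (Fin n), l.map Fin.val ∈ (ofList n E G.s G.t).paths ↔ l ∈ G.paths := by
      intro l
      have hchain : (l.map Fin.val).IsChain (fun a b => (a, b) ∈ (ofList n E G.s G.t).edges) ↔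
          l.IsChain fun a b => (a, b) ∈ G.edges := by
        rw [List.isChain_map]
        simp [ofList, hE]
      constructor
      · intro h
        refine ⟨?_, ?_, fun x _ => hG ▸ Finset.mem_univ x, List.Nodup.of_map _ h.nodup,
          hchain.1 h.chain⟩
        · have := h.head_eq
          rw [List.head?_map] at this
          exact Option.map_injective Fin.val_injective this
        · have := h.last_eq
          rw [List.getLast?_map] at this
          exact Option.map_injective Fin.val_injective this
      · intro h
        refine ⟨?_, ?_, ?_, h.nodup.map Fin.val_injective, hchain.2 h.chain⟩
        · rw [List.head?_map, h.head_eq]; rfl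
        · rw [List.getLast?_map, h.last_eq]; rfl
        · intro x hx
          obtain ⟨v, -, rfl⟩ := List.mem_map.1 hx
          simp [ofList]
    intro l
    constructor
    · intro h
      have hl : ∀ x ∈ l, x < n := fun x hx => by simpa [ofList] using h.mem_verts x hx
      lift l to List (Fin n) using hl
      exact ⟨⟨l, (key l).1 h⟩, rfl⟩
    · rintro ⟨P, rfl⟩
      exact (key _).2 P.2

theorem ofList_outEdges_isDAG {n : ℕ} {G : STDigraph (Fin n)} (hG : G.IsDAG)
    {L : Fin n → List (Fin n)} (hL : ∀ v w, w ∈ L v ↔ (v, w) ∈ G.edges) :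
    (ofList n (outEdges (natLists L) (List.range n)) G.s G.t).IsDAG := by
  have key : ∀ a b, TransGen (fun a b => (a, b) ∈ outEdges (natLists L) (List.range n)) a b →
      ∃ u v : Fin n, a = u ∧ b = v ∧ TransGen (fun a b => (a, b) ∈ G.edges) u v := by
    intro a b h
    induction h with
    | single h =>
      obtain ⟨u, v, e⟩ := mem_outEdges_natLists h
      obtain ⟨rfl, rfl⟩ := Prod.mk.inj e
      exact ⟨u, v, rfl, rfl, .single ((hL u v).1 (val_mem_outEdges.1 h))⟩
    | tail _ h ih =>
      obtain ⟨u, v, rfl, rfl, h1⟩ := ih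
      obtain ⟨v', w, e⟩ := mem_outEdges_natLists h
      obtain ⟨e1, rfl⟩ := Prod.mk.inj e
      obtain rfl := Fin.val_injective e1
      exact ⟨u, w, rfl, rfl, h1.tail ((hL v w).1 (val_mem_outEdges.1 h))⟩
  constructor
  · simp [ofList]
  · simp [ofList]
  · intro e he
    obtain ⟨u, v, rfl⟩ := mem_outEdges_natLists (by simpa [ofList] using he)
    simp [ofList]
  · intro v h
    have h' : TransGen (fun a b => (a, b) ∈ outEdges (natLists L) (List.range n)) v v := by
      simpa [ofList] using h
    obtain ⟨u, w, rfl, e, h1⟩ := key v v h'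
    obtain rfl := Fin.val_injective e
    exact hG.acyclic _ h1

theorem sum_length_eq_card_edges {n : ℕ} {G : STDigraph (Fin n)} {L : Fin n → List (Fin n)}
    (hL : ∀ v, (L v).Nodup ∧ ∀ w, w ∈ L v ↔ (v, w) ∈ G.edges) :
    ∑ v, (L v).length = G.edges.card := by
  rw [Finset.card_eq_sum_card_fiberwise (f := Prod.fst) (t := Finset.univ) (by simp)]
  refine Finset.sum_congr rfl fun v _ => ?_
  rw [← List.toFinset_card_of_nodup (hL v).1, ← Finset.card_map (Function.Embedding.sectR v _)]
  congr 1
  ext ⟨a, b⟩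
  simp only [Finset.mem_map, List.mem_toFinset, (hL v).2, Finset.mem_filter,
    Function.Embedding.sectR_apply, Prod.mk.injEq]
  constructor
  · rintro ⟨w, h, rfl, rfl⟩
    exact ⟨h, rfl⟩
  · rintro ⟨h, rfl⟩
    exact ⟨b, h, rfl, rfl⟩

theorem sum_length_eq_two_mul {n : ℕ} {G : SimpleGraph (Fin n)} {L : Fin n → List (Fin n)}
    (hL : ∀ v, (L v).Nodup ∧ ∀ w, w ∈ L v ↔ G.Adj v w) :
    ∑ v, (L v).length = 2 * G.edgeSet.ncard := by
  classical
  rw [Set.ncard_eq_toFinset_card', Set.toFinset_card, ← SimpleGraph.edgeFinset_card,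
    ← G.sum_degrees_eq_twice_card_edges]
  refine Finset.sum_congr rfl fun v _ => ?_
  rw [← List.toFinset_card_of_nodup (hL v).1, SimpleGraph.degree]
  congr 1
  ext w
  simp [(hL v).2]

/-! ### Shortest paths and search labels -/

section

variable {n : ℕ} {G : SimpleGraph (Fin n)} {f : Fin n → ℕ}

theorem walk_label_le (hf : ∀ u v, G.Adj u v → f u ≠ 0 → f v ≠ 0 ∧ f v ≤ f u + 1) {u v : Fin n}
    (p : G.Walk u v) (hu : f u ≠ 0) : f v ≠ 0 ∧ f v ≤ f u + p.length := by
  induction p with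
  | nil => exact ⟨hu, le_rfl⟩
  | cons h p ih =>
    have h1 := hf _ _ h hu
    have h2 := ih h1.1
    rw [SimpleGraph.Walk.length_cons]
    exact ⟨h2.1, by omega⟩

/-- A label grows by at most one per edge. If the total growth along a walk equals its length, it
grows by exactly one on every edge. -/
theorem isChain_support_of_label (hf : ∀ u v, G.Adj u v → f u ≠ 0 → f v ≠ 0 ∧ f v ≤ f u + 1)
    {u v : Fin n} (p : G.Walk u v) (hu : f u ≠ 0) (h : f v = f u + p.length) :
    p.support.IsChain fun a b => G.Adj a b ∧ f a ≠ 0 ∧ f b = f a + 1 := by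
  induction p with
  | nil => simp
  | @cons a b c hab p ih =>
    have h1 := hf _ _ hab hu
    have h2 := walk_label_le hf p h1.1
    rw [SimpleGraph.Walk.length_cons] at h
    rw [SimpleGraph.Walk.support_cons, ← SimpleGraph.Walk.cons_tail_support p, List.isChain_cons_cons,
      SimpleGraph.Walk.cons_tail_support]
    exact ⟨⟨hab, hu, by omega⟩, ih h1.1 (by omega)⟩

theorem exists_walk_of_isChain {l : List (Fin n)} {u v : Fin n} (hu : l.head? = some u)
    (hv : l.getLast? = some v)
    (h : l.IsChain fun a b => G.Adj a b ∧ f a ≠ 0 ∧ f b = f a + 1) :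
    ∃ p : G.Walk u v, p.support = l ∧ f v = f u + p.length := by
  induction l generalizing u with
  | nil => simp at hu
  | cons a l ih =>
    obtain rfl : a = u := by simpa using hu
    cases l with
    | nil =>
      obtain rfl : a = v := by simpa using hv
      exact ⟨.nil, by simp⟩
    | cons b l =>
      rw [List.isChain_cons_cons] at h
      obtain ⟨p, h1, h2⟩ := ih (u := b) (by simp) (by simpa using hv) h.2
      refine ⟨.cons h.1.1 p, by simp [h1], ?_⟩
      rw [SimpleGraph.Walk.length_cons, h2, h.1.2.2]
      omega

/-- Parents have a label smaller by one, so following them backwards leads to s in f v - 1 steps. -/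
theorem exists_walk_of_label {s : Fin n} (hs : f s = 1)
    (hf : ∀ v, f v ≠ 0 → v = s ∨ ∃ u, G.Adj u v ∧ f u ≠ 0 ∧ f v = f u + 1) {v : Fin n}
    (hv : f v ≠ 0) : ∃ p : G.Walk s v, f v = 1 + p.length := by
  induction hm : f v generalizing v with
  | zero => exact (hv hm).elim
  | succ m ih =>
    rcases hf v hv with rfl | ⟨u, huv, hu, e⟩
    · exact ⟨.nil, by rw [← hm, hs]; rfl⟩
    · obtain ⟨p, hp⟩ := ih hu (by omega)
      refine ⟨p.concat huv, ?_⟩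
      rw [SimpleGraph.Walk.length_concat]
      omega

end

/-- A walk from s along label-increasing edges has length f t - 1, which is the distance of t;
conversely a shortest walk must increase the label on each edge. So the s-t paths of the listed
digraph are exactly the supports of the shortest paths, and both problems track the same family. -/
theorem ofList_isYes_iff_shortest {n k : ℕ} {G : SimpleGraph (Fin n)} {s t : Fin n} {f : Fin n → ℕ}
    {E : List (ℕ × ℕ)} (hs : f s = 1)
    (h1 : ∀ u v, G.Adj u v → f u ≠ 0 → f v ≠ 0 ∧ f v ≤ f u + 1)
    (h2 : ∀ v, f v ≠ 0 → v = s ∨ ∃ u, G.Adj u v ∧ f u ≠ 0 ∧ f v = f u + 1)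
    (hE : ∀ u v : Fin n, ((u : ℕ), (v : ℕ)) ∈ E ↔ G.Adj u v ∧ f u ≠ 0 ∧ f v = f u + 1)
    (hE' : ∀ e ∈ E, e.1 < n ∧ e.2 < n) (hsort : TopoSorted E) :
    (ofList n E s t).IsYes k ↔ IsShortestYes G s t k := by
  have hs0 : f s ≠ 0 := by omega
  -- A shortest walk bounds the label from above, and the walk along parents bounds the distance by
  -- the label.
  have hdist : f t ≠ 0 → f t = f s + G.dist s t := by
    intro ht
    obtain ⟨p, hp⟩ := exists_walk_of_label hs h2 ht
    obtain ⟨q, hq⟩ := p.reachable.exists_walk_length_eq_dist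
    have := (walk_label_le h1 q hs0).2
    have := SimpleGraph.dist_le p
    omega
  have hDAG := ofList_isDAG (s := s) (t := t) s.2 t.2 hE' hsort
  rw [isYes_iff_of_paths (n := n) rfl
    (fun P : {p : G.Walk s t // p.IsPath ∧ p.length = G.dist s t} => P.1.support)
    fun P₁ P₂ h => Subtype.ext (SimpleGraph.Walk.support_injective h)]
  · refine exists_congr fun T => and_congr_left fun _ => ?_
    have key : ∀ P₁ P₂ : G.Walk s t, (∀ v ∈ T, v ∈ P₁.support ↔ v ∈ P₂.support) ↔
        T ∩ P₁.support.toFinset = T ∩ P₂.support.toFinset := by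
      intro P₁ P₂
      simp only [Finset.ext_iff, Finset.mem_inter, List.mem_toFinset, and_congr_right_iff]
    constructor
    · intro h P₁ P₂ a1 a2 b1 b2 hne e
      exact hne (congrArg Subtype.val (h ⟨P₁, a1, a2⟩ ⟨P₂, b1, b2⟩ ((key _ _).2 e)))
    · intro h P₁ P₂ e
      by_contra hne
      exact h P₁.1 P₂.1 P₁.2.1 P₁.2.2 P₂.2.1 P₂.2.2 (fun e => hne (Subtype.ext e)) ((key _ _).1 e)
  · have hchain : ∀ l : List (Fin n),
        (l.map Fin.val).IsChain (fun a b => (a, b) ∈ (ofList n E s t).edges) ↔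
          l.IsChain fun a b => G.Adj a b ∧ f a ≠ 0 ∧ f b = f a + 1 := by
      intro l
      rw [List.isChain_map]
      simp [ofList, hE]
    intro l
    constructor
    · intro h
      have hl : ∀ x ∈ l, x < n := fun x hx => by simpa [ofList] using h.mem_verts x hx
      lift l to List (Fin n) using hl
      have hh := h.head_eq
      have hg := h.last_eq
      rw [List.head?_map] at hh
      rw [List.getLast?_map] at hg
      obtain ⟨p, hp, hlen⟩ := exists_walk_of_isChain (Option.map_injective Fin.val_injective hh)
        (Option.map_injective Fin.val_injective hg) ((hchain l).1 h.chain)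
      have := hdist (by omega)
      refine ⟨⟨p, ?_, by omega⟩, by rw [hp]⟩
      rw [SimpleGraph.Walk.isPath_def, hp]
      exact List.Nodup.of_map _ h.nodup
    · rintro ⟨⟨p, -, hp⟩, rfl⟩
      have ht := (walk_label_le h1 p hs0).1
      refine hDAG.isPath (by simp [ofList]) ?_ ?_ ((hchain _).2 (isChain_support_of_label h1 p hs0 ?_))
      · rw [List.head?_map, ← SimpleGraph.Walk.cons_tail_support]; rfl
      · rw [List.getLast?_map, List.getLast?_eq_some_getLast p.support_ne_nil,
          SimpleGraph.Walk.getLast_support]; rfl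
      · rw [hp]
        exact hdist ht

/-! ### Composition of the programs and the final bounds -/

theorem wp.decidesWithin {B τ₀ : ℕ} {p : Prog} {σ : State} {P : Prop} {a : ℕ}
    (h : wp B p (fun σ' τ => σ'.vars 0 = a ∧ τ ≤ τ₀) σ) (h1 : P → a = 1) (h0 : ¬ P → a = 0) :
    DecidesWithin p B σ P τ₀ := by
  obtain ⟨σ', τ, he, ha, hτ⟩ := h
  exact ⟨σ', τ, he, hτ, fun h => ha.trans (h1 h), fun h => ha.trans (h0 h)⟩

/-- A program that lists the edges of a suitable digraph in a sorted order, followed by the decision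
procedure for sorted lists of edges. -/
theorem decidesWithin_of_sorted {n m M k : ℕ} {L : Fin n → List (Fin n)} {s t : Fin n} {P : Prop}
    {p : Prog} (hM : M ≤ 2 * m)
    (hp : wp ((n + m + k + 2) ^ 5000) p (fun σ' τ => (∃ E, EmitAt E σ' ∧ TopoSorted E ∧ E.Nodup ∧
      (∀ e ∈ E, e.1 < n ∧ e.2 < n) ∧ E.length ≤ M ∧ ((ofList n E s t).IsYes k ↔ P)) ∧
      τ ≤ 30 * (M + n + 1)) (init L s t k))
    (hv : ([0, 1, 2, 3].all fun x => p.keepsVar x) = true) (ha : ∀ A, 6 ≤ A → p.keepsArr A = true) :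
    DecidesWithin (block [p, decideSorted]) ((n + m + k + 2) ^ 5000) (init L s t k) P
      (5000 * (2 ^ (k ^ 2 + 3 * k) * (max k 1) ^ 2 * (m + n))) := by
  classical
  simp only [List.all_cons, List.all_nil, Bool.and_true, Bool.and_eq_true] at hv
  obtain ⟨v0, v1, v2, v3⟩ := hv
  have hn : 0 < n := s.pos
  -- A vertex exists, so n + m + k + 2 ≥ 3 and three further factors give 27. Linear room suffices
  -- for the second phase, which needs 9(n + |E| + k + 2) with |E| ≤ 2m.
  have hB : 27 * (n + m + k + 2) ≤ (n + m + k + 2) ^ 5000 := by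
    calc 27 * (n + m + k + 2) ≤ (n + m + k + 2) ^ 3 * (n + m + k + 2) := by
          refine Nat.mul_le_mul_right _ ?_
          calc 27 = 3 ^ 3 := by norm_num
            _ ≤ _ := Nat.pow_le_pow_left (by omega) 3
      _ = (n + m + k + 2) ^ 4 := by ring
      _ ≤ _ := Nat.pow_le_pow_right (by omega) (by norm_num)
  generalize (n + m + k + 2) ^ 5000 = B at hp hB ⊢
  set W := 2 ^ (k ^ 2 + 3 * k) * (max k 1) ^ 2 with hW
  have hW1 : 1 ≤ W := Nat.mul_pos Nat.one_le_two_pow (pow_pos (lt_max_of_lt_right one_pos) 2)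
  refine wp.decidesWithin (a := if P then 1 else 0) ?_ (fun h => if_pos h) (fun h => if_neg h)
  simp only [wp_block_cons, wp_block_nil]
  refine hp.frame.mono ?_
  rintro σ₁ τ₁ ⟨⟨⟨E, h1, h2, h3, h4, h5, h6⟩, hτ₁⟩, hF⟩
  refine wp.mono (wp_decideSorted (n := n) (s := s) (t := t) (k := k) (E := E)
    ⟨(hF.vars 0 v0).trans ?_, (hF.vars 1 v1).trans ?_, (hF.vars 2 v2).trans ?_,
      (hF.vars 3 v3).trans ?_, h1.length, h1.entries, s.2, t.2, h4, h2, h3, by omega⟩ ?_) ?_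
  · rfl
  · rfl
  · rfl
  · rfl
  · intro A hA v
    rw [hF.arrs A (ha A hA)]
    simp only [init]
    rw [if_neg (by omega), if_neg (by omega)]
  · rintro σ₂ τ₂ ⟨g0, hτ₂⟩
    rw [← hW] at hτ₂
    refine ⟨g0.trans (if_congr h6 rfl rfl), ?_⟩
    -- The list may have 2m entries, since each undirected edge occurs twice in the adjacency lists;
    -- this doubles the constant of the second phase.
    have t1 : W * (E.length + n) ≤ W * (2 * m + n) := Nat.mul_le_mul_left _ (by omega)
    have t2 : 2 * m + n ≤ W * (2 * m + n) := Nat.le_mul_of_pos_left _ hW1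
    have t3 : W * (2 * m + n) = 2 * (W * m) + W * n := by ring
    have t4 : W * (m + n) = W * m + W * n := by ring
    have t5 : n ≤ W * n := Nat.le_mul_of_pos_left _ hW1
    have t6 : m ≤ W * m := Nat.le_mul_of_pos_left _ hW1
    omega

end RAM

theorem mainTheorem1 (α : Type*) [DecidableEq α] :
    -- tracking all `s`-`t` paths in directed acyclic graphs
    (∃ (p : RAM.Prog) (C : ℕ), ∀ (n : ℕ) (G : STDigraph (Fin n)) (L : Fin n → List (Fin n)) (k : ℕ),
      G.IsDAG → G.verts = Finset.univ →
      (∀ v, (L v).Nodup ∧ ∀ w, w ∈ L v ↔ (v, w) ∈ G.edges) →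
      RAM.DecidesWithin p ((n + G.edges.card + k + 2) ^ C) (RAM.init L G.s G.t k) (G.IsYes k)
        (C * (2 ^ (k ^ 2 + 3 * k) * (max k 1) ^ 2 * (G.edges.card + n)))) ∧
    -- tracking shortest `s`-`t` paths in undirected graphs
    (∃ (p : RAM.Prog) (C : ℕ), ∀ (n : ℕ) (G : SimpleGraph (Fin n)) (s t : Fin n)
      (L : Fin n → List (Fin n)) (k : ℕ),
      (∀ v, (L v).Nodup ∧ ∀ w, w ∈ L v ↔ G.Adj v w) →
      RAM.DecidesWithin p ((n + G.edgeSet.ncard + k + 2) ^ C) (RAM.init L s t k)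
        (IsShortestYes G s t k)
        (C * (2 ^ (k ^ 2 + 3 * k) * (max k 1) ^ 2 * (G.edgeSet.ncard + n)))) ∧
    -- a tracking set has at least `lg p` elements, where `p` is the number of `s`-`t` paths
    (∀ G : STDigraph α, G.IsDAG → ∀ T : Finset α, G.IsTrackingSet T →
      Real.logb 2 (G.paths.ncard : ℝ) ≤ (T.card : ℝ)) ∧
    -- the reduction rules
    (∀ G : STDigraph α, G.IsDAG →
      (∃ G', Relation.ReflTransGen STDigraph.Step G G' ∧ G'.IsReduced) ∧
      ∀ G', Relation.ReflTransGen STDigraph.Step G G' → G'.IsReduced →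
        G'.IsDAG ∧
        (∀ k, G.IsYes k ↔ G'.IsYes k) ∧
        (G'.paths.Nonempty → (G'.verts.card : ℝ) / 5 ≤ (G'.paths.ncard : ℝ)) ∧
        (∀ k, G.IsYes k → G'.verts.card ≤ 5 * 2 ^ k) ∧
        (∀ T ⊆ G'.verts, G'.IsTrackingSet T ↔ G'.TrackingSetCondition T)) := by
  -- One constant serves as the factor of the running time and as the exponent of the word bound.
  -- The size 5000 is needed only for the time; a small exponent would do.
  refine ⟨⟨RAM.block [RAM.kahn, RAM.decideSorted], 5000, fun n G L k hG hV hL => ?_⟩,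
    ⟨RAM.block [RAM.search, RAM.decideSorted], 5000, fun n G s t L k hL => ?_⟩,
    fun G _ T hT => hT.logb_ncard_le,
    fun G hG => ⟨hG.exists_reduced, fun G' h hr => hG.reduced_spec h hr⟩⟩
  · have hLn := fun v => (hL v).1
    have hM : ((List.range n).map (RAM.natLists L)).flatten.length = G.edges.card := by
      rw [RAM.length_flatten_natLists, RAM.sum_length_eq_card_edges hL]
    refine RAM.decidesWithin_of_sorted (M := G.edges.card) (by omega) ?_ (by rfl) fun A hA => ?_
    · refine (RAM.wp_kahn (n := n) (s := G.s) (t := G.t) rfl (RAM.init_adjAt _ _ _)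
        (RAM.natLists_spec hLn) ?_ (RAM.ofList_outEdges_isDAG hG fun v w => (hL v).2 w)
        (fun _ => rfl) rfl rfl rfl).mono ?_
      · rw [hM]
        refine lt_of_lt_of_le ?_ (Nat.pow_le_pow_right (by omega) (show 2 ≤ 5000 by norm_num))
        rw [sq]
        exact lt_of_lt_of_le (by omega) (Nat.mul_le_mul_left _ (show 2 ≤ _ by omega))
      · rintro σ τ ⟨⟨E, h1, h2, h3, h4⟩, hτ⟩
        rw [hM] at hτ
        refine ⟨⟨E, h1, h2, h3, fun e he => ?_, ?_, RAM.ofList_isYes_iff hV fun u v => ?_⟩, hτ⟩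
        · obtain ⟨u, v, rfl⟩ := RAM.mem_outEdges_natLists ((h4 e).1 he)
          exact ⟨u.2, v.2⟩
        · rw [← hM, ← RAM.length_outEdges]
          exact (h3.subperm fun e he => (h4 e).1 he).length_le
        · rw [h4, RAM.val_mem_outEdges, (hL u).2]
    · simp [RAM.kahn, RAM.countIn, RAM.pushSources, RAM.scan, RAM.kahnBody, RAM.emit, RAM.push,
        RAM.forLt, RAM.loop, RAM.block, RAM.Prog.keepsArr]
      omega
  · have hLn := fun v => (hL v).1
    have hM : ((List.range n).map (RAM.natLists L)).flatten.length = 2 * G.edgeSet.ncard := by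
      rw [RAM.length_flatten_natLists, RAM.sum_length_eq_two_mul hL]
    have hn := s.pos
    refine RAM.decidesWithin_of_sorted (M := 2 * G.edgeSet.ncard) le_rfl ?_ (by rfl) fun A hA => ?_
    · refine (RAM.wp_search (n := n) (s := s) rfl (RAM.init_adjAt _ _ _)
        (RAM.natLists_spec hLn) s.2 ?_ (fun _ => rfl) rfl rfl).mono ?_
      · rw [hM]
        refine lt_of_lt_of_le ?_ (Nat.pow_le_pow_right (by omega) (show 2 ≤ 5000 by norm_num))
        rw [sq]
        exact lt_of_lt_of_le (by omega) (Nat.mul_le_mul_left _ (show 3 ≤ _ by omega))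
      · rintro σ τ ⟨⟨E, f, h1, h2, h3, h4, h5, h6, h7⟩, hτ⟩
        rw [hM] at hτ
        have h4' : ∀ e ∈ E, e ∈ RAM.outEdges (RAM.natLists L) (List.range n) := fun e he => by
          rw [RAM.mem_outEdges, List.mem_range]
          exact ((h4 e).1 he).1
        have hlt : ∀ e ∈ E, e.1 < n ∧ e.2 < n := fun e he => by
          obtain ⟨u, v, rfl⟩ := RAM.mem_outEdges_natLists (h4' e he)
          exact ⟨u.2, v.2⟩
        refine ⟨⟨E, h1, h2, h3, hlt, ?_, ?_⟩, hτ⟩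
        · rw [← hM, ← RAM.length_outEdges]
          exact (h3.subperm h4').length_le
        · refine RAM.ofList_isYes_iff_shortest (f := fun v => f v) h5 (fun u v huv hu => ?_)
            (fun v hv => ?_) (fun u v => ?_) hlt h2
          · exact h6 u u.2 hu v (RAM.val_mem_natLists.2 (((hL u).2 v).2 huv))
          · rcases h7 v hv with h | ⟨u, hu, huv, h⟩
            · exact .inl (Fin.val_injective h)
            · lift u to Fin n using hu
              exact .inr ⟨u, ((hL u).2 v).1 (RAM.val_mem_natLists.1 huv), h⟩
          · rw [h4, RAM.val_mem_natLists, (hL u).2]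
            simp
    · simp [RAM.search, RAM.scan, RAM.searchBody, RAM.emit, RAM.push, RAM.loop, RAM.block,
        RAM.Prog.keepsArr]
      omega
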